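/- Let $k$ be a field of characteristic different from $2$ and let $A$ be a cocommutative Hopf algebra over $k$, with counit $\varepsilon$, coproduct $\Delta(a)=\sum a_1\otimes a_2$ and antipode $S$ (which is then automatically bijective). Let $H^*(A,k)=\operatorname{Ext}^*_A(k,k)$ be its Hopf algebra cohomology, where $A$ acts on $k$ through $\varepsilon$, and let $HH^*(A)=\operatorname{Ext}^*_{A^e}(A,A)$, $A^e=A\otimes_k A^{op}$, be its Hochschild cohomology with the Gerstenhaber bracket $[\ ,\ ]$, which is induced by $$[f,g]=f\circ g-(-1)^{(m-1)(n-1)}g\circ f,$$ $$(f\circ g)(a_1,\dots,a_{m+n-1})=\sum_{i=1}^{m}(-1)^{(i-1)(n-1)}f(a_1,\dots,a_{i-1},g(a_i,\dots,a_{i+n-1}),a_{i+n},\dots,a_{m+n-1})$$ on Hochschild cochains $f$, $g$ of degrees $m$, $n$. Let $$\iota: H^*(A,k)\to H^*(A,A^{ad})=\operatorname{Ext}^*_A(k,A^{ad})\cong HH^*(A)$$ be the embedding given by the unit map $k\to A^{ad}$ and the Eckmann-Shapiro isomorphism, where $A^{ad}$ is $A$ with the left adjoint action $a\cdot b=\sum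 a_1bS(a_2)$. The Gerstenhaber bracket of two elements of $H^*(A,k)$ is defined as the Gerstenhaber bracket of their images under $\iota$ in $HH^*(A)$. Then this bracket is zero in positive degrees: for all $m,n\ge 1$, all $\alpha\in H^m(A,k)$ and all $\beta\in H^n(A,k)$, one has $[\iota(\alpha),\iota(\beta)]=0$ in $HH^{m+n-1}(A)$. -/

import Mathlib

open scoped TensorProduct

universe u v w x

noncomputable section

namespace HopfGerstenhaber

/-! ## Cohomology of a cochain complex in degrees `0, 1, 2, …` -/

section Cohomology

variable {C : ℕ → Type w} [∀ n, AddCommGroup (C n)] (δ : ∀ n, C n →+ C (n + 1))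

/-- The cocycles of degree `n`. -/
def cocycles (n : ℕ) : AddSubgroup (C n) := (δ n).ker

/-- The coboundaries of degree `n` (only `0` in degree `0`). -/
def coboundaries : ∀ n : ℕ, AddSubgroup (C n)
  | 0 => ⊥
  | n + 1 => (δ n).range

/-- Cohomology: cocycles modulo coboundaries. -/
abbrev Cohomology (n : ℕ) : Type w :=
  cocycles δ n ⧸ (coboundaries δ n).addSubgroupOf (cocycles δ n)

/-- The class of a cocycle. -/
def cohClass {n : ℕ} (c : cocycles δ n) : Cohomology δ n :=
  QuotientAddGroup.mk' _ c

variable {C' : ℕ → Type x} [∀ n, AddCommGroup (C' n)] (δ' : ∀ n, C' n →+ C' (n + 1))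

variable {δ δ'} in
/-- The map on cohomology induced by a map of cochain complexes. -/
def cohMap (φ : ∀ n, C n →+ C' n) (hφ : ∀ n c, δ' n (φ n c) = φ (n + 1) (δ n c)) (n : ℕ) :
    Cohomology δ n →+ Cohomology δ' n :=
  QuotientAddGroup.map _ _
    (((φ n).comp (cocycles δ n).subtype).codRestrict (cocycles δ' n) (fun c => by
      have hc : δ n c.1 = 0 := c.2
      change δ' n (φ n c.1) = 0
      rw [hφ, hc, map_zero]))
    (by
      rintro ⟨c, hc⟩ h
      have h' : c ∈ coboundaries δ n := h
      change φ n c ∈ coboundaries δ' n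
      cases n with
      | zero =>
        have h0 : c = 0 := h'
        rw [h0, map_zero]
        exact zero_mem _
      | succ n =>
        obtain ⟨b, rfl⟩ := h'
        exact ⟨φ n b, hφ n b⟩)

end Cohomology

/-! ## Bimodules and the Hochschild complex -/

section Hochschild

variable (k : Type u) [Field k] (A : Type v) [Ring A] [Algebra k A]

/-- The enveloping algebra `Aᵉ = A ⊗ Aᵒᵖ`; left modules over it are `A`-bimodules. -/
abbrev Env : Type v := A ⊗[k] Aᵐᵒᵖ

/-- `A` as a bimodule over itself: `(x ⊗ op y) • b = x * (b * y)`. -/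
instance envModule : Module (Env k A) A := TensorProduct.Algebra.module

theorem env_smul_def (x : A) (y : Aᵐᵒᵖ) (b : A) :
    (x ⊗ₜ[k] y : Env k A) • b = x * (b * y.unop) := rfl

instance envTower : IsScalarTower k (Env k A) A where
  smul_assoc r e b := by
    change TensorProduct.Algebra.moduleAux _ _ = _ • TensorProduct.Algebra.moduleAux _ _
    simp

variable (M : Type w) [AddCommGroup M] [Module k M]

/-- Hochschild `n`-cochains with values in a bimodule: `k`-multilinear maps `Aⁿ → M`. -/
abbrev Cochain (n : ℕ) : Type (max v w) := MultilinearMap k (fun _ : Fin n => A) M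

variable {k A M}

/-- The arguments `(a₀, …, a_{i-1}, g (a_i, …, a_{i+n-1}), a_{i+n}, …)`. -/
def insertArg {m n N : ℕ} (h : N + 1 = m + n) (i : Fin m) (g : Cochain k A A n)
    (a : Fin N → A) : Fin m → A := fun j =>
  if hj : j.1 < i.1 then a ⟨j.1, by omega⟩
  else if hji : j = i then g fun l => a ⟨i.1 + l.1, by omega⟩
  else a ⟨j.1 + n - 1, by omega⟩

theorem insertArg_update {m n N : ℕ} (h : N + 1 = m + n) (i : Fin m) (g : Cochain k A A n)
    (a : Fin N → A) (t : Fin N) :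
    ∃ (j : Fin m) (L : A →ₗ[k] A), ∀ z : A,
      insertArg h i g (Function.update a t z) = Function.update (insertArg h i g a) j (L z) := by
  by_cases h1 : t.1 < i.1
  · refine ⟨⟨t.1, by omega⟩, LinearMap.id, fun z => ?_⟩
    funext j
    by_cases hj : j.1 = t.1
    · have hj0 : j = ⟨t.1, by omega⟩ := Fin.ext hj
      rw [hj0]
      simp [insertArg, h1]
    · have hj' : j ≠ ⟨t.1, by omega⟩ := fun e => hj (congrArg Fin.val e)
      rw [Function.update_of_ne hj']
      unfold insertArg
      split_ifs with h2 h3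
      · exact Function.update_of_ne (fun e => hj (congrArg Fin.val e)) _ _
      · congr 1
        funext l
        exact Function.update_of_ne (fun e => by have := congrArg Fin.val e; simp at this; omega) _ _
      · have h4 : j.1 ≠ i.1 := fun e => h3 (Fin.ext e)
        exact Function.update_of_ne (fun e => by have := congrArg Fin.val e; simp at this; omega) _ _
  · by_cases h2 : t.1 < i.1 + n
    · have hl : t.1 - i.1 < n := by omega
      refine ⟨i, g.toLinearMap (fun l => a ⟨i.1 + l.1, by omega⟩) ⟨t.1 - i.1, hl⟩, fun z => ?_⟩
      funext j
      by_cases hj : j = i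
      · subst hj
        simp only [insertArg, lt_irrefl, dite_false, dite_true, Function.update_self,
          MultilinearMap.toLinearMap_apply]
        congr 1
        funext l
        by_cases hlt : l.1 = t.1 - j.1
        · obtain rfl : l = ⟨t.1 - j.1, hl⟩ := Fin.ext hlt
          have : (⟨j.1 + (t.1 - j.1), by omega⟩ : Fin N) = t := Fin.ext (by simp; omega)
          rw [Function.update_self]
          simp [this]
        · have q1 : (⟨j.1 + l.1, by omega⟩ : Fin N) ≠ t :=
            fun e => by have := congrArg Fin.val e; simp at this; omega
          have q2 : l ≠ ⟨t.1 - j.1, hl⟩ := fun e => hlt (congrArg Fin.val e)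
          rw [Function.update_of_ne q1, Function.update_of_ne q2]
      · rw [Function.update_of_ne hj]
        have h4 : j.1 ≠ i.1 := fun e => hj (Fin.ext e)
        unfold insertArg
        split_ifs with h3
        · exact Function.update_of_ne
            (fun e => by have := congrArg Fin.val e; simp at this; omega) _ _
        · exact Function.update_of_ne
            (fun e => by have := congrArg Fin.val e; simp at this; omega) _ _
    · refine ⟨⟨t.1 + 1 - n, by omega⟩, LinearMap.id, fun z => ?_⟩
      funext j
      by_cases hj : j.1 = t.1 + 1 - n
      · have hj0 : j = ⟨t.1 + 1 - n, by omega⟩ := Fin.ext hj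
        rw [hj0]
        have e1 : ¬ (t.1 + 1 - n < i.1) := by omega
        have e2 : (⟨t.1 + 1 - n, by omega⟩ : Fin m) ≠ i :=
          fun e => by have := congrArg Fin.val e; simp at this; omega
        have e3 : (⟨t.1 + 1 - n + n - 1, by omega⟩ : Fin N) = t := Fin.ext (by simp; omega)
        simp [insertArg, e1, e2, e3]
      · rw [Function.update_of_ne (fun e => hj (congrArg Fin.val e))]
        unfold insertArg
        split_ifs with h3 h4
        · exact Function.update_of_ne
            (fun e => by have := congrArg Fin.val e; simp at this; omega) _ _
        · congr 1
          funext l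
          exact Function.update_of_ne
            (fun e => by have := congrArg Fin.val e; simp at this; omega) _ _
        · have h5 : j.1 ≠ i.1 := fun e => h4 (Fin.ext e)
          exact Function.update_of_ne
            (fun e => by have := congrArg Fin.val e; simp at this; omega) _ _

/-- Partial composition: `g` is plugged into the (zero-based) `i`-th slot of `f`,
`(a₀, …) ↦ f (a₀, …, a_{i-1}, g (a_i, …, a_{i+n-1}), a_{i+n}, …)`. -/
def insertAt {m n N : ℕ} (h : N + 1 = m + n) (i : Fin m)
    (f : Cochain k A M m) (g : Cochain k A A n) : Cochain k A M N where
  toFun a := f (insertArg h i g a)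
  map_update_add' {inst} a t x y := by
    obtain rfl : inst = instDecidableEqFin N := Subsingleton.elim _ _
    obtain ⟨j, L, hL⟩ := insertArg_update h i g a t
    simp only [hL, map_add, MultilinearMap.map_update_add]
  map_update_smul' {inst} a t r x := by
    obtain rfl : inst = instDecidableEqFin N := Subsingleton.elim _ _
    obtain ⟨j, L, hL⟩ := insertArg_update h i g a t
    simp only [hL, map_smul, MultilinearMap.map_update_smul]

theorem insertAt_apply {m n N : ℕ} (h : N + 1 = m + n) (i : Fin m)
    (f : Cochain k A M m) (g : Cochain k A A n) (a : Fin N → A) :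
    insertAt h i f g a = f (insertArg h i g a) := rfl

variable [Module (Env k A) M] [IsScalarTower k (Env k A) M]

/-- Left multiplication on a bimodule, `x ↦ (b ↦ x b)`. -/
def leftAct : A →ₗ[k] M →ₗ[k] M :=
  (Algebra.lsmul k k M : Env k A →ₐ[k] Module.End k M).toLinearMap ∘ₗ
    (Algebra.TensorProduct.includeLeft : A →ₐ[k] Env k A).toLinearMap

/-- Right multiplication on a bimodule, `y ↦ (b ↦ b y)`. -/
def rightAct : A →ₗ[k] M →ₗ[k] M :=
  (Algebra.lsmul k k M : Env k A →ₐ[k] Module.End k M).toLinearMap ∘ₗ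
    (Algebra.TensorProduct.includeRight : Aᵐᵒᵖ →ₐ[k] Env k A).toLinearMap ∘ₗ
      (MulOpposite.opLinearEquiv k).toLinearMap

/-- `(a₀, …, aₙ) ↦ a₀ c (a₁, …, aₙ)`. -/
def leftTerm {n : ℕ} (c : Cochain k A M n) : Cochain k A M (n + 1) :=
  LinearMap.uncurryLeft (M := fun _ : Fin (n + 1) => A)
    { toFun := fun a => (leftAct a).compMultilinearMap c
      map_add' := fun a b => by ext; simp
      map_smul' := fun r a => by ext; simp }

/-- `(a₀, …, aₙ) ↦ c (a₀, …, a_{n-1}) aₙ`. -/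
def rightTerm {n : ℕ} (c : Cochain k A M n) : Cochain k A M (n + 1) :=
  MultilinearMap.uncurryRight (M := fun _ : Fin (n + 1) => A)
    ((rightAct (k := k) (A := A) (M := M)).flip.compMultilinearMap c)

theorem leftTerm_apply {n : ℕ} (c : Cochain k A M n) (a : Fin (n + 1) → A) :
    leftTerm c a = (a 0 ⊗ₜ[k] 1 : Env k A) • c fun i => a i.succ := rfl

theorem rightTerm_apply {n : ℕ} (c : Cochain k A M n) (a : Fin (n + 1) → A) :
    rightTerm c a =
      (1 ⊗ₜ[k] MulOpposite.op (a (Fin.last n)) : Env k A) • c fun i => a i.castSucc := rfl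

/-- `(a₀, …, aₙ) ↦ c (a₀, …, aᵢ aᵢ₊₁, …, aₙ)`. -/
def mulTerm {n : ℕ} (i : Fin n) (c : Cochain k A M n) : Cochain k A M (n + 1) :=
  insertAt (n := 2) rfl i c (MultilinearMap.mkPiAlgebraFin k 2 A)

variable (k A M) in
/-- The Hochschild differential
`(δ c)(a₀, …, aₙ) = a₀ c (a₁, …, aₙ) + ∑ᵢ (-1)ⁱ⁺¹ c (…, aᵢ aᵢ₊₁, …) + (-1)ⁿ⁺¹ c (a₀, …, a_{n-1}) aₙ`. -/
def hochschildD (n : ℕ) : Cochain k A M n →+ Cochain k A M (n + 1) where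
  toFun c := leftTerm c + ∑ i : Fin n, (-1 : k) ^ (i.1 + 1) • mulTerm i c
    + (-1 : k) ^ (n + 1) • rightTerm c
  map_zero' := by
    ext a
    simp [leftTerm_apply, rightTerm_apply, mulTerm, insertAt_apply]
  map_add' c c' := by
    ext a
    simp only [add_apply, sum_apply, smul_apply,
      leftTerm_apply, rightTerm_apply, mulTerm, insertAt_apply, smul_add, Finset.sum_add_distrib]
    abel

theorem hochschildD_apply {n : ℕ} (c : Cochain k A M n) (a : Fin (n + 1) → A) :
    hochschildD k A M n c a = (a 0 ⊗ₜ[k] 1 : Env k A) • c (fun i => a i.succ)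
      + ∑ i : Fin n, (-1 : k) ^ (i.1 + 1) •
          c (insertArg (n := 2) rfl i (MultilinearMap.mkPiAlgebraFin k 2 A) a)
      + (-1 : k) ^ (n + 1) •
          (1 ⊗ₜ[k] MulOpposite.op (a (Fin.last n)) : Env k A) • c (fun i => a i.castSucc) := by
  simp [hochschildD, leftTerm_apply, rightTerm_apply, mulTerm, insertAt_apply]

variable (k A) in
/-- Hochschild cohomology `HHⁿ(A) = Extⁿ_{Aᵉ}(A, A)`, as the cohomology of Hochschild cochains. -/
abbrev HH (n : ℕ) : Type v := Cohomology (hochschildD k A A) n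

/-- The circle product `f ∘ g = ∑ᵢ (-1)^(i (n-1)) f ∘ᵢ g` of cochains of degrees `m` and `n`,
a cochain of degree `N = m + n - 1` (note that `n + 1` and `n - 1` have the same parity). -/
def circ {m n N : ℕ} (h : N + 1 = m + n) (f : Cochain k A A m) (g : Cochain k A A n) :
    Cochain k A A N :=
  ∑ i : Fin m, (-1 : k) ^ (i.1 * (n + 1)) • insertAt h i f g

/-- The Gerstenhaber bracket of cochains, `[f, g] = f ∘ g - (-1)^((m-1)(n-1)) g ∘ f`. -/
def cochainBracket {m n N : ℕ} (h : N + 1 = m + n) (f : Cochain k A A m) (g : Cochain k A A n) :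
    Cochain k A A N :=
  circ h f g - (-1 : k) ^ ((m + 1) * (n + 1)) • circ (h.trans (Nat.add_comm m n)) g f

/-- `z ∈ HH^{m+n-1}(A)` is the Gerstenhaber bracket of `x ∈ HHᵐ(A)` and `y ∈ HHⁿ(A)`: it is
the class of the bracket of cocycles that represent `x` and `y`. -/
def IsGerstenhaberBracket {m n N : ℕ} (h : N + 1 = m + n)
    (x : HH k A m) (y : HH k A n) (z : HH k A N) : Prop :=
  ∃ (f : cocycles (hochschildD k A A) m) (g : cocycles (hochschildD k A A) n)
    (b : cocycles (hochschildD k A A) N),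
    cohClass _ f = x ∧ cohClass _ g = y ∧ b.1 = cochainBracket h f.1 g.1 ∧ cohClass _ b = z

/-! ### The bar resolution of the bimodule `A` -/

variable (k A) in
/-- The bar resolution in degree `n`: the free `Aᵉ`-module on `A^{⊗n}`, that is
`A ⊗ A^{⊗n} ⊗ A` with the last factor moved next to the first. -/
abbrev Bar (n : ℕ) : Type (max u v) := Env k A ⊗[k] (⨂[k] _ : Fin n, A)

/-- The bimodule map `Barₙ → M`, `x ⊗ (a₁, …, aₙ) ⊗ y ↦ x c(a₁, …, aₙ) y`, that corresponds
to the cochain `c`. -/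
def barExtend {n : ℕ} (c : Cochain k A M n) : Bar k A n →ₗ[Env k A] M :=
  TensorProduct.AlgebraTensorModule.lift
    (LinearMap.toSpanSingleton (Env k A) ((⨂[k] _ : Fin n, A) →ₗ[k] M) (PiTensorProduct.lift c))

theorem barExtend_tmul {n : ℕ} (c : Cochain k A M n) (e : Env k A) (a : Fin n → A) :
    barExtend c (e ⊗ₜ PiTensorProduct.tprod k a) = e • c a := by
  simp [barExtend]

variable (k A) in
/-- The universal cochain `(a₁, …, aₙ) ↦ 1 ⊗ (a₁, …, aₙ) ⊗ 1`. -/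
def barUniv (n : ℕ) : Cochain k A (Bar k A n) n :=
  (TensorProduct.mk k (Env k A) (⨂[k] _ : Fin n, A) 1).compMultilinearMap (PiTensorProduct.tprod k)

theorem barExtend_zero {n : ℕ} : barExtend (0 : Cochain k A M n) = 0 := by
  apply TensorProduct.AlgebraTensorModule.ext
  intro e t
  simp [barExtend]

theorem barExtend_add {n : ℕ} (c c' : Cochain k A M n) :
    barExtend (c + c') = barExtend c + barExtend c' := by
  apply TensorProduct.AlgebraTensorModule.ext
  intro e t
  simp [barExtend]

theorem barExtend_barUniv {n : ℕ} (c : Cochain k A M n) (a : Fin n → A) :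
    barExtend c (barUniv k A n a) = c a :=
  (barExtend_tmul c 1 a).trans (one_smul _ _)

theorem barExtend_smul {n : ℕ} (c : Cochain k A M n) (r : k) (b : Bar k A n) :
    barExtend c (r • b) = r • barExtend c b :=
  LinearMap.map_smul_of_tower (barExtend c) r b

variable (k A) in
/-- The bar differential
`1 ⊗ (a₀, …, aₙ) ⊗ 1 ↦ a₀ ⊗ (a₁, …, aₙ) ⊗ 1 + ∑ᵢ (-1)ⁱ⁺¹ 1 ⊗ (…, aᵢ aᵢ₊₁, …) ⊗ 1
  + (-1)ⁿ⁺¹ 1 ⊗ (a₀, …, a_{n-1}) ⊗ aₙ`. -/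
def barD (n : ℕ) : Bar k A (n + 1) →ₗ[Env k A] Bar k A n :=
  barExtend (hochschildD k A (Bar k A n) n (barUniv k A n))

variable (k A) in
/-- The augmentation `x ⊗ () ⊗ y ↦ x y` of the bar resolution. -/
def barAug : Bar k A 0 →ₗ[Env k A] A :=
  barExtend (MultilinearMap.constOfIsEmpty k (fun _ : Fin 0 => A) 1)

theorem barExtend_barD {n : ℕ} (c : Cochain k A M n) :
    barExtend c ∘ₗ barD k A n = barExtend (hochschildD k A M n c) := by
  have key : ∀ a : Fin (n + 1) → A,
      barExtend c (hochschildD k A (Bar k A n) n (barUniv k A n) a) = hochschildD k A M n c a := by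
    intro a
    simp only [hochschildD_apply, map_add, map_sum, barExtend_smul, map_smul, barExtend_barUniv]
  apply TensorProduct.AlgebraTensorModule.ext
  intro e t
  induction t using PiTensorProduct.induction_on with
  | smul_tprod r a =>
    simp only [TensorProduct.tmul_smul, LinearMap.comp_apply, barExtend_smul, barD, barExtend_tmul,
      map_smul, key]
  | add x y hx hy => rw [TensorProduct.tmul_add, map_add, map_add, hx, hy]

end Hochschild

/-! ## Hopf algebra cohomology and its embedding into Hochschild cohomology -/

section Hopf

variable (k : Type u) [Field k] (A : Type v) [Ring A] [HopfAlgebra k A]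

/-- The trivial `A`-module `k`. -/
def Triv (_A : Type v) : Type u := k

instance : AddCommGroup (Triv k A) := inferInstanceAs (AddCommGroup k)

/-- `a • c = ε(a) c`. -/
instance : Module A (Triv k A) :=
  Module.compHom k (Bialgebra.counitAlgHom k A).toRingHom

/-- The embedding `A → Aᵉ`, `a ↦ ∑ a₁ ⊗ S(a₂)`. -/
def deltaHom : A →ₐ[k] Env k A :=
  (Algebra.TensorProduct.map (AlgHom.id k A) (HopfAlgebra.antipodeAlgHomOp k A)).comp
    (Bialgebra.comulAlgHom k A)

/-- A bimodule `M` as a left `A`-module by restriction along `a ↦ ∑ a₁ ⊗ S(a₂)`, that is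
`a • b = ∑ a₁ b S(a₂)`. In particular `Ad k A A` is the left adjoint module. -/
def Ad (_k : Type u) (_A : Type v) (M : Type w) : Type w := M

instance (M : Type w) [AddCommGroup M] : AddCommGroup (Ad k A M) :=
  inferInstanceAs (AddCommGroup M)

instance (M : Type w) [AddCommGroup M] [Module (Env k A) M] : Module A (Ad k A M) :=
  Module.compHom M (deltaHom k A).toRingHom

variable {k A} in
/-- A bimodule map, regarded as a map of restricted `A`-modules. -/
def adMap {M : Type w} {N : Type x} [AddCommGroup M] [Module (Env k A) M]
    [AddCommGroup N] [Module (Env k A) N] (f : M →ₗ[Env k A] N) : Ad k A M →ₗ[A] Ad k A N where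
  toFun := f
  map_add' := f.map_add
  map_smul' a m := f.map_smul (deltaHom k A a) m

theorem deltaHom_smul_algebraMap (a : A) (c : k) :
    deltaHom k A a • algebraMap k A c =
      algebraMap k A (Coalgebra.counit a) * algebraMap k A c := by
  have key : ∀ t : A ⊗[k] A,
      (Algebra.TensorProduct.map (AlgHom.id k A) (HopfAlgebra.antipodeAlgHomOp k A) t : Env k A) •
        algebraMap k A c =
      LinearMap.mul' k A ((HopfAlgebra.antipode k).lTensor A t) * algebraMap k A c := by
    intro t
    induction t with
    | zero => simp
    | add x y hx hy => rw [map_add, add_smul, hx, hy, map_add, map_add, add_mul]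
    | tmul x y =>
      rw [Algebra.TensorProduct.map_tmul, env_smul_def]
      simp [mul_assoc, Algebra.commutes]
  have h := key (Coalgebra.comul a)
  rw [HopfAlgebra.mul_antipode_lTensor_comul_apply] at h
  exact h

/-- The unit map `k → A`, which is `A`-linear from the trivial to the adjoint module. -/
def unitMap : Triv k A →ₗ[A] Ad k A A where
  toFun c := algebraMap k A c
  map_add' := (algebraMap k A).map_add
  map_smul' a (c : k) := by
    change algebraMap k A (Coalgebra.counit (R := k) a * c) = deltaHom k A a • algebraMap k A c
    rw [deltaHom_smul_algebraMap, map_mul]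

/-- A projective resolution `⋯ → X₁ → X₀ → k → 0` of the trivial `A`-module. -/
structure ProjRes where
  X : ℕ → Type w
  [addCommGroup : ∀ n, AddCommGroup (X n)]
  [module : ∀ n, Module A (X n)]
  projective : ∀ n, Module.Projective A (X n)
  d : ∀ n, X (n + 1) →ₗ[A] X n
  aug : X 0 →ₗ[A] Triv k A
  aug_surjective : Function.Surjective aug
  exact_aug : Function.Exact (d 0) aug
  exact_d : ∀ n, Function.Exact (d (n + 1)) (d n)

attribute [instance] ProjRes.addCommGroup ProjRes.module

variable {k A}

/-- The differential `f ↦ f ∘ d` of the complex `Hom_A(P, M)`. -/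
def homD (P : ProjRes.{u, v, w} k A) (M : Type x) [AddCommGroup M] [Module A M] (n : ℕ) :
    (P.X n →ₗ[A] M) →+ (P.X (n + 1) →ₗ[A] M) where
  toFun f := f ∘ₗ P.d n
  map_zero' := LinearMap.zero_comp _
  map_add' _ _ := LinearMap.add_comp _ _ _

/-- `Hⁿ(A, M) = Extⁿ_A(k, M)`, computed by the projective resolution `P` of `k`. -/
abbrev HopfCoh (P : ProjRes.{u, v, w} k A) (M : Type x) [AddCommGroup M] [Module A M] (n : ℕ) :
    Type (max w x) :=
  Cohomology (homD P M) n

/-- The map `η_* : Hⁿ(A, k) → Hⁿ(A, A^{ad})` induced by the unit map. -/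
def unitCoh (P : ProjRes.{u, v, w} k A) (n : ℕ) :
    HopfCoh P (Triv k A) n →+ HopfCoh P (Ad k A A) n :=
  cohMap
    (fun _ =>
      { toFun := fun f => unitMap k A ∘ₗ f
        map_zero' := LinearMap.comp_zero _
        map_add' := fun _ _ => LinearMap.comp_add _ _ _ })
    (fun _ _ => rfl) n

/-- A chain map of `A`-modules from `P` to the restricted bar resolution that lifts the unit map
`k → A^{ad}`; it is unique up to homotopy. -/
structure UnitLift (P : ProjRes.{u, v, w} k A) where
  hom : ∀ n, P.X n →ₗ[A] Ad k A (Bar k A n)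
  comm : ∀ n, adMap (barD k A n) ∘ₗ hom (n + 1) = hom n ∘ₗ P.d n
  comm_aug : adMap (barAug k A) ∘ₗ hom 0 = unitMap k A ∘ₗ P.aug

/-- The Eckmann-Shapiro isomorphism `HHⁿ(A) = Extⁿ_{Aᵉ}(A, A) ≅ Extⁿ_A(k, A^{ad})`: restriction of
a cocycle `Barₙ → A` along `a ↦ ∑ a₁ ⊗ S(a₂)`, followed by pull back along `k → A^{ad}`. -/
def shapiro {P : ProjRes.{u, v, w} k A} (L : UnitLift P) (n : ℕ) :
    HH k A n →+ HopfCoh P (Ad k A A) n :=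
  cohMap
    (fun n =>
      { toFun := fun c => adMap (barExtend c) ∘ₗ L.hom n
        map_zero' := by
          rw [barExtend_zero]
          rfl
        map_add' := fun c c' => by
          rw [barExtend_add]
          rfl })
    (fun n c => by
      change (adMap (barExtend c) ∘ₗ L.hom n) ∘ₗ P.d n =
        adMap (barExtend (hochschildD k A A n c)) ∘ₗ L.hom (n + 1)
      rw [← barExtend_barD, LinearMap.comp_assoc, ← L.comm]
      rfl) n

/-- `x ∈ HHⁿ(A)` is the image of `α ∈ Hⁿ(A, k)` under the embedding
`Hⁿ(A, k) → Hⁿ(A, A^{ad}) ≅ HHⁿ(A)` given by the unit map and the Eckmann-Shapiro isomorphism. -/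
def IsHochschildImage {P : ProjRes.{u, v, w} k A} {n : ℕ}
    (α : HopfCoh P (Triv k A) n) (x : HH k A n) : Prop :=
  ∃ L : UnitLift P, shapiro L n x = unitCoh P n α

/-- `z` is the Gerstenhaber bracket of the Hopf algebra cohomology classes `α` and `β`:
the Gerstenhaber bracket in Hochschild cohomology of their images under the embedding. -/
def IsHopfBracket {P : ProjRes.{u, v, w} k A} {m n N : ℕ} (h : N + 1 = m + n)
    (α : HopfCoh P (Triv k A) m) (β : HopfCoh P (Triv k A) n) (z : HH k A N) : Prop :=
  ∃ (x : HH k A m) (y : HH k A n),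
    IsHochschildImage α x ∧ IsHochschildImage β y ∧ IsGerstenhaberBracket h x y z

end Hopf

end HopfGerstenhaber

end

universe y z

/-!
Let `g` be the Hochschild cocycle that represents the image of a class of `H^n(A, k)`. Its values
satisfy `Δ(g(a₁, …, aₙ)) = ∑ a₁' ⋯ aₙ' ⊗ g(a₁'', …, aₙ'')`. The bar resolution of `A` maps to the
resolution `P ⊗ A` of `A` by bimodules (here cocommutativity enters), and the displayed identity
makes it possible to define the bracket of `g` with this chain map in such a way that composition
with the bimodule map `P_m ⊗ A → A` of a cocycle `p : P_m → k` gives the Gerstenhaber bracket of the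
cocycle of `p` with `g`. Bracketing with a cocycle commutes with the differential up to sign. Hence
the bracket of `g` with the chain map is itself a chain map of positive degree up to sign, it starts
with a boundary, and `P ⊗ A` is exact, so it is null-homotopic. Composed with `p` it is a coboundary.
-/

noncomputable section

namespace HopfGerstenhaber

section Words

variable {k A M M' : Type*} [CommRing k] [AddCommGroup M] [Module k M] [AddCommGroup M']
  [Module k M']

/-- The sum of `H w (G v)` over all factorizations `l = v ++ w`. -/
def cutSum (H : List A → M →ₗ[k] M') (G : List A → M) : List A → M'
  | [] => H [] (G [])
  | a :: l => H (a :: l) (G []) + cutSum H (fun v => G (a :: v)) l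

/-- The sum of `s ^ |u| • F u w (G v)` over all factorizations `l = u ++ v ++ w`: the insertion of
`G` into the marked slot of `F`. -/
def insertSum (s : k) (F : List A → List A → M →ₗ[k] M') (G : List A → M) : List A → M'
  | [] => F [] [] (G [])
  | a :: l => cutSum (F []) G (a :: l) + s • insertSum s (fun u => F (a :: u)) G l

theorem isLinearMap_cutSum_left (G : List A → M) (l : List A) :
    IsLinearMap k fun H : List A → M →ₗ[k] M' => cutSum H G l := by
  induction l generalizing G with
  | nil => exact ⟨fun _ _ => rfl, fun _ _ => rfl⟩
  | cons a l ih =>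
    refine ⟨fun H H' => ?_, fun r H => ?_⟩
    · simp only [cutSum, (ih _).map_add, Pi.add_apply, LinearMap.add_apply]
      abel
    · simp only [cutSum, (ih _).map_smul, Pi.smul_apply, LinearMap.smul_apply, smul_add]

theorem isLinearMap_cutSum_right (H : List A → M →ₗ[k] M') (l : List A) :
    IsLinearMap k fun G : List A → M => cutSum H G l := by
  induction l with
  | nil => exact ⟨fun _ _ => map_add _ _ _, fun _ _ => map_smul _ _ _⟩
  | cons a l ih =>
    refine ⟨fun G G' => ?_, fun r G => ?_⟩
    · have := ih.map_add (fun v => G (a :: v)) fun v => G' (a :: v)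
      simp only [cutSum, Pi.add_apply, map_add]
      rw [add_add_add_comm, ← this]
      rfl
    · have := ih.map_smul r fun v => G (a :: v)
      simp only [cutSum, Pi.smul_apply, map_smul, smul_add]
      rw [← this]
      rfl

theorem isLinearMap_insertSum_left (s : k) (G : List A → M) (l : List A) :
    IsLinearMap k fun F : List A → List A → M →ₗ[k] M' => insertSum s F G l := by
  induction l with
  | nil => exact ⟨fun _ _ => rfl, fun _ _ => rfl⟩
  | cons a l ih =>
    refine ⟨fun F F' => ?_, fun r F => ?_⟩
    · have := ih.map_add (fun u => F (a :: u)) fun u => F' (a :: u)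
      simp only [insertSum, Pi.add_apply, (isLinearMap_cutSum_left G (a :: l)).map_add]
      rw [add_add_add_comm, ← smul_add, ← this]
      rfl
    · have := ih.map_smul r fun u => F (a :: u)
      simp only [insertSum, Pi.smul_apply, (isLinearMap_cutSum_left G (a :: l)).map_smul]
      rw [smul_add, smul_comm r, ← this]
      rfl

theorem isLinearMap_insertSum_right (s : k) (F : List A → List A → M →ₗ[k] M') (l : List A) :
    IsLinearMap k fun G : List A → M => insertSum s F G l := by
  induction l generalizing F with
  | nil => exact ⟨fun _ _ => map_add _ _ _, fun _ _ => map_smul _ _ _⟩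
  | cons a l ih =>
    exact ((isLinearMap_cutSum_right (F []) (a :: l)).mk' +
      s • (ih fun u => F (a :: u)).mk').isLinear

theorem cutSum_sub_left (H H' : List A → M →ₗ[k] M') (G : List A → M) (l : List A) :
    cutSum (fun w => H w - H' w) G l = cutSum H G l - cutSum H' G l :=
  (isLinearMap_cutSum_left G l).map_sub H H'

theorem cutSum_sub_right (H : List A → M →ₗ[k] M') (G G' : List A → M) (l : List A) :
    cutSum H (fun v => G v - G' v) l = cutSum H G l - cutSum H G' l :=
  (isLinearMap_cutSum_right H l).map_sub G G'

theorem insertSum_sub_left (s : k) (F F' : List A → List A → M →ₗ[k] M') (G : List A → M)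
    (l : List A) : insertSum s (fun u w => F u w - F' u w) G l =
      insertSum s F G l - insertSum s F' G l :=
  (isLinearMap_insertSum_left s G l).map_sub F F'

theorem cutSum_comp_left {N : Type*} [AddCommGroup N] [Module k N] (H : List A → M →ₗ[k] M')
    (g : N →ₗ[k] M) (G : List A → N) (l : List A) :
    cutSum H (fun v => g (G v)) l = cutSum (fun w => H w ∘ₗ g) G l := by
  induction l generalizing G with
  | nil => rfl
  | cons a l ih => simp only [cutSum, ih, LinearMap.comp_apply]

theorem insertSum_comp_left {N : Type*} [AddCommGroup N] [Module k N] (s : k)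
    (F : List A → List A → M →ₗ[k] M') (g : N →ₗ[k] M) (G : List A → N) (l : List A) :
    insertSum s F (fun v => g (G v)) l = insertSum s (fun u w => F u w ∘ₗ g) G l := by
  induction l generalizing F with
  | nil => rfl
  | cons a l ih => simp only [insertSum, cutSum_comp_left, ih]

theorem map_cutSum {N : Type*} [AddCommGroup N] [Module k N] (g : M' →ₗ[k] N)
    (H : List A → M →ₗ[k] M') (G : List A → M) (l : List A) :
    g (cutSum H G l) = cutSum (fun w => g ∘ₗ H w) G l := by
  induction l generalizing G with
  | nil => rfl
  | cons a l ih => simp only [cutSum, map_add, ih, LinearMap.comp_apply]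

theorem map_insertSum {N : Type*} [AddCommGroup N] [Module k N] (g : M' →ₗ[k] N) (s : k)
    (F : List A → List A → M →ₗ[k] M') (G : List A → M) (l : List A) :
    g (insertSum s F G l) = insertSum s (fun u w => g ∘ₗ F u w) G l := by
  induction l generalizing F with
  | nil => rfl
  | cons a l ih => simp only [insertSum, map_add, map_smul, map_cutSum, ih]

/-- `s` is the sign `(-1) ^ (n + 1)` of the degree `n` in which `G` is concentrated. -/
def HasSign (s : k) (G : List A → M) : Prop := ∀ v, s • G v = (-1 : k) ^ (v.length + 1) • G v

theorem HasSign.cons {s : k} {G : List A → M} (hG : HasSign s G) (a : A) :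
    HasSign (-s) fun v => G (a :: v) := by
  intro v
  rw [neg_smul, hG (a :: v), ← neg_smul, List.length_cons, pow_succ (-1 : k) (v.length + 1)]
  simp

theorem HasSign.nil {s : k} {G : List A → M} (hG : HasSign s G) : s • G [] = -G [] := by
  simpa using hG []

/-- The function `f` vanishes off the words of length `n`. -/
def ConcentratedIn (n : ℕ) (f : List A → M) : Prop := ∀ l, l.length ≠ n → f l = 0

theorem ConcentratedIn.hasSign {n : ℕ} {f : List A → M} (hf : ConcentratedIn n f) :
    HasSign ((-1 : k) ^ (n + 1)) f := by
  intro v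
  by_cases hv : v.length = n
  · rw [hv]
  · rw [hf v hv, smul_zero, smul_zero]

theorem cutSum_ite_nil (b : M →ₗ[k] M') (G : List A → M) (l : List A) :
    cutSum (fun w => if w = [] then b else 0) G l = b (G l) := by
  induction l generalizing G with
  | nil => rfl
  | cons a l ih => simp [cutSum, ih]

theorem insertSum_ite_nil_left (s : k) (H : List A → M →ₗ[k] M') (G : List A → M) (l : List A) :
    insertSum s (fun u w => if u = [] then H w else 0) G l = cutSum H G l := by
  rcases l with - | ⟨a, l⟩
  · rfl
  · have := (isLinearMap_insertSum_left (M' := M') s G l).map_zero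
    simp only [insertSum, reduceCtorEq, if_true, if_false]
    exact (congrArg _ (smul_eq_zero_of_right s this)).trans (add_zero _)

theorem insertSum_ite_nil_right {N : Type*} [AddCommGroup N] [Module k N] (s r : k)
    (B : N →ₗ[k] M →ₗ[k] M') {n : ℕ} {f : List A → N} (hf : ConcentratedIn n f) (G : List A → M)
    (l : List A) : insertSum s (fun u w => if w = [] then r • B (f u) else 0) G l =
      (s ^ n * r) • cutSum (fun w => B.flip (G w)) f l := by
  induction l generalizing f n with
  | nil =>
    rcases n with - | n
    · simp [insertSum, cutSum]
    · simp [hf [] (Nat.succ_ne_zero n).symm, insertSum, cutSum]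
  | cons a l ih =>
    rcases n with - | n
    · have hfa : ∀ u, f (a :: u) = 0 := fun u => hf _ (Nat.succ_ne_zero _)
      have insert_zero : insertSum s (fun _ _ => (0 : M →ₗ[k] M')) G l = 0 :=
        (isLinearMap_insertSum_left s G l).map_zero
      have cut_zero : cutSum (fun w => B.flip (G w)) (fun _ => 0) l = 0 :=
        (isLinearMap_cutSum_right _ l).map_zero
      simp [insertSum, cutSum, cutSum_ite_nil, hfa, insert_zero, cut_zero]
    · have := ih (f := fun u => f (a :: u)) (n := n) fun u hu => hf _ (by simpa using hu)
      simp only [insertSum, cutSum, cutSum_ite_nil, this, hf [] (Nat.succ_ne_zero n).symm]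
      simp [pow_succ', mul_smul]

variable [Ring A]

/-- The alternating sum `f (a₀a₁, …) - f (a₀, a₁a₂, …) + ⋯ ± e (a₀, …, aₙ₋₁) aₙ` of the contractions
of the word `a₀ ⋯ aₙ`, given as first letter and tail; `e` supplies the end term. -/
def contract (f : List A → M) (e : List A → A → M) : A → List A → M
  | a, [] => e [] a
  | a, b :: l => f (a * b :: l) - contract (fun u => f (a :: u)) (fun u => e (a :: u)) b l

theorem contract_sub (f f' : List A → M) (e e' : List A → A → M) (a : A) (l : List A) :
    contract (fun u => f u - f' u) (fun u x => e u x - e' u x) a l =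
      contract f e a l - contract f' e' a l := by
  induction l generalizing f f' e e' a with
  | nil => rfl
  | cons b l ih => simp only [contract, ih]; abel

theorem contract_add (f f' : List A → M) (e e' : List A → A → M) (a : A) (l : List A) :
    contract (fun u => f u + f' u) (fun u x => e u x + e' u x) a l =
      contract f e a l + contract f' e' a l := by
  induction l generalizing f f' e e' a with
  | nil => rfl
  | cons b l ih => simp only [contract, ih]; abel

theorem map_contract (g : M →ₗ[k] M') (f : List A → M) (e : List A → A → M) (a : A) (l : List A) :
    g (contract f e a l) = contract (fun u => g (f u)) (fun u x => g (e u x)) a l := by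
  induction l generalizing f e a with
  | nil => rfl
  | cons b l ih => simp only [contract, map_sub, ih]

theorem contract_smul (r : k) (f : List A → M) (e : List A → A → M) (a : A) (l : List A) :
    contract (fun u => r • f u) (fun u x => r • e u x) a l = r • contract f e a l :=
  (map_contract (LinearMap.lsmul k M r) f e a l).symm

/-- The Hochschild differential on functions of words, for an `A`-bimodule structure on `M` given
by the left and right multiplications `L` and `R`; there is no summation over degrees, since the
value at a word of length `n + 1` only involves values at words of length `n`. -/
def wordD (L R : A → Module.End k M) (f : List A → M) : List A → M
  | [] => 0
  | a :: l => L a (f l) - contract f (fun u x => R x (f u)) a l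

/-- The part of the Hochschild differential of a marked function that does not contract letters
before the marked slot, `H w m` being the value at the word `w` with `m` put in front of it. -/
def tailD (R : A → Module.End k M) (R' : A → Module.End k M') (H : List A → M →ₗ[k] M') :
    List A → M →ₗ[k] M'
  | [] => 0
  | b :: w => H w ∘ₗ R b - contract H (fun u x => R' x ∘ₗ H u) b w

/-- The contractions of the word `a :: u`, `m`, `w` in which a letter before the marked slot is
involved. -/
def headContract (L R : A → Module.End k M) (R' : A → Module.End k M')
    (F : List A → List A → M →ₗ[k] M') (a : A) (u w : List A) : M →ₗ[k] M' :=
  contract (fun v => F v w) (fun v x => F v w ∘ₗ L x - tailD R R' (F (v ++ [x])) w) a u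

/-- The Hochschild differential of a function of words with a marked slot in `M`: `F u w m` is the
value at the word `u`, `m`, `w`. -/
def markedD (L R : A → Module.End k M) (L' R' : A → Module.End k M')
    (F : List A → List A → M →ₗ[k] M') : List A → List A → M →ₗ[k] M'
  | [], w => -tailD R R' (F []) w
  | a :: u, w => L' a ∘ₗ F u w - headContract L R R' F a u w

theorem smul_tailD_cons (R : A → Module.End k M) (R' : A → Module.End k M')
    (H : List A → M →ₗ[k] M') {s : k} {m : M} (hm : s • m = -m) (b : A) (w : List A) :
    s • tailD R R' H (b :: w) m =
      contract (fun u => H u m) (fun u x => R' x (H u m)) b w - H w (R b m) := by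
  have := map_contract (LinearMap.applyₗ m) H (fun u x => R' x ∘ₗ H u) b w
  rw [← map_smul, hm, map_neg, tailD, LinearMap.sub_apply, neg_sub]
  exact congrArg (· - H w (R b m)) this

theorem contract_cutSum (R : A → Module.End k M) (R' : A → Module.End k M')
    (H : List A → M →ₗ[k] M') {G : List A → M} {s : k} (hG : HasSign s G) (a : A) (l : List A) :
    contract (cutSum H G) (fun u x => R' x (cutSum H G u)) a l =
      s • cutSum (tailD R R' H) G (a :: l) +
        cutSum H (contract G (fun u x => R x (G u)) a) l := by
  induction l generalizing a G s with
  | nil =>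
    simp only [cutSum, smul_add, smul_tailD_cons R R' H hG.nil]
    simp [contract, cutSum, tailD]
  | cons b l ih =>
    have split : contract (fun u => cutSum H G (a :: u))
        (fun u x => R' x (cutSum H G (a :: u))) b l =
        contract (fun u => H (a :: u) (G [])) (fun u x => R' x (H (a :: u) (G []))) b l +
        contract (cutSum H fun v => G (a :: v))
          (fun u x => R' x (cutSum H (fun v => G (a :: v)) u)) b l := by
      simp only [cutSum, map_add, contract_add]
    have expand : cutSum (tailD R R' H) G (a :: b :: l) = tailD R R' H (a :: b :: l) (G []) +
      cutSum (tailD R R' H) (fun v => G (a :: v)) (b :: l) := rfl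
    rw [contract, split, ih (hG.cons a), expand, smul_add, smul_tailD_cons R R' H hG.nil]
    simp only [cutSum, contract, cutSum_sub_right, neg_smul]
    abel

theorem cutSum_wordD (L R : A → Module.End k M) (H : List A → M →ₗ[k] M') (G : List A → M) (a : A)
    (l : List A) : cutSum H (wordD L R G) (a :: l) =
      cutSum (fun w => H w ∘ₗ L a) G l - cutSum H (contract G (fun u x => R x (G u)) a) l := by
  simp only [cutSum, wordD, cutSum_sub_right, map_zero, zero_add, cutSum_comp_left]

theorem contract_insertSum (L R : A → Module.End k M) (R' : A → Module.End k M')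
    (F : List A → List A → M →ₗ[k] M') {G : List A → M} {s : k} (hs : s * s = 1)
    (hG : HasSign s G) (a : A) (l : List A) :
    contract (insertSum s F G) (fun u x => R' x (insertSum s F G u)) a l =
      insertSum s (headContract L R R' F a) G l + s • cutSum (tailD R R' (F [])) G (a :: l)
        - cutSum (F []) (wordD L R G) (a :: l)
        + s • insertSum (-s) (fun u => F (a :: u)) (wordD L R G) l := by
  have head (F : List A → List A → M →ₗ[k] M') (a : A) : headContract L R R' F a [] =
    fun w => F [] w ∘ₗ L a - tailD R R' (F [a]) w := rfl
  induction l generalizing F a with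
  | nil =>
    have hm := hG.nil
    simp only [insertSum, contract, head]
    simp [cutSum, wordD, tailD, contract, smul_sub, ← map_smul, hm]
  | cons b l ih =>
    have split : contract (fun u => insertSum s F G (a :: u))
        (fun u x => R' x (insertSum s F G (a :: u))) b l =
        contract (fun u => cutSum (F []) G (a :: u))
          (fun u x => R' x (cutSum (F []) G (a :: u))) b l +
        s • contract (insertSum s (fun u => F (a :: u)) G)
          (fun u x => R' x (insertSum s (fun u => F (a :: u)) G u)) b l := by
      simp only [insertSum, map_add, contract_add, map_smul, contract_smul]
    have cutF := contract_cutSum R R' (F []) hG a (b :: l)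
    have hsum := cutSum_wordD L R (F []) G a (b :: l)
    have head_cons : (fun u => headContract L R R' F a (b :: u)) = fun u w =>
        F (a * b :: u) w - headContract L R R' (fun u => F (a :: u)) b u w := rfl
    rw [contract] at cutF
    rw [contract, split, ih, hsum]
    simp only [insertSum, head, head_cons, cutSum_sub_left, insertSum_sub_left]
    linear_combination (norm := module) cutF - hs • cutSum (tailD R R' (F [a])) G (b :: l)

theorem wordD_insertSum (L R : A → Module.End k M) (L' R' : A → Module.End k M')
    (F : List A → List A → M →ₗ[k] M') {G : List A → M} {s : k} (hs : s * s = 1)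
    (hG : HasSign s G) (l : List A) :
    wordD L' R' (insertSum s F G) l =
      s • insertSum s (markedD L R L' R' F) G l + insertSum (-s) F (wordD L R G) l := by
  cases l with
  | nil => simp [wordD, insertSum, markedD, tailD]
  | cons a l =>
    have hD : (fun u => markedD L R L' R' F (a :: u)) = fun u w =>
        L' a ∘ₗ F u w - headContract L R R' F a u w := rfl
    have neg : cutSum (fun w => -tailD R R' (F []) w) G (a :: l) =
        -cutSum (tailD R R' (F [])) G (a :: l) :=
      (map_cutSum (-LinearMap.id) (tailD R R' (F [])) G (a :: l)).symm
    rw [wordD, contract_insertSum L R R' F hs hG, insertSum, insertSum, hD, insertSum_sub_left,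
      map_insertSum]
    rw [show cutSum (markedD L R L' R' F []) G (a :: l) = _ from neg]
    linear_combination (norm := module) -hs •
      (insertSum s (fun u w => L' a ∘ₗ F u w) G l - insertSum s (headContract L R R' F a) G l)

end Words

section LetterLinear

variable {k A M : Type*} [CommRing k] [Ring A] [AddCommGroup M] [Module k M]

theorem contract_contract {R : A → Module.End k M} (hR : ∀ x y, R (x * y) = R y * R x)
    (f : List A → M) (a b : A) (l : List A) :
    contract (contract f (fun u x => R x (f u)) a)
        (fun u x => R x (contract f (fun u x => R x (f u)) a u)) b l =
      contract f (fun u x => R x (f u)) (a * b) l := by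
  induction l generalizing f a b with
  | nil => simp [contract, hR]
  | cons c l ih =>
    have expand : contract (fun u => contract f (fun u x => R x (f u)) a (b :: u))
        (fun u x => R x (contract f (fun u x => R x (f u)) a (b :: u))) c l =
        contract (fun u => f (a * b :: u)) (fun u x => R x (f (a * b :: u))) c l -
        contract (fun u => f (a :: u)) (fun u x => R x (f (a :: u))) (b * c) l := by
      simp only [contract, map_sub, contract_sub, ih]
    rw [contract, expand]
    simp only [contract, mul_assoc, sub_sub_sub_cancel_right]

theorem wordD_wordD {L R : A → Module.End k M} (hL : ∀ x y, L (x * y) = L x * L y)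
    (hR : ∀ x y, R (x * y) = R y * R x) (hLR : ∀ x y, L x * R y = R y * L x) (f : List A → M) :
    wordD L R (wordD L R f) = 0 := by
  funext l
  rcases l with - | ⟨a, - | ⟨b, l⟩⟩
  · rfl
  · simp [wordD, contract]
  · have left : contract (fun u => L a (f u)) (fun u x => R x (L a (f u))) b l =
        L a (contract f (fun u x => R x (f u)) b l) := by
      simp only [map_contract, ← Module.End.mul_apply, hLR]
    have := contract_contract hR f a b l
    simp only [wordD, contract, map_sub, contract_sub, left, this, hL, Module.End.mul_apply,
      Pi.zero_apply]
    abel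

theorem isLinearMap_contract {N : Type*} [AddCommGroup N] [Module k N] {f : N → List A → M}
    {e : N → List A → A → M} (hf : ∀ u, IsLinearMap k fun n => f n u)
    (he : ∀ u x, IsLinearMap k fun n => e n u x) (a : A) (l : List A) :
    IsLinearMap k fun n => contract (f n) (e n) a l := by
  convert (contract (fun u => (hf u).mk') (fun u x => (he u x).mk') a l).isLinear using 2 with n
  exact (map_contract (LinearMap.applyₗ n : (N →ₗ[k] M) →ₗ[k] M) (fun u => (hf u).mk')
    (fun u x => (he u x).mk') a l).symm

theorem isLinearMap_wordD (L R : A → Module.End k M) (l : List A) :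
    IsLinearMap k fun f : List A → M => wordD L R f l := by
  rcases l with - | ⟨a, l⟩
  · exact (0 : (List A → M) →ₗ[k] M).isLinear
  · exact (L a ∘ₗ LinearMap.proj l - (isLinearMap_contract (fun u => (LinearMap.proj u).isLinear)
      (fun u x => (R x ∘ₗ LinearMap.proj u).isLinear) a l).mk').isLinear

variable [Algebra k A]

variable (k A M) in
/-- The functions of words that are linear in each letter: their restrictions to the words of
length `n` are the Hochschild `n`-cochains. -/
def letterLinear : Submodule k (List A → M) where
  carrier := {f | ∀ u w, IsLinearMap k fun x => f (u ++ x :: w)}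
  add_mem' {f g} (hf : ∀ u w, IsLinearMap k fun x => f (u ++ x :: w))
      (hg : ∀ u w, IsLinearMap k fun x => g (u ++ x :: w)) u w :=
    ((hf u w).mk' + (hg u w).mk').isLinear
  zero_mem' _ _ := (0 : A →ₗ[k] M).isLinear
  smul_mem' r _ hf u w := (r • (hf u w).mk').isLinear

variable {f : List A → M}

theorem mem_letterLinear_iff : f ∈ letterLinear k A M ↔
    (∀ w, IsLinearMap k fun x => f (x :: w)) ∧ ∀ a, (fun w => f (a :: w)) ∈ letterLinear k A M :=
  ⟨fun h => ⟨h [], fun a u => h (a :: u)⟩, fun h u => u.casesOn h.1 fun a u => h.2 a u⟩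

/-- The function of words obtained from `f` by fixing the first letter. -/
def fixLetter : A →ₗ[k] letterLinear k A M →ₗ[k] letterLinear k A M :=
  LinearMap.mk₂ k (fun a f => ⟨fun w => f.1 (a :: w), (mem_letterLinear_iff.1 f.2).2 a⟩)
    (fun a b f => Subtype.ext (funext fun w => (f.2 [] w).map_add a b))
    (fun r a f => Subtype.ext (funext fun w => (f.2 [] w).map_smul r a))
    (fun _ _ _ => rfl) (fun _ _ _ => rfl)

/-- The letter-linear function `f` with a marked letter, `mark f u w x = f (u ++ x :: w)`. -/
def mark (f : letterLinear k A M) (u w : List A) : A →ₗ[k] M := (f.2 u w).mk'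

/-- All contractions of a letter-linear function, with end term `e`. -/
def contractWord (f : List A → M) (e : List A → A → M) : List A → M
  | [] => 0
  | a :: l => contract f e a l

theorem contractWord_mem (hf : f ∈ letterLinear k A M) {e : List A → A → M}
    (he : ∀ x, (fun u => e u x) ∈ letterLinear k A M) (he' : ∀ u, IsLinearMap k (e u)) :
    contractWord f e ∈ letterLinear k A M := by
  have first : ∀ {f : List A → M} {e : List A → A → M}, f ∈ letterLinear k A M →
      (∀ x, (fun u => e u x) ∈ letterLinear k A M) → (∀ u, IsLinearMap k (e u)) →
      ∀ w, IsLinearMap k fun x => contract f e x w := by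
    intro f e hf he he' w
    rcases w with - | ⟨b, w⟩
    · exact he' []
    · simp only [contract]
      have product : IsLinearMap k fun x => f (x * b :: w) :=
        ((hf [] w).mk' ∘ₗ LinearMap.mulRight k b).isLinear
      have rest := isLinearMap_contract (fun u => hf [] u) (fun u x => he x [] u) b w
      exact (product.mk' - rest.mk').isLinear
  suffices later : ∀ (u : List A) {f : List A → M} {e : List A → A → M}, f ∈ letterLinear k A M →
      (∀ x, (fun u => e u x) ∈ letterLinear k A M) → (∀ u, IsLinearMap k (e u)) →
      ∀ a w, IsLinearMap k fun x => contract f e a (u ++ x :: w) from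
    fun u w => u.casesOn (first hf he he' w) fun a u => later u hf he he' a w
  intro u
  induction u with
  | nil =>
    intro f e hf he he' a w
    have product : IsLinearMap k fun x => f (a * x :: w) :=
      ((hf [] w).mk' ∘ₗ LinearMap.mulLeft k a).isLinear
    have rest := first ((mem_letterLinear_iff.1 hf).2 a)
      (fun x => (mem_letterLinear_iff.1 (he x)).2 a) (fun u => he' (a :: u)) w
    exact (product.mk' - rest.mk').isLinear
  | cons b u ih =>
    intro f e hf he he' a w
    have rest := ih ((mem_letterLinear_iff.1 hf).2 a)
      (fun x => (mem_letterLinear_iff.1 (he x)).2 a) (fun u => he' (a :: u)) b w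
    exact ((hf (a * b :: u) w).mk' - rest.mk').isLinear

theorem wordD_mem (L R : A →ₗ[k] Module.End k M) (hf : f ∈ letterLinear k A M) :
    wordD L R f ∈ letterLinear k A M := by
  have hc := contractWord_mem (e := fun u x => R x (f u)) hf
    (fun x u w => (R x ∘ₗ (hf u w).mk').isLinear) fun u => (R.flip (f u)).isLinear
  intro u w
  rcases u with - | ⟨a, u⟩
  · exact (L.flip (f w) - (hc [] w).mk').isLinear
  · exact (L a ∘ₗ (hf u w).mk' - (hc (a :: u) w).mk').isLinear

/-- The Hochschild differential on letter-linear functions of words. -/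
def letterD (L R : A →ₗ[k] Module.End k M) : letterLinear k A M →ₗ[k] letterLinear k A M where
  toFun f := ⟨wordD L R f.1, wordD_mem L R f.2⟩
  map_add' f g := Subtype.ext (funext fun l => (isLinearMap_wordD L R l).map_add f.1 g.1)
  map_smul' r f := Subtype.ext (funext fun l => (isLinearMap_wordD L R l).map_smul r f.1)

section Mark

variable (R : A → Module.End k M) (f : letterLinear k A M)

theorem contract_eq_tailD (x : A) (w : List A) :
    contract f.1 (fun u y => R y (f.1 u)) x w = tailD (LinearMap.mulRight k) R (mark f []) w x +
      if w = [] then R x (f.1 []) else 0 := by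
  rcases w with - | ⟨b, w⟩
  · simp [contract, tailD]
  · have := map_contract (LinearMap.applyₗ x) (mark f []) (fun u y => R y ∘ₗ mark f [] u) b w
    simp only [tailD, LinearMap.sub_apply, contract, if_neg (List.cons_ne_nil b w), add_zero]
    exact congrArg (f.1 (x * b :: w) - ·) this.symm

theorem contract_eq_headContract (a x : A) (u w : List A) :
    contract f.1 (fun u y => R y (f.1 u)) a (u ++ x :: w) =
      headContract (LinearMap.mulLeft k) (LinearMap.mulRight k) R (mark f) a u w x +
        if w = [] then (-1 : k) ^ (u.length + 1) • R x (f.1 (a :: u)) else 0 := by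
  induction u generalizing f a with
  | nil =>
    have tail : contract (fun u => f.1 (a :: u)) (fun u y => R y (f.1 (a :: u))) x w =
        tailD (LinearMap.mulRight k) R (mark f [a]) w x + if w = [] then R x (f.1 [a]) else 0 :=
      contract_eq_tailD R (fixLetter a f) x w
    have head : headContract (LinearMap.mulLeft k) (LinearMap.mulRight k) R (mark f) a [] w x =
        f.1 (a * x :: w) - tailD (LinearMap.mulRight k) R (mark f [a]) w x := rfl
    rw [List.nil_append, contract, tail, head]
    split_ifs
    · simp only [List.length_nil, zero_add, pow_one, neg_smul, one_smul]
      module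
    · simp
  | cons b u ih =>
    have tail : contract (fun v => f.1 (a :: v)) (fun v y => R y (f.1 (a :: v))) b (u ++ x :: w) =
        headContract (LinearMap.mulLeft k) (LinearMap.mulRight k) R (fun v => mark f (a :: v)) b u
          w x + if w = [] then (-1 : k) ^ (u.length + 1) • R x (f.1 (a :: b :: u)) else 0 :=
      ih (fixLetter a f) b
    have head : headContract (LinearMap.mulLeft k) (LinearMap.mulRight k) R (mark f) a (b :: u) w x
        = f.1 (a * b :: (u ++ x :: w)) - headContract (LinearMap.mulLeft k) (LinearMap.mulRight k) R
          (fun v => mark f (a :: v)) b u w x := rfl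
    rw [List.cons_append, contract, tail, head, List.length_cons, pow_succ (-1 : k) (u.length + 1)]
    split_ifs
    · simp only [mul_neg, mul_one, neg_smul]
      module
    · simp

theorem wordD_mark (L : A → Module.End k M) (u w : List A) (x : A) :
    wordD L R f.1 (u ++ x :: w) =
      markedD (LinearMap.mulLeft k) (LinearMap.mulRight k) L R (mark f) u w x +
        (if u = [] then L x (f.1 w) else 0) +
        if w = [] then (-1 : k) ^ (u.length + 1) • R x (f.1 u) else 0 := by
  rcases u with - | ⟨a, u⟩
  · rw [List.nil_append, wordD, contract_eq_tailD, markedD, if_pos rfl]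
    split_ifs
    · simp only [LinearMap.neg_apply, List.length_nil, zero_add, pow_one, neg_smul, one_smul]
      module
    · simp only [add_zero, LinearMap.neg_apply]
      module
  · rw [List.cons_append, wordD, contract_eq_headContract, markedD, List.length_cons,
      if_neg (List.cons_ne_nil a u), pow_succ (-1 : k) (u.length + 1)]
    split_ifs
    · simp only [mark, LinearMap.sub_apply, LinearMap.coe_comp, Function.comp_apply,
        IsLinearMap.mk'_apply, add_zero, mul_neg, mul_one, neg_smul]
      module
    · simp [mark]

end Mark

end LetterLinear

section Bracket

variable {k A M M' : Type*} [CommRing k] [Ring A] [Algebra k A] [AddCommGroup M] [Module k M]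
  [AddCommGroup M'] [Module k M']

theorem cutSum_mem {H : List A → M →ₗ[k] M'} (hH : H ∈ letterLinear k A (M →ₗ[k] M'))
    {G : List A → M} (hG : G ∈ letterLinear k A M) : cutSum H G ∈ letterLinear k A M' := by
  intro u
  induction u generalizing G with
  | nil =>
    exact fun w => (LinearMap.applyₗ (G []) ∘ₗ (hH [] w).mk' + (isLinearMap_cutSum_right H w).mk' ∘ₗ
      LinearMap.pi fun v => (hG [] v).mk').isLinear
  | cons a u ih =>
    exact fun w => (LinearMap.applyₗ (G []) ∘ₗ (hH (a :: u) w).mk' +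
      (ih ((mem_letterLinear_iff.1 hG).2 a) w).mk').isLinear

theorem insertSum_mem (s : k) {F : List A → List A → M →ₗ[k] M'}
    (hF : ∀ u, F u ∈ letterLinear k A (M →ₗ[k] M'))
    (hF' : ∀ w, (fun u => F u w) ∈ letterLinear k A (M →ₗ[k] M'))
    {G : List A → M} (hG : G ∈ letterLinear k A M) : insertSum s F G ∈ letterLinear k A M' := by
  intro u
  induction u generalizing F with
  | nil =>
    exact fun w => ((cutSum_mem (hF []) hG [] w).mk' + s • (isLinearMap_insertSum_left s G w).mk' ∘ₗ
      LinearMap.pi fun u => LinearMap.pi fun v => (hF' v [] u).mk').isLinear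
  | cons a u ih =>
    exact fun w => ((cutSum_mem (hF []) hG (a :: u) w).mk' + s • (ih (fun u => hF (a :: u))
      (fun v => (mem_letterLinear_iff.1 (hF' v)).2 a) w).mk').isLinear

variable (m n : ℕ) (F : List A → List A → M →ₗ[k] M) (g : List A → A)

/-- The bracket of `c` (in degree `m`) and `g` (in degree `n`), where the insertion of the values
of `c` into `g` is by means of `F`, the result of marking a slot of `g`. -/
def wordBracket (c : letterLinear k A M) (l : List A) : M :=
  insertSum ((-1 : k) ^ (n + 1)) (mark c) g l -
    (-1 : k) ^ ((m + 1) * (n + 1)) • insertSum ((-1 : k) ^ (m + 1)) F c.1 l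

variable {m n F g}

theorem insertSum_markedD_mark (L R : A →ₗ[k] Module.End k M) (s : k) (g : List A → A)
    {c : letterLinear k A M} (hc : ConcentratedIn m c.1) (l : List A) :
    insertSum s (markedD (LinearMap.mulLeft k) (LinearMap.mulRight k) L R (mark c)) g l =
      insertSum s (mark (letterD L R c)) g l - cutSum (fun w => L.flip (c.1 w)) g l -
        (s ^ m * (-1) ^ (m + 1)) • cutSum (fun w => R (g w)) c.1 l := by
  have marked : markedD (LinearMap.mulLeft k) (LinearMap.mulRight k) L R (mark c) = fun u w =>
      mark (letterD L R c) u w - (if u = [] then L.flip (c.1 w) else 0) -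
        if w = [] then (-1 : k) ^ (m + 1) • R.flip (c.1 u) else 0 := by
    funext u w
    ext x
    have := wordD_mark R c L u w x
    have hm : (-1 : k) ^ (u.length + 1) • c.1 u = (-1 : k) ^ (m + 1) • c.1 u := (hc.hasSign u).symm
    simp only [← map_smul, hm] at this
    have hx : mark (letterD L R c) u w x = wordD L R c.1 (u ++ x :: w) := rfl
    simp only [LinearMap.sub_apply, hx, this]
    split_ifs <;> simp only [map_smul, LinearMap.smul_apply, LinearMap.flip_apply,
      LinearMap.zero_apply] <;> abel
  rw [marked, insertSum_sub_left, insertSum_sub_left, insertSum_ite_nil_left,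
    insertSum_ite_nil_right s _ R.flip hc]
  rfl

variable {L R : A →ₗ[k] Module.End k M}

theorem insertSum_markedD_eq_neg_cutSum (hg : ConcentratedIn n g)
    (hF : markedD L R L R F = fun u w => -(if u = [] then R (g w) else 0) -
      if w = [] then (-1 : k) ^ (n + 1) • L (g u) else 0) (t : k) (c : List A → M) (l : List A) :
    insertSum t (markedD L R L R F) c l = -cutSum (fun w => R (g w)) c l -
      (t ^ n * (-1) ^ (n + 1)) • cutSum (fun w => L.flip (c w)) g l := by
  have neg : insertSum t (fun u w => -(if u = [] then R (g w) else 0)) c l =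
      -cutSum (fun w => R (g w)) c l := by
    rw [← insertSum_ite_nil_left t]
    exact (isLinearMap_insertSum_left t c l).map_neg _
  rw [hF, insertSum_sub_left, neg, insertSum_ite_nil_right t _ L hg]

/-- For fixed `g`, bracketing with `g` is a chain map up to sign: the cup products with `g` in the
two insertion formulas cancel. -/
theorem wordD_wordBracket (hg : ConcentratedIn n g)
    (hδ : wordD (LinearMap.mulLeft k) (LinearMap.mulRight k) g = 0)
    (hF : markedD L R L R F = fun u w => -(if u = [] then R (g w) else 0) -
      if w = [] then (-1 : k) ^ (n + 1) • L (g u) else 0)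
    (c : letterLinear k A M) (hc : ConcentratedIn m c.1) (l : List A) :
    wordD L R (wordBracket m n F g c) l =
      (-1 : k) ^ (n + 1) • wordBracket (m + 1) n F g (letterD L R c) l := by
  have sq (i : ℕ) : (-1 : k) ^ i * (-1) ^ i = 1 := by rw [← mul_pow]; simp
  have insert_c := wordD_insertSum (LinearMap.mulLeft k) (LinearMap.mulRight k) L R (mark c) (sq _)
    hg.hasSign l
  have insert_F := wordD_insertSum L R L R F (sq _) hc.hasSign l
  have insert_zero : insertSum (-(-1) ^ (n + 1)) (mark c) 0 l = 0 :=
    (isLinearMap_insertSum_right _ _ l).map_zero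
  rw [insertSum_markedD_mark L R _ g hc, hδ, insert_zero] at insert_c
  rw [insertSum_markedD_eq_neg_cutSum hg hF] at insert_F
  have expand := (isLinearMap_wordD L R l).map_sub (insertSum ((-1) ^ (n + 1)) (mark c) g)
    ((-1 : k) ^ ((m + 1) * (n + 1)) • insertSum ((-1) ^ (m + 1)) F c.1)
  rw [(isLinearMap_wordD L R l).map_smul, insert_c, insert_F] at expand
  refine expand.trans ?_
  have hc' : (letterD L R c).1 = wordD L R c.1 := rfl
  have hs := sq (n + 1)
  have hκ := sq ((m + 1) * (n + 1))
  have hκs : (-1 : k) ^ ((m + 1) * (n + 1)) = ((-1) ^ (n + 1)) ^ m * (-1) ^ (n + 1) := by ring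
  have hκt : (-1 : k) ^ ((m + 1) * (n + 1)) = ((-1) ^ (m + 1)) ^ n * (-1) ^ (m + 1) := by ring
  rw [wordBracket, hc', show (-1 : k) ^ ((m + 1 + 1) * (n + 1)) =
    (-1) ^ ((m + 1) * (n + 1)) * (-1) ^ (n + 1) by ring, pow_succ (-1 : k) (m + 1), mul_neg_one]
  generalize (-1 : k) ^ ((m + 1) * (n + 1)) = κ at *
  generalize (-1 : k) ^ (n + 1) = s at *
  generalize (-1 : k) ^ (m + 1) = t at *
  linear_combination (norm := module)
    (s * hκ - s * κ * hκt) • cutSum (fun w => L.flip (c.1 w)) g l +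
      (t * hκs) • cutSum (fun w => R (g w)) c.1 l +
      (κ * hs) • insertSum (-t) F (wordD L R c.1) l

end Bracket

section Sums

variable {k A M M' : Type*} [CommRing k] [AddCommGroup M] [Module k M] [AddCommGroup M']
  [Module k M']

theorem cutSum_eq_ite {n : ℕ} (H : List A → M →ₗ[k] M') {G : List A → M}
    (hG : ConcentratedIn n G) (l : List A) :
    cutSum H G l = if n ≤ l.length then H (l.drop n) (G (l.take n)) else 0 := by
  induction l generalizing n G with
  | nil =>
    rcases n with - | n
    · rfl
    · exact (congrArg (H []) (hG [] (by simp))).trans (map_zero _)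
  | cons a l ih =>
    rw [cutSum]
    rcases n with - | n
    · rw [ih (n := 0) fun v _ => hG (a :: v) (by simp)]
      simp [hG [a] (by simp)]
    · rw [ih (n := n) fun v hv => hG (a :: v) (by simpa using hv), hG [] (by simp)]
      simp

theorem insertSum_eq_sum_range {n : ℕ} (s : k) (F : List A → List A → M →ₗ[k] M') {G : List A → M}
    (hG : ConcentratedIn n G) (l : List A) : insertSum s F G l =
      ∑ i ∈ Finset.range (l.length + 1 - n),
        s ^ i • F (l.take i) (l.drop (i + n)) (G ((l.drop i).take n)) := by
  induction l generalizing F with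
  | nil =>
    rcases n with - | n
    · simp [insertSum]
    · rw [insertSum, hG [] (by simp)]
      simp
  | cons a l ih =>
    rw [insertSum, ih, cutSum_eq_ite _ hG]
    split_ifs with hn
    · obtain ⟨r, hr⟩ : ∃ r, l.length + 1 = r + n :=
        ⟨l.length + 1 - n, (Nat.sub_add_cancel (by simpa using hn)).symm⟩
      rw [List.length_cons, hr, Nat.add_sub_cancel, show r + n + 1 - n = r + 1 by omega,
        Finset.sum_range_succ' _ r, Finset.smul_sum, add_comm]
      simp [pow_succ', mul_smul, add_right_comm _ 1 n]
    · rw [List.length_cons, not_le] at hn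
      simp [show l.length + 1 - n = 0 by omega, show l.length + 1 + 1 - n = 0 by omega]

end Sums

section Cochains

variable {k : Type u} [Field k] {A : Type v} [Ring A] [Algebra k A] {M : Type w} [AddCommGroup M]
  [Module k M]

omit [Ring A] in
theorem exists_ofFn_update {n : ℕ} (a : Fin n → A) (i : Fin n) :
    ∃ u w, ∀ x, List.ofFn (Function.update a i x) = u ++ x :: w := by
  refine ⟨(List.ofFn a).take i, (List.ofFn a).drop (i + 1), fun x => ?_⟩
  rw [← List.set_eq_take_append_cons_drop.trans (if_pos (by simp))]
  apply List.ext_getElem (by simp)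
  intro j hj _
  by_cases h : j = i
  · subst h; simp
  · have : (⟨j, by simpa using hj⟩ : Fin n) ≠ i := fun e => h (congrArg Fin.val e)
    simp [Ne.symm h, Function.update_of_ne this]

/-- The restriction of a letter-linear function to the words of length `n`. -/
def toCochain (n : ℕ) : letterLinear k A M →ₗ[k] Cochain k A M n where
  toFun f :=
    { toFun := fun a => f.1 (List.ofFn a)
      map_update_add' := fun {inst} a i x y => by
        obtain rfl : inst = instDecidableEqFin n := Subsingleton.elim _ _
        obtain ⟨u, w, h⟩ := exists_ofFn_update a i
        simp only [h, (f.2 u w).map_add]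
      map_update_smul' := fun {inst} a i r x => by
        obtain rfl : inst = instDecidableEqFin n := Subsingleton.elim _ _
        obtain ⟨u, w, h⟩ := exists_ofFn_update a i
        simp only [h, (f.2 u w).map_smul] }
  map_add' _ _ := rfl
  map_smul' _ _ := rfl

theorem toCochain_apply {n : ℕ} (f : letterLinear k A M) (a : Fin n → A) :
    toCochain n f a = f.1 (List.ofFn a) := rfl

/-- The extension of a Hochschild cochain by zero to the words of all lengths. -/
def ofCochain {n : ℕ} (c : Cochain k A M n) : letterLinear k A M where
  val l := if h : l.length = n then c fun i => l[i.1] else 0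
  property u w := by
    by_cases h : (u ++ (0 : A) :: w).length = n
    · have hu : u.length < n := by simp at h; omega
      refine (congrArg (IsLinearMap k) (funext fun x => ?_)).mpr
        (c.toLinearMap (fun i => (u ++ (0 : A) :: w)[i.1]) ⟨u.length, hu⟩).isLinear
      refine (dif_pos (by simpa using h)).trans ?_
      rw [MultilinearMap.toLinearMap_apply]
      congr 1
      funext i
      by_cases hi : i = ⟨u.length, hu⟩
      · subst hi
        simp
      · obtain hlt | hlt := Nat.lt_or_gt_of_ne fun e => hi (Fin.ext e)
        · simp [Function.update_of_ne hi, List.getElem_append_left hlt]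
        · obtain ⟨j, hj⟩ : ∃ j, i.1 - u.length = j + 1 :=
            ⟨i.1 - u.length - 1, (Nat.sub_add_cancel (Nat.sub_pos_of_lt hlt)).symm⟩
          simp [Function.update_of_ne hi, List.getElem_append_right hlt.le,
            show i.1 - u.length = j + 1 from hj]
    · refine (congrArg (IsLinearMap k) (funext fun x => ?_)).mpr (0 : A →ₗ[k] M).isLinear
      exact dif_neg (by simpa using h)

theorem concentratedIn_ofCochain {n : ℕ} (c : Cochain k A M n) :
    ConcentratedIn n (ofCochain c).1 :=
  fun _ hl => dif_neg hl

theorem toCochain_ofCochain {n : ℕ} (c : Cochain k A M n) : toCochain n (ofCochain c) = c := by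
  ext a
  exact (dif_pos (List.length_ofFn)).trans (by simp)

theorem ofFn_insertArg {m n N : ℕ} (h : N + 1 = m + n) (i : Fin m) (g : Cochain k A A n)
    (a : Fin N → A) :
    List.ofFn (insertArg h i g a) = (List.ofFn a).take i.1 ++
      g (fun l => a ⟨i.1 + l.1, by omega⟩) :: (List.ofFn a).drop (i.1 + n) := by
  apply List.ext_getElem
  · simp
    omega
  · intro j hj _
    rw [List.length_ofFn] at hj
    simp only [List.getElem_ofFn, List.getElem_append, List.length_take, List.length_ofFn,
      List.getElem_take]
    unfold insertArg
    rcases lt_trichotomy j i.1 with before | at_slot | after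
    · rw [dif_pos before, dif_pos (by omega)]
    · subst at_slot
      rw [dif_neg (lt_irrefl _), dif_pos rfl, dif_neg (by omega)]
      simp only [min_eq_left (show i.1 ≤ N by omega), Nat.sub_self, List.getElem_cons_zero]
    · rw [dif_neg (by simpa using after.le), dif_neg (fun e => after.ne' (congrArg Fin.val e)),
        dif_neg (by omega)]
      obtain ⟨r, hr⟩ : ∃ r, j = i.1 + r + 1 := ⟨j - i.1 - 1, by omega⟩
      have index : j - min i.1 N = r + 1 := by omega
      simp only [index, List.getElem_cons_succ, List.getElem_drop, List.getElem_ofFn]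
      congr 2
      omega

theorem contract_ofFn (f : List A → M) (e : List A → A → M) {n : ℕ} (a : Fin (n + 1) → A) :
    contract f e (a 0) (List.ofFn (Fin.tail a)) =
      ∑ i : Fin n, (-1 : k) ^ i.1 •
        f (List.ofFn (insertArg (n := 2) rfl i (MultilinearMap.mkPiAlgebraFin k 2 A) a)) +
      (-1 : k) ^ n • e (List.ofFn (Fin.init a)) (a (Fin.last n)) := by
  induction n generalizing f e with
  | zero => simp [contract]
  | succ n ih =>
    have := ih (fun u => f (a 0 :: u)) (fun u => e (a 0 :: u)) (Fin.tail a)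
    have step : contract f e (a 0) (List.ofFn (Fin.tail a)) =
        f (a 0 * a 1 :: List.ofFn (Fin.tail (Fin.tail a))) -
          contract (fun u => f (a 0 :: u)) (fun u => e (a 0 :: u)) (Fin.tail a 0)
            (List.ofFn (Fin.tail (Fin.tail a))) := by
      conv_lhs => rw [List.ofFn_succ, contract]
      rfl
    have first : List.ofFn (insertArg (n := 2) rfl 0 (MultilinearMap.mkPiAlgebraFin k 2 A) a) =
        a 0 * a 1 :: List.ofFn (Fin.tail (Fin.tail a)) := by
      rw [ofFn_insertArg, List.ofFn_succ, List.ofFn_succ]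
      simp only [MultilinearMap.mkPiAlgebraFin_apply, List.ofFn_succ, List.ofFn_zero,
        List.prod_cons, List.prod_nil, mul_one]
      rfl
    have later (i : Fin n) :
        List.ofFn (insertArg (n := 2) rfl i.succ (MultilinearMap.mkPiAlgebraFin k 2 A) a) =
        a 0 :: List.ofFn (insertArg (n := 2) rfl i (MultilinearMap.mkPiAlgebraFin k 2 A)
          (Fin.tail a)) := by
      rw [ofFn_insertArg, ofFn_insertArg, List.ofFn_succ (f := a)]
      simp [Fin.tail]
    rw [step, this, Fin.sum_univ_succ, first]
    simp only [later, Fin.val_succ, Fin.val_zero, pow_zero, pow_succ (-1 : k), one_smul, mul_neg,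
      mul_one, neg_smul, Finset.sum_neg_distrib, List.ofFn_succ (f := Fin.init a), Fin.init,
      Fin.tail]
    simp only [sub_eq_add_neg, neg_add, add_assoc]
    rfl

theorem circ_toCochain {m n N : ℕ} (h : N + 1 = m + n) (f : letterLinear k A A)
    {g : letterLinear k A A} (hg : ConcentratedIn n g.1) (a : Fin N → A) :
    circ h (toCochain m f) (toCochain n g) a =
      insertSum ((-1 : k) ^ (n + 1)) (mark f) g.1 (List.ofFn a) := by
  have block (i : ℕ) (hi : i < m) : ((List.ofFn a).drop i).take n =
      List.ofFn fun l : Fin n => a ⟨i + l.1, by omega⟩ :=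
    List.ext_getElem (by simp; omega) (by simp)
  rw [insertSum_eq_sum_range _ _ hg, List.length_ofFn, show N + 1 - n = m by omega,
    Finset.sum_range]
  simp only [circ, sum_apply, smul_apply, insertAt_apply, toCochain_apply, ofFn_insertArg,
    block _ (Fin.is_lt _), ← pow_mul, mul_comm (n + 1)]
  rfl

variable [Module (Env k A) M] [IsScalarTower k (Env k A) M]

theorem hochschildD_toCochain {n : ℕ} (f : letterLinear k A M) :
    hochschildD k A M n (toCochain n f) = toCochain (n + 1) (letterD leftAct rightAct f) := by
  ext a
  have contractions :=
    contract_ofFn (k := k) f.1 (fun u x => rightAct (k := k) (M := M) x (f.1 u)) a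
  have expand : toCochain (n + 1) (letterD leftAct rightAct f) a =
      leftAct (k := k) (a 0) (f.1 (List.ofFn (Fin.tail a))) -
        contract f.1 (fun u x => rightAct (k := k) x (f.1 u)) (a 0) (List.ofFn (Fin.tail a)) := by
    rw [toCochain_apply, List.ofFn_succ]
    rfl
  rw [hochschildD_apply, expand, contractions, sub_eq_add_neg, neg_add, ← Finset.sum_neg_distrib,
    add_assoc]
  simp only [pow_succ (-1 : k), mul_neg, mul_one, neg_smul]
  rfl

end Cochains

section WordConcentration

variable {k A M : Type*} [CommRing k] [Ring A] [AddCommGroup M] [Module k M]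

theorem contract_eq_zero {f : List A → M} {e : List A → A → M} {n : ℕ}
    (hf : ∀ l, l.length = n → f l = 0) (he : ∀ l x, l.length = n → e l x = 0) (a : A) {l : List A}
    (hl : l.length = n) : contract f e a l = 0 := by
  induction l generalizing f e a n with
  | nil => exact he [] a hl
  | cons b l ih =>
    obtain rfl : l.length + 1 = n := hl
    rw [contract, hf _ rfl, ih (fun v hv => hf (a :: v) (congrArg (· + 1) hv))
      (fun v x hv => he (a :: v) x (congrArg (· + 1) hv)) b rfl, sub_zero]

theorem wordD_eq_zero (L R : A → Module.End k M) {n : ℕ} {f : List A → M}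
    (hf : ∀ l, l.length = n → f l = 0) {l : List A} (hl : l.length = n + 1) :
    wordD L R f l = 0 := by
  obtain ⟨a, l, rfl⟩ := List.exists_cons_of_length_eq_add_one hl
  obtain rfl : l.length = n := Nat.succ.inj hl
  rw [wordD, hf l rfl, map_zero, zero_sub, neg_eq_zero]
  exact contract_eq_zero hf (fun v x hv => by rw [hf v hv, map_zero]) a rfl

theorem ConcentratedIn.wordD (L R : A → Module.End k M) {n : ℕ} {f : List A → M}
    (hf : ConcentratedIn n f) : ConcentratedIn (n + 1) (wordD L R f) := by
  rintro (- | ⟨a, l⟩) hl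
  · rfl
  · have hl' : l.length ≠ n := fun h => hl (congrArg (· + 1) h)
    exact wordD_eq_zero L R (fun v hv => hf v (hv ▸ hl')) rfl

end WordConcentration

section Extension

variable {k : Type u} [Field k] {A : Type v} [Ring A] [Algebra k A] {M : Type w} [AddCommGroup M]
  [Module k M]

theorem ofCochain_toCochain {n : ℕ} {f : letterLinear k A M} (hf : ConcentratedIn n f.1) :
    ofCochain (toCochain n f) = f := by
  apply Subtype.ext
  funext l
  by_cases hl : l.length = n
  · subst hl
    exact (dif_pos rfl).trans (congrArg f.1 List.ofFn_getElem)
  · exact (dif_neg hl).trans (hf l hl).symm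

theorem ofCochain_zero {n : ℕ} : ofCochain (0 : Cochain k A M n) = 0 := by
  rw [← map_zero (toCochain n), ofCochain_toCochain fun _ _ => rfl]

variable [Module (Env k A) M] [IsScalarTower k (Env k A) M]

theorem leftAct_mul (x y : A) : (leftAct (k := k) (x * y) : Module.End k M) =
    leftAct (k := k) x * leftAct (k := k) y := by
  simp [leftAct, ← map_mul]

theorem rightAct_mul (x y : A) : (rightAct (k := k) (x * y) : Module.End k M) =
    rightAct (k := k) y * rightAct (k := k) x := by
  simp [rightAct, ← map_mul]

theorem leftAct_mul_rightAct (x y : A) :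
    (leftAct (k := k) x : Module.End k M) * rightAct (k := k) y =
      rightAct (k := k) y * leftAct (k := k) x := by
  simp [leftAct, rightAct, ← map_mul]

theorem letterD_ofCochain {n : ℕ} (c : Cochain k A M n) :
    letterD leftAct rightAct (ofCochain c) = ofCochain (hochschildD k A M n c) := by
  rw [← ofCochain_toCochain (f := letterD leftAct rightAct (ofCochain c))
    ((concentratedIn_ofCochain c).wordD leftAct rightAct)]
  exact congrArg ofCochain (by rw [← hochschildD_toCochain, toCochain_ofCochain])

theorem hochschildD_hochschildD {n : ℕ} (c : Cochain k A M n) :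
    hochschildD k A M (n + 1) (hochschildD k A M n c) = 0 := by
  rw [← toCochain_ofCochain c, hochschildD_toCochain, hochschildD_toCochain]
  ext a
  exact congrFun (wordD_wordD leftAct_mul rightAct_mul leftAct_mul_rightAct _) _

theorem hochschildD_smul {n : ℕ} (r : k) (c : Cochain k A M n) :
    hochschildD k A M n (r • c) = r • hochschildD k A M n c := by
  rw [← toCochain_ofCochain c, ← map_smul, hochschildD_toCochain, hochschildD_toCochain, map_smul,
    map_smul]

theorem smul_mem_coboundaries {n : ℕ} (r : k) {c : Cochain k A M n}
    (hc : c ∈ coboundaries (hochschildD k A M) n) : r • c ∈ coboundaries (hochschildD k A M) n := by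
  rcases n with - | n
  · rw [show c = 0 from hc, smul_zero]
    exact zero_mem _
  · obtain ⟨b, rfl⟩ := hc
    exact ⟨r • b, hochschildD_smul r b⟩

theorem toCochain_mem_coboundaries {n : ℕ} {f : letterLinear k A M}
    (hf : f ∈ coboundaries (C := fun _ => letterLinear k A M)
      (fun _ => (letterD leftAct rightAct).toAddMonoidHom) n) :
    toCochain n f ∈ coboundaries (hochschildD k A M) n := by
  rcases n with - | n
  · rw [show f = 0 from hf, map_zero]
    exact zero_mem _
  · obtain ⟨c, rfl⟩ := hf
    exact ⟨toCochain n c, hochschildD_toCochain c⟩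

end Extension

section Mark

variable {k A M : Type*} [CommRing k] [Ring A] [Algebra k A] [AddCommGroup M] [Module k M]

theorem mark_mem_left (f : letterLinear k A M) (w : List A) :
    (fun u => mark f u w) ∈ letterLinear k A (A →ₗ[k] M) := by
  intro u v
  refine ⟨fun x y => ?_, fun r x => ?_⟩ <;> ext z
  · simpa [mark] using (f.2 u (v ++ z :: w)).map_add x y
  · simpa [mark] using (f.2 u (v ++ z :: w)).map_smul r x

theorem mark_mem_right (f : letterLinear k A M) (u : List A) :
    mark f u ∈ letterLinear k A (A →ₗ[k] M) := by
  intro v w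
  refine ⟨fun x y => ?_, fun r x => ?_⟩ <;> ext z
  · simpa [mark] using (f.2 (u ++ z :: v) w).map_add x y
  · simpa [mark] using (f.2 (u ++ z :: v) w).map_smul r x

theorem markedD_mark_of_wordD_eq_zero {n : ℕ} {g : letterLinear k A A}
    (hg : ConcentratedIn n g.1) (hδ : wordD (LinearMap.mulLeft k) (LinearMap.mulRight k) g.1 = 0) :
    markedD (LinearMap.mulLeft k) (LinearMap.mulRight k) (LinearMap.mulLeft k)
      (LinearMap.mulRight k) (mark g) = fun u w =>
        -(if u = [] then LinearMap.mulRight k (g.1 w) else 0) -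
          if w = [] then (-1 : k) ^ (n + 1) • LinearMap.mulLeft k (g.1 u) else 0 := by
  funext u w
  ext x
  have expand := wordD_mark (LinearMap.mulRight k) g (LinearMap.mulLeft k) u w x
  have hn : (-1 : k) ^ (u.length + 1) • g.1 u = (-1 : k) ^ (n + 1) • g.1 u := (hg.hasSign u).symm
  rw [hδ, LinearMap.mulRight_apply, ← smul_mul_assoc, hn] at expand
  rw [eq_sub_of_add_eq (eq_sub_of_add_eq expand.symm)]
  split_ifs <;>
    simp only [Pi.zero_apply, smul_mul_assoc, LinearMap.mulLeft_apply, LinearMap.mulRight_apply,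
      LinearMap.sub_apply, LinearMap.neg_apply, LinearMap.smul_apply, LinearMap.zero_apply] <;>
    abel

end Mark

section CochainBracket

variable {k : Type u} [Field k] {A : Type v} [Ring A] [Algebra k A] {m n N : ℕ}

theorem leftAct_self : (leftAct : A →ₗ[k] A →ₗ[k] A) = LinearMap.mul k A := by
  ext a b
  exact (env_smul_def k A a 1 b).trans (by simp)

theorem rightAct_self : (rightAct : A →ₗ[k] A →ₗ[k] A) = (LinearMap.mul k A).flip := by
  ext a b
  exact (env_smul_def k A 1 (MulOpposite.op a) b).trans (by simp)

theorem wordD_ofCochain_eq_zero {g : Cochain k A A n} (hg : hochschildD k A A n g = 0) :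
    wordD (LinearMap.mulLeft k) (LinearMap.mulRight k) (ofCochain g).1 = 0 := by
  have := letterD_ofCochain g
  rw [leftAct_self, rightAct_self, hg, ofCochain_zero] at this
  exact congrArg Subtype.val this

theorem cochainBracket_toCochain (h : N + 1 = m + n) {f g : letterLinear k A A}
    (hf : ConcentratedIn m f.1) (hg : ConcentratedIn n g.1) (a : Fin N → A) :
    cochainBracket h (toCochain m f) (toCochain n g) a =
      wordBracket m n (mark g) g.1 f (List.ofFn a) :=
  congrArg₂ (fun x y : A => x - (-1 : k) ^ ((m + 1) * (n + 1)) • y) (circ_toCochain h f hg a)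
    (circ_toCochain (h.trans (Nat.add_comm m n)) g hf a)

theorem wordBracket_sub {M : Type*} [AddCommGroup M] [Module k M] (F : List A → List A → M →ₗ[k] M)
    (g : List A → A) (c c' : letterLinear k A M) (l : List A) :
    wordBracket m n F g (c - c') l = wordBracket m n F g c l - wordBracket m n F g c' l := by
  have left := (isLinearMap_insertSum_left ((-1 : k) ^ (n + 1)) g l).map_sub (mark c) (mark c')
  have right := (isLinearMap_insertSum_right ((-1 : k) ^ (m + 1)) F l).map_sub c.1 c'.1
  have hmark : mark (c - c') = mark c - mark c' := rfl
  rw [wordBracket, hmark, left, Submodule.coe_sub, right, smul_sub, sub_sub_sub_comm]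
  rfl

theorem wordBracket_mem {M : Type*} [AddCommGroup M] [Module k M]
    {F : List A → List A → M →ₗ[k] M} (hF : ∀ u, F u ∈ letterLinear k A (M →ₗ[k] M))
    (hF' : ∀ w, (fun u => F u w) ∈ letterLinear k A (M →ₗ[k] M)) {g : List A → A}
    (hg : g ∈ letterLinear k A A) (c : letterLinear k A M) :
    wordBracket m n F g c ∈ letterLinear k A M :=
  sub_mem (insertSum_mem _ (mark_mem_right c) (mark_mem_left c) hg)
    (Submodule.smul_mem _ _ (insertSum_mem _ hF hF' c.2))

theorem hochschildD_cochainBracket (h : N + 1 = m + n) (f : Cochain k A A m) {g : Cochain k A A n}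
    (hg : hochschildD k A A n g = 0) (h' : N + 1 + 1 = m + 1 + n) :
    hochschildD k A A N (cochainBracket h f g) =
      (-1 : k) ^ (n + 1) • cochainBracket h' (hochschildD k A A m f) g := by
  have closed := wordD_ofCochain_eq_zero hg
  let b : letterLinear k A A := ⟨wordBracket m n (mark (ofCochain g)) (ofCochain g).1 (ofCochain f),
    wordBracket_mem (mark_mem_right _) (mark_mem_left _) (ofCochain g).2 _⟩
  have bracket : cochainBracket h f g = toCochain N b := by
    ext a
    have := cochainBracket_toCochain h (concentratedIn_ofCochain f) (concentratedIn_ofCochain g) a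
    rwa [toCochain_ofCochain, toCochain_ofCochain] at this
  rw [bracket, hochschildD_toCochain]
  ext a
  have := cochainBracket_toCochain h' (concentratedIn_ofCochain (hochschildD k A A m f))
    (concentratedIn_ofCochain g) a
  rw [toCochain_ofCochain, toCochain_ofCochain, ← letterD_ofCochain] at this
  rw [smul_apply, this, leftAct_self, rightAct_self]
  exact wordD_wordBracket (L := LinearMap.mul k A) (R := (LinearMap.mul k A).flip)
    (concentratedIn_ofCochain g) closed
    (markedD_mark_of_wordD_eq_zero (concentratedIn_ofCochain g) closed) (ofCochain f)
    (concentratedIn_ofCochain f) (List.ofFn a)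

theorem cochainBracket_comm (h : N + 1 = m + n) (f : Cochain k A A m) (g : Cochain k A A n) :
    cochainBracket h f g = -((-1 : k) ^ ((m + 1) * (n + 1)) •
      cochainBracket (h.trans (Nat.add_comm m n)) g f) := by
  have hs : (-1 : k) ^ ((m + 1) * (n + 1)) * (-1) ^ ((m + 1) * (n + 1)) = 1 := by
    rw [← mul_pow]; simp
  rw [cochainBracket, cochainBracket, mul_comm (n + 1), smul_sub, smul_smul, hs, one_smul, neg_sub]

theorem cochainBracket_sub_left (h : N + 1 = m + n) (f f' : Cochain k A A m)
    (g : Cochain k A A n) :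
    cochainBracket h (f - f') g = cochainBracket h f g - cochainBracket h f' g := by
  have sub : f - f' = toCochain m (ofCochain f - ofCochain f') := by
    rw [map_sub, toCochain_ofCochain, toCochain_ofCochain]
  have bracket (c : letterLinear k A A) (hc : ConcentratedIn m c.1) :=
    cochainBracket_toCochain h hc (concentratedIn_ofCochain g)
  have hf := bracket _ (concentratedIn_ofCochain f)
  have hf' := bracket _ (concentratedIn_ofCochain f')
  have hsub := bracket (ofCochain f - ofCochain f') fun l hl => by
    simp [concentratedIn_ofCochain f l hl, concentratedIn_ofCochain f' l hl]
  simp only [toCochain_ofCochain, ← sub] at hf hf' hsub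
  ext a
  rw [sub_apply, hf, hf', hsub, wordBracket_sub]

theorem cochainBracket_mem_coboundaries (h : N + 1 = m + n) (hm : 0 < m) (hn : 0 < n)
    {f : Cochain k A A m} (hf : f ∈ coboundaries (hochschildD k A A) m) {g : Cochain k A A n}
    (hg : hochschildD k A A n g = 0) :
    cochainBracket h f g ∈ coboundaries (hochschildD k A A) N := by
  obtain ⟨m, rfl⟩ := Nat.exists_eq_succ_of_ne_zero hm.ne'
  obtain ⟨N, rfl⟩ := Nat.exists_eq_succ_of_ne_zero (show N ≠ 0 by omega)
  obtain ⟨c, rfl⟩ := hf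
  refine ⟨(-1 : k) ^ (n + 1) • cochainBracket (by omega) c g, ?_⟩
  have hs : (-1 : k) ^ (n + 1) * (-1) ^ (n + 1) = 1 := by rw [← mul_pow]; simp
  rw [hochschildD_smul, hochschildD_cochainBracket (by omega) c hg h, smul_smul, hs, one_smul]

theorem cochainBracket_sub_cochainBracket_mem (h : N + 1 = m + n) (hm : 0 < m) (hn : 0 < n)
    {f f' : Cochain k A A m} (hf' : hochschildD k A A m f' = 0)
    (hff' : f - f' ∈ coboundaries (hochschildD k A A) m)
    {g g' : Cochain k A A n} (hg : hochschildD k A A n g = 0)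
    (hgg' : g - g' ∈ coboundaries (hochschildD k A A) n) :
    cochainBracket h f g - cochainBracket h f' g' ∈ coboundaries (hochschildD k A A) N := by
  have left := cochainBracket_mem_coboundaries h hm hn hff' hg
  have right := cochainBracket_mem_coboundaries (h.trans (Nat.add_comm m n)) hn hm hgg' hf'
  rw [cochainBracket_sub_left] at left right
  rw [← sub_add_sub_cancel _ (cochainBracket h f' g)]
  refine add_mem left ?_
  rw [cochainBracket_comm h f' g, cochainBracket_comm h f' g', neg_sub_neg, ← neg_sub]
  have := smul_mem_coboundaries ((-1 : k) ^ ((m + 1) * (n + 1))) right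
  rw [smul_sub] at this
  exact neg_mem this

end CochainBracket

section DoubleComplex

variable {D : ℕ → ℕ → Type*} [∀ i j, AddCommGroup (D i j)] {d : ∀ i j, D i (j + 1) →+ D i j}
  {δ : ∀ i j, D i j →+ D (i + 1) j}

theorem exists_chain_lift (comm : ∀ i j x, d (i + 1) j (δ i (j + 1) x) = δ i j (d i j x))
    (sq : ∀ i j x, δ (i + 1) j (δ i j x) = 0)
    (exact : ∀ i j x, d i j x = 0 → ∃ y, d i (j + 1) y = x) (z₀ : D 0 0)
    (hz₀ : ∃ y, d 1 0 y = δ 0 0 z₀) :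
    ∃ z : ∀ j, D j j, z 0 = z₀ ∧ ∀ j, d (j + 1) j (z (j + 1)) = δ j j (z j) := by
  have next (j) (z : {z : D j j // ∃ y, d (j + 1) j y = δ j j z}) :
      ∃ z' : {z : D (j + 1) (j + 1) // ∃ y, d (j + 2) (j + 1) y = δ (j + 1) (j + 1) z},
        d (j + 1) j z'.1 = δ j j z.1 := by
    obtain ⟨y, hy⟩ := z.2
    exact ⟨⟨y, exact _ _ _ (by rw [comm, hy, sq])⟩, hy⟩
  choose step hstep using next
  let z (j : ℕ) : {z : D j j // ∃ y, d (j + 1) j y = δ j j z} := Nat.rec ⟨z₀, hz₀⟩ step j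
  exact ⟨fun j => (z j).1, rfl, fun j => hstep j (z j)⟩

/-- Comparison of resolutions: a chain `z` of components of a chain map that starts with a
boundary is null-homotopic. -/
theorem exists_sub_mem_coboundaries (comm : ∀ i j x, d (i + 1) j (δ i (j + 1) x) = δ i j (d i j x))
    (sq : ∀ i j x, δ (i + 1) j (δ i j x) = 0)
    (exact : ∀ i j x, d i j x = 0 → ∃ y, d i (j + 1) y = x) {z : ∀ j, D j j}
    (hz : ∀ j, d (j + 1) j (z (j + 1)) = δ j j (z j)) (hz₀ : ∃ y, d 0 0 y = z 0) (n : ℕ) :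
    ∃ y, z n - d n n y ∈ coboundaries (C := fun i => D i n) (fun i => δ i n) n := by
  induction n with
  | zero =>
    obtain ⟨y, hy⟩ := hz₀
    exact ⟨y, sub_eq_zero.2 hy.symm⟩
  | succ n ih =>
    obtain ⟨y, hy⟩ := ih
    have closed : δ n n (z n - d n n y) = 0 := by
      rcases n with - | n
      · rw [show z 0 - d 0 0 y = 0 from hy, map_zero]
      · obtain ⟨x, hx⟩ := hy
        rw [← hx, sq]
    obtain ⟨t, ht⟩ := exact _ _ (z (n + 1) - δ n (n + 1) y)
      (by rw [map_sub, hz, comm, ← map_sub, closed])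
    exact ⟨t, y, by rw [ht, sub_sub_cancel]⟩

end DoubleComplex

section Postcomposition

variable {k : Type*} [CommRing k] {A M M' : Type*} [Ring A] [Algebra k A]
  [AddCommGroup M] [Module k M] [AddCommGroup M'] [Module k M']

/-- Postcomposition of letter-linear functions with a linear map. -/
def letterMap (φ : M →ₗ[k] M') : letterLinear k A M →ₗ[k] letterLinear k A M' where
  toFun c := ⟨fun l => φ (c.1 l), fun u w => (φ ∘ₗ (c.2 u w).mk').isLinear⟩
  map_add' c c' := Subtype.ext (funext fun l => φ.map_add (c.1 l) (c'.1 l))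
  map_smul' r c := Subtype.ext (funext fun l => φ.map_smul r (c.1 l))

theorem letterD_letterMap {L R : A →ₗ[k] Module.End k M} {L' R' : A →ₗ[k] Module.End k M'}
    {φ : M →ₗ[k] M'} (hL : ∀ a, φ ∘ₗ L a = L' a ∘ₗ φ) (hR : ∀ a, φ ∘ₗ R a = R' a ∘ₗ φ)
    (c : letterLinear k A M) :
    letterD L' R' (letterMap φ c) = letterMap φ (letterD L R c) := by
  apply Subtype.ext
  funext l
  rcases l with - | ⟨a, l⟩
  · exact (map_zero φ).symm
  · have hL := LinearMap.congr_fun (hL a) (c.1 l)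
    have hR (u : List A) (x : A) := LinearMap.congr_fun (hR x) (c.1 u)
    simp only [LinearMap.comp_apply] at hL hR
    simp only [letterD, letterMap, LinearMap.coe_mk, AddHom.coe_mk, wordD, map_sub, map_contract,
      hL, hR]

end Postcomposition

theorem exists_letterMap_eq {k : Type*} [Field k] {A M M' M'' : Type*} [Ring A] [Algebra k A]
    [AddCommGroup M] [Module k M] [AddCommGroup M'] [Module k M'] [AddCommGroup M''] [Module k M'']
    {f : M →ₗ[k] M'} {g : M' →ₗ[k] M''} (exact : Function.Exact f g)
    {c : letterLinear k A M'} (hc : letterMap g c = 0) : ∃ b, letterMap f b = c := by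
  obtain ⟨σ, hσ⟩ := f.rangeRestrict.exists_rightInverse_of_surjective f.range_rangeRestrict
  obtain ⟨τ, hτ⟩ := σ.exists_extend
  refine ⟨letterMap τ c, Subtype.ext (funext fun l => ?_)⟩
  have mem : c.1 l ∈ LinearMap.range f := (exact _).1 (congrFun (congrArg Subtype.val hc) l)
  have extend : τ (c.1 l) = σ ⟨c.1 l, mem⟩ := LinearMap.congr_fun hτ ⟨c.1 l, mem⟩
  have lift := congrArg Subtype.val (LinearMap.congr_fun hσ ⟨c.1 l, mem⟩)
  exact (congrArg f extend).trans lift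

section Precomposition

variable {k A B M M' : Type*} [CommRing k] [Ring A] [Algebra k A] [Ring B] [Algebra k B]
  [AddCommGroup M] [Module k M] [AddCommGroup M'] [Module k M']

/-- Restriction of letter-linear functions along an algebra homomorphism, letter by letter. -/
def letterComap (φ : A →ₐ[k] B) : letterLinear k B M →ₗ[k] letterLinear k A M where
  toFun c := ⟨fun l => c.1 (l.map φ), fun u w => by
    simp only [List.map_append, List.map_cons]
    exact (mark c (u.map φ) (w.map φ) ∘ₗ φ.toLinearMap).isLinear⟩
  map_add' _ _ := rfl
  map_smul' _ _ := rfl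

omit [Module k M] in
theorem contract_map (φ : A →ₐ[k] B) (f : List B → M) (e : List B → B → M) (a : A) (l : List A) :
    contract f e (φ a) (l.map φ) =
      contract (fun u => f (u.map φ)) (fun u x => e (u.map φ) (φ x)) a l := by
  induction l generalizing f e a with
  | nil => rfl
  | cons b l ih =>
    simp only [List.map_cons, contract, map_mul, ih]

theorem letterD_letterComap (φ : A →ₐ[k] B) (L R : B →ₗ[k] Module.End k M)
    (c : letterLinear k B M) :
    letterD (L ∘ₗ φ.toLinearMap) (R ∘ₗ φ.toLinearMap) (letterComap φ c) =
      letterComap φ (letterD L R c) := by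
  apply Subtype.ext
  funext l
  rcases l with - | ⟨a, l⟩
  · rfl
  · exact congrArg (L (φ a) (c.1 (l.map φ)) - ·)
      (contract_map φ c.1 (fun u x => R x (c.1 u)) a l).symm

end Precomposition

section Twist

variable {k C A M M' : Type*} [CommRing k] [Ring C] [Algebra k C] [Ring A] [Algebra k A]
  [AddCommGroup M] [Module k M] [AddCommGroup M'] [Module k M']

/-- The recursion step of `twist`: the letter `y ⊗ₜ x` puts `x` into the function and multiplies
the result by `y`. -/
def twistStep : C ⊗[k] A →ₗ[k] Module.End k (letterLinear k A M →ₗ[k] C ⊗[k] M) :=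
  TensorProduct.lift (LinearMap.mk₂ k
    (fun y x => y • LinearMap.lcomp k (C ⊗[k] M) (fixLetter x))
    (fun y y' x => add_smul y y' _) (fun r y x => smul_assoc r y _)
    (fun y x x' => by
      ext T c
      simp only [map_add, LinearMap.smul_apply, LinearMap.lcomp_apply, LinearMap.add_apply,
        smul_add])
    (fun r y x => by
      ext T c
      simp only [map_smul, LinearMap.smul_apply, LinearMap.lcomp_apply]
      exact smul_comm y r _))

/-- The word function of `twist`, linear in the twisted function. -/
def twistWord (U : List (C ⊗[k] A)) : letterLinear k A M →ₗ[k] C ⊗[k] M :=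
  U.foldr (fun b T => twistStep b T)
    (TensorProduct.mk k C M 1 ∘ₗ LinearMap.proj [] ∘ₗ (letterLinear k A M).subtype)

theorem twistWord_mem (c : letterLinear k A M) :
    (fun U => twistWord U c) ∈ letterLinear k (C ⊗[k] A) (C ⊗[k] M) := by
  suffices h : ∀ U V : List (C ⊗[k] A), IsLinearMap k fun b => twistWord (M := M) (U ++ b :: V) from
    fun U V => (LinearMap.applyₗ c ∘ₗ (h U V).mk').isLinear
  intro U V
  induction U with
  | nil => exact (twistStep.flip (twistWord V)).isLinear
  | cons b U ih => exact (twistStep b ∘ₗ ih.mk').isLinear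

variable (C) in
/-- The extension of a letter-linear function `c` on `A` to one on `C ⊗ A` which sends the word
`(y₁ ⊗ x₁) ⋯ (yₙ ⊗ xₙ)` to `y₁ ⋯ yₙ ⊗ c (x₁ ⋯ xₙ)`. -/
def twist : letterLinear k A M →ₗ[k] letterLinear k (C ⊗[k] A) (C ⊗[k] M) where
  toFun c := ⟨fun U => twistWord U c, twistWord_mem c⟩
  map_add' c c' := Subtype.ext (funext fun _ => map_add _ c c')
  map_smul' r c := Subtype.ext (funext fun _ => map_smul _ r c)

theorem twist_nil (c : letterLinear k A M) : (twist C c).1 [] = 1 ⊗ₜ c.1 [] := rfl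

theorem twist_tmul_cons (c : letterLinear k A M) (y : C) (x : A) (U : List (C ⊗[k] A)) :
    (twist C c).1 (y ⊗ₜ x :: U) = y • (twist C (fixLetter x c)).1 U := rfl

/-- The word `(y₁ ⊗ x₁) ⋯ (yₙ ⊗ xₙ)`. -/
abbrev tmulWord (p : List (C × A)) : List (C ⊗[k] A) := p.map fun q => q.1 ⊗ₜ q.2

theorem twist_tmulWord (c : letterLinear k A M) (p : List (C × A)) :
    (twist C c).1 (tmulWord p) = (p.map Prod.fst).prod ⊗ₜ c.1 (p.map Prod.snd) := by
  induction p generalizing c with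
  | nil => rfl
  | cons q p ih =>
    rw [tmulWord, List.map_cons, twist_tmul_cons, ih, TensorProduct.smul_tmul', List.map_cons,
      List.prod_cons]
    rfl

theorem letterLinear_ext_tmul {f g : letterLinear k (C ⊗[k] A) M}
    (h : ∀ p, f.1 (tmulWord p) = g.1 (tmulWord p)) : f = g := by
  apply Subtype.ext
  funext U
  induction U generalizing f g with
  | nil => exact h []
  | cons b U ih =>
    suffices mark f [] U = mark g [] U from LinearMap.congr_fun this b
    exact TensorProduct.ext' fun y x =>
      ih (f := fixLetter (y ⊗ₜ x) f) (g := fixLetter (y ⊗ₜ x) g) fun p => h ((y, x) :: p)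

theorem twist_letterMap (φ : M →ₗ[k] M') (c : letterLinear k A M) :
    twist C (letterMap φ c) = letterMap (φ.lTensor C) (twist C c) :=
  letterLinear_ext_tmul fun p => by
    refine (twist_tmulWord _ p).trans ?_
    exact (congrArg (φ.lTensor C) (twist_tmulWord c p)).symm

theorem contract_tmulWord {F : List (C ⊗[k] A) → C ⊗[k] M}
    {E : List (C ⊗[k] A) → C ⊗[k] A → C ⊗[k] M}
    {f : List A → M} {e : List A → A → M} {z : C}
    (hF : ∀ p, F (tmulWord p) = (z * (p.map Prod.fst).prod) ⊗ₜ f (p.map Prod.snd))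
    (hE : ∀ p y x, E (tmulWord p) (y ⊗ₜ x) =
      (z * (p.map Prod.fst).prod * y) ⊗ₜ e (p.map Prod.snd) x) (y : C) (x : A) (p : List (C × A)) :
    contract F E (y ⊗ₜ x) (tmulWord p) =
      (z * y * (p.map Prod.fst).prod) ⊗ₜ contract f e x (p.map Prod.snd) := by
  induction p generalizing F E f e y x z with
  | nil => simpa [contract] using hE [] y x
  | cons q p ih =>
    have hF' (p : List (C × A)) := hF ((y, x) :: p)
    have hE' (p : List (C × A)) := hE ((y, x) :: p)
    have := hF ((y * q.1, x * q.2) :: p)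
    simp only [tmulWord, List.map_cons, List.prod_cons, ← mul_assoc] at hF' hE' this
    simp only [tmulWord, List.map_cons, contract, List.prod_cons,
      Algebra.TensorProduct.tmul_mul_tmul, this,
      ih (F := fun U => F (y ⊗ₜ x :: U)) (E := fun U => E (y ⊗ₜ x :: U)) (f := fun l => f (x :: l))
        (e := fun l => e (x :: l)) hF' hE', TensorProduct.tmul_sub, ← mul_assoc]

/-- The action of `C ⊗ A` on `C ⊗ M` given by an action of `C` on itself and one of `A` on `M`. -/
abbrev tensorAct (S : C →ₗ[k] Module.End k C) (L : A →ₗ[k] Module.End k M) :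
    C ⊗[k] A →ₗ[k] Module.End k (C ⊗[k] M) :=
  TensorProduct.homTensorHomMap (.id k) C M C M ∘ₗ TensorProduct.map S L

theorem letterD_twist (L R : A →ₗ[k] Module.End k M) (c : letterLinear k A M) :
    letterD (tensorAct (LinearMap.mul k C) L) (tensorAct (LinearMap.mul k C).flip R) (twist C c) =
      twist C (letterD L R c) := by
  refine letterLinear_ext_tmul fun p => ?_
  rw [twist_tmulWord]
  rcases p with - | ⟨⟨y, x⟩, p⟩
  · simp [letterD, wordD]
  · have := contract_tmulWord (F := (twist C c).1)
      (E := fun u b => tensorAct (LinearMap.mul k C).flip R b ((twist C c).1 u)) (z := 1)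
      (fun p => by rw [twist_tmulWord, one_mul]) (e := fun u x => R x (c.1 u))
      (fun p y x => by simp [twist_tmulWord]) y x p
    simp only [letterD, LinearMap.coe_mk, AddHom.coe_mk, wordD, List.map_cons, this]
    simp [twist_tmulWord, TensorProduct.tmul_sub]

end Twist

section Twist

variable {k C A M : Type*} [CommRing k] [Ring C] [Algebra k C] [Ring A] [Algebra k A]
  [AddCommGroup M] [Module k M]

theorem twist_eq_zero {c : letterLinear k A M} {U : List (C ⊗[k] A)}
    (hc : ∀ l : List A, l.length = U.length → c.1 l = 0) : (twist C c).1 U = 0 := by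
  induction U generalizing c with
  | nil => rw [twist_nil, hc [] rfl, TensorProduct.tmul_zero]
  | cons b U ih =>
    suffices mark (twist C c) [] U = 0 from LinearMap.congr_fun this b
    refine TensorProduct.ext' fun y x => (twist_tmul_cons c y x U).trans ?_
    rw [ih fun l hl => hc (x :: l) (congrArg (· + 1) hl), smul_zero, LinearMap.zero_apply]

theorem tensorAct_mul : tensorAct (LinearMap.mul k C) (LinearMap.mul k A) =
    LinearMap.mul k (C ⊗[k] A) := by
  ext; simp

theorem tensorAct_mul_flip : tensorAct (LinearMap.mul k C).flip (LinearMap.mul k A).flip =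
    (LinearMap.mul k (C ⊗[k] A)).flip := by
  ext; simp

theorem wordD_twist_eq_zero {g : letterLinear k A A}
    (hg : letterD (LinearMap.mul k A) (LinearMap.mul k A).flip g = 0) :
    letterD (LinearMap.mul k (C ⊗[k] A)) (LinearMap.mul k (C ⊗[k] A)).flip (twist C g) = 0 := by
  rw [← tensorAct_mul_flip, ← tensorAct_mul, letterD_twist, hg, map_zero]

theorem twist_map_one_tmul (c : letterLinear k A M) (l : List A) :
    (twist C c).1 (l.map fun x => 1 ⊗ₜ x) = 1 ⊗ₜ c.1 l := by
  have := twist_tmulWord c (l.map fun x => ((1 : C), x))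
  simpa [tmulWord, Function.comp_def] using this

theorem twist_append_tmul_cons (g : letterLinear k A A) (U : List (C ⊗[k] A)) (y : C) (x : A)
    (w : List A) :
    (twist C g).1 (U ++ y ⊗ₜ x :: w.map fun x => 1 ⊗ₜ x) =
      (twist C g).1 (U ++ 1 ⊗ₜ x :: w.map fun x => 1 ⊗ₜ x) * (y ⊗ₜ 1) := by
  induction U generalizing g with
  | nil => simp [twist_tmul_cons, twist_map_one_tmul, TensorProduct.smul_tmul']
  | cons b U ih =>
    suffices mark (twist C g) [] (U ++ y ⊗ₜ x :: w.map fun x => 1 ⊗ₜ x) =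
        LinearMap.mulRight k (y ⊗ₜ[k] (1 : A)) ∘ₗ
          mark (twist C g) [] (U ++ 1 ⊗ₜ x :: w.map fun x => 1 ⊗ₜ x) from
      LinearMap.congr_fun this b
    refine TensorProduct.ext' fun z t => ?_
    refine (congrArg (z • ·) (ih (fixLetter t g))).trans ?_
    exact (smul_mul_assoc z _ _).symm

end Twist

section Counit

variable {k C A M : Type*} [CommRing k] [Ring C] [Bialgebra k C] [Ring A] [Algebra k A]
  [AddCommGroup M] [Module k M]

variable (k C M) in
/-- The map `y ⊗ m ↦ ε(y) m`. -/
def counitTensor : C ⊗[k] M →ₗ[k] M := TensorProduct.lid k M ∘ₗ Coalgebra.counit.rTensor M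

variable (k C A) in
/-- The algebra homomorphism `y ⊗ x ↦ ε(y) x`. -/
def counitTensorAlgHom : C ⊗[k] A →ₐ[k] A :=
  (Algebra.TensorProduct.lid k A).toAlgHom.comp
    (Algebra.TensorProduct.map (Bialgebra.counitAlgHom k C) (AlgHom.id k A))

theorem counitTensor_twist (c : letterLinear k A M) :
    letterMap (counitTensor k C M) (twist C c) = letterComap (counitTensorAlgHom k C A) c := by
  refine letterLinear_ext_tmul fun p => ?_
  induction p generalizing c with
  | nil => simp [letterMap, letterComap, twist_nil, counitTensor]
  | cons q p ih =>
    have pull (t : C ⊗[k] M) :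
        counitTensor k C M (q.1 • t) = Coalgebra.counit (R := k) q.1 • counitTensor k C M t := by
      induction t with
      | zero => simp
      | tmul y m => simp [counitTensor, TensorProduct.smul_tmul', mul_smul]
      | add t t' ht ht' => simp only [smul_add, map_add, ht, ht']
    refine (pull _).trans ((congrArg (Coalgebra.counit q.1 • ·) (ih (fixLetter q.2 c))).trans ?_)
    exact ((mark c [] _).map_smul _ q.2).symm

end Counit

section Colinearity

variable {k A : Type*} [CommRing k] [Ring A] [Bialgebra k A]

/-- The function of words `l ↦ γ (l₍₂₎) l₍₁₎` with values in `A` that a scalar function `γ` of words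
induces. Here `l₍₁₎` stands for the product of its letters. -/
def cofreeExtension : letterLinear k A k →ₗ[k] letterLinear k A A :=
  letterComap (Bialgebra.comulAlgHom k A) ∘ₗ
    letterMap (TensorProduct.AlgebraTensorModule.rid k A A).toLinearMap ∘ₗ twist A

/-- The function of words `l ↦ y (cofreeExtension γ_x l)`, where `γ_x` is `γ` with the first letter
`x`, as a linear function of `y ⊗ x`. -/
def mulCofree (γ : letterLinear k A k) : A ⊗[k] A →ₗ[k] letterLinear k A A :=
  letterComap (Bialgebra.comulAlgHom k A) ∘ₗ
    letterMap (TensorProduct.AlgebraTensorModule.rid k A A).toLinearMap ∘ₗ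
      fixLetter.flip (twist A γ)

theorem mulCofree_tmul (γ : letterLinear k A k) (y x : A) :
    mulCofree γ (y ⊗ₜ x) = letterMap (LinearMap.mulLeft k y) (cofreeExtension (fixLetter x γ)) := by
  apply Subtype.ext
  funext l
  exact (TensorProduct.AlgebraTensorModule.rid k A A).map_smul y
    ((twist A (fixLetter x γ)).1 (l.map (Bialgebra.comulAlgHom k A)))

theorem comul_cofreeExtension (γ : letterLinear k A k) (l : List A) :
    Coalgebra.comul ((cofreeExtension γ).1 l) =
      (twist A (cofreeExtension γ)).1 (l.map (Bialgebra.comulAlgHom k A)) := by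
  induction l generalizing γ with
  | nil =>
    simp [cofreeExtension, letterMap, letterComap, twist_nil, Algebra.TensorProduct.one_def]
  | cons a l ih =>
    let U := l.map (Bialgebra.comulAlgHom k A)
    let Ψ : A ⊗[k] A ⊗[k] A →ₗ[k] A ⊗[k] A := TensorProduct.lift
      ((LinearMap.mul k (A ⊗[k] A)).compl₂ (Coalgebra.comul ∘ₗ LinearMap.proj l ∘ₗ
        (letterLinear k A A).subtype ∘ₗ cofreeExtension ∘ₗ fixLetter.flip γ))
    have left : Coalgebra.comul ∘ₗ LinearMap.proj l ∘ₗ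
        (letterLinear k A A).subtype ∘ₗ mulCofree γ = Ψ ∘ₗ Coalgebra.comul.rTensor A :=
      TensorProduct.ext' fun y x => by simp [Ψ, mulCofree_tmul, letterMap]
    have inner (y : A) : y • (LinearMap.proj U ∘ₗ (letterLinear k _ (A ⊗[k] A)).subtype ∘ₗ
        twist A ∘ₗ mulCofree γ) = Ψ ∘ₗ (TensorProduct.assoc k A A A).symm.toLinearMap ∘ₗ
          TensorProduct.mk k A (A ⊗[k] A) y := by
      refine TensorProduct.ext' fun z t => ?_
      have mul_eq : y • (LinearMap.mulLeft k z).lTensor A = LinearMap.mulLeft k (y ⊗ₜ[k] z) := by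
        ext; simp [TensorProduct.smul_tmul']
      refine Eq.trans ?_ (congrArg (y ⊗ₜ z * ·) (ih (fixLetter t γ)).symm)
      simp only [LinearMap.smul_apply, LinearMap.comp_apply, mulCofree_tmul, twist_letterMap]
      exact LinearMap.congr_fun mul_eq ((twist A (cofreeExtension (fixLetter t γ))).1 U)
    have right : mark (twist A (cofreeExtension γ)) [] U =
        Ψ ∘ₗ (TensorProduct.assoc k A A A).symm.toLinearMap ∘ₗ Coalgebra.comul.lTensor A :=
      TensorProduct.ext' fun y x => LinearMap.congr_fun (inner y) (Coalgebra.comul x)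
    refine (LinearMap.congr_fun left (Coalgebra.comul a)).trans ?_
    refine Eq.trans ?_ (LinearMap.congr_fun right (Coalgebra.comul a)).symm
    exact congrArg Ψ (Coalgebra.coassoc_symm_apply a).symm

end Colinearity

section Ind

variable (k : Type u) [Field k] (A : Type v) [Ring A]

/-- The bimodule `N ⊗ A` induced by the `A`-module `N`, with
`x (n ⊗ b) y = ∑ x₁ n ⊗ x₂ b y`. -/
def Ind [Algebra k A] (N : Type w) [AddCommGroup N] [Module k N] : Type (max w v) := N ⊗[k] A

instance [Algebra k A] (N : Type w) [AddCommGroup N] [Module k N] : AddCommGroup (Ind k A N) :=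
  inferInstanceAs (AddCommGroup (N ⊗[k] A))

instance [Algebra k A] (N : Type w) [AddCommGroup N] [Module k N] : Module k (Ind k A N) :=
  inferInstanceAs (Module k (N ⊗[k] A))

variable (N : Type w) [AddCommGroup N] [Module k N]

/-- Right multiplication of `A` on the second factor of `N ⊗ A`. -/
def tensorRmul [Algebra k A] : Aᵐᵒᵖ →ₐ[k] Module.End k (N ⊗[k] A) :=
  (Module.endTensorEndAlgHom (R := k) (S := k) (A := k) (M := N) (N := A)).comp
    (Algebra.TensorProduct.includeRight.comp (Algebra.lsmul k k A))

variable {k A N} in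
theorem tensorRmul_tmul [Algebra k A] (y : Aᵐᵒᵖ) (n : N) (b : A) :
    tensorRmul k A N y (n ⊗ₜ b) = n ⊗ₜ (b * y.unop) := rfl

variable [Bialgebra k A] [Module A N] [IsScalarTower k A N]

/-- The action of `A ⊗ A` on `N ⊗ A` in both factors. -/
def tensorLsmul : A ⊗[k] A →ₐ[k] Module.End k (N ⊗[k] A) :=
  (Module.endTensorEndAlgHom (R := k) (S := k) (A := k) (M := N) (N := A)).comp
    (Algebra.TensorProduct.map (Algebra.lsmul k k N) (Algebra.lsmul k k A))

variable {k A N}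

theorem tensorLsmul_tmul (s t : A) (n : N) (b : A) :
    tensorLsmul k A N (s ⊗ₜ t) (n ⊗ₜ b) = (s • n) ⊗ₜ (t * b) := rfl

theorem commute_tensorLsmul_tensorRmul (t : A ⊗[k] A) (y : Aᵐᵒᵖ) :
    Commute (tensorLsmul k A N t) (tensorRmul k A N y) := by
  induction t with
  | zero => exact map_zero (tensorLsmul k A N) ▸ Commute.zero_left _
  | add t t' ht ht' => exact map_add (tensorLsmul k A N) t t' ▸ ht.add_left ht'
  | tmul s t =>
    exact TensorProduct.ext' fun n b => congrArg ((s • n) ⊗ₜ[k] ·) (mul_assoc t b y.unop).symm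

variable (k A N) in
/-- The action of the enveloping algebra on `Ind k A N`. -/
def indAction : Env k A →ₐ[k] Module.End k (N ⊗[k] A) :=
  Algebra.TensorProduct.lift ((tensorLsmul k A N).comp (Bialgebra.comulAlgHom k A))
    (tensorRmul k A N) fun x y => commute_tensorLsmul_tensorRmul (Coalgebra.comul x) y

instance : Module (Env k A) (Ind k A N) :=
  show Module (Env k A) (N ⊗[k] A) from Module.compHom _ (indAction k A N).toRingHom

instance : IsScalarTower k (Env k A) (Ind k A N) where
  smul_assoc r e t :=
    LinearMap.congr_fun (f := indAction k A N (r • e)) (map_smul (indAction k A N) r e) t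

theorem leftAct_ind (x : A) : (leftAct x : Ind k A N →ₗ[k] Ind k A N) =
    tensorLsmul k A N (Coalgebra.comul x) := by
  have := AlgHom.congr_fun (Algebra.TensorProduct.lift_comp_includeLeft
    ((tensorLsmul k A N).comp (Bialgebra.comulAlgHom k A)) (tensorRmul k A N)
    fun x y => commute_tensorLsmul_tensorRmul (Coalgebra.comul x) y) x
  exact this

theorem rightAct_ind (x : A) : (rightAct x : Ind k A N →ₗ[k] Ind k A N) =
    tensorRmul k A N (MulOpposite.op x) := by
  have := AlgHom.congr_fun (Algebra.TensorProduct.lift_comp_includeRight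
    ((tensorLsmul k A N).comp (Bialgebra.comulAlgHom k A)) (tensorRmul k A N)
    fun x y => commute_tensorLsmul_tensorRmul (Coalgebra.comul x) y) (MulOpposite.op x)
  exact this

end Ind

section Cochains

variable {k : Type u} [Field k] {A : Type v} [Ring A] [Bialgebra k A]
  {N : Type w} [AddCommGroup N] [Module k N]

/-- The action of `A` on a vector space through the counit. -/
def augAct : A →ₗ[k] Module.End k N :=
  Algebra.linearMap k (Module.End k N) ∘ₗ Coalgebra.counit

/-- The function of words `l ↦ c (l₍₁₎) ⊗ l₍₂₎` with values in `Ind k A N`. -/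
def indWord : letterLinear k A N →ₗ[k] letterLinear k A (Ind k A N) :=
  letterMap (TensorProduct.comm k A N).toLinearMap ∘ₗ
    letterComap (Bialgebra.comulAlgHom k A) ∘ₗ twist A

theorem concentratedIn_indWord {c : letterLinear k A N} {n : ℕ} (hc : ConcentratedIn n c.1) :
    ConcentratedIn n (indWord c).1 := fun l hl => by
  refine (congrArg (TensorProduct.comm k A N) (twist_eq_zero fun l' hl' => hc l' ?_)).trans
    (map_zero _)
  rwa [hl', List.length_map]

variable [Module A N] [IsScalarTower k A N]

/-- The differential of words with values in the `A`-module `N`, a bimodule through the counit. -/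
def moduleD : letterLinear k A N →ₗ[k] letterLinear k A N :=
  letterD (Algebra.lsmul k k N : A →ₐ[k] Module.End k N).toLinearMap augAct

theorem comm_comp_tensorAct_left [Coalgebra.IsCocomm k A] (x : A) :
    (TensorProduct.comm k A N).toLinearMap ∘ₗ
        tensorAct (LinearMap.mul k A) (Algebra.lsmul k k N : A →ₐ[k] Module.End k N).toLinearMap
          (Coalgebra.comul x) =
      (leftAct x : Ind k A N →ₗ[k] Ind k A N) ∘ₗ (TensorProduct.comm k A N).toLinearMap := by
  suffices h : ∀ t : A ⊗[k] A, (TensorProduct.comm k A N).toLinearMap ∘ₗ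
      tensorAct (LinearMap.mul k A) (Algebra.lsmul k k N : A →ₐ[k] Module.End k N).toLinearMap t =
        tensorLsmul k A N (TensorProduct.comm k A A t) ∘ₗ
          (TensorProduct.comm k A N).toLinearMap by
    rw [h, Coalgebra.comm_comul, leftAct_ind]
    rfl
  intro t
  induction t with
  | zero => simp
  | add t t' ht ht' => simp only [map_add, LinearMap.add_comp, LinearMap.comp_add, ht, ht']
  | tmul y x => exact TensorProduct.ext' fun _ _ => rfl

theorem comm_comp_tensorAct_right (x : A) :
    (TensorProduct.comm k A N).toLinearMap ∘ₗ
        tensorAct (LinearMap.mul k A).flip augAct (Coalgebra.comul x) =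
      (rightAct x : Ind k A N →ₗ[k] Ind k A N) ∘ₗ (TensorProduct.comm k A N).toLinearMap := by
  have h : tensorAct (LinearMap.mul k A).flip (augAct (A := A) (N := N)) =
      LinearMap.rTensorHom N ∘ₗ (LinearMap.mul k A).flip ∘ₗ
        (TensorProduct.rid k A).toLinearMap ∘ₗ Coalgebra.counit.lTensor A := by
    ext
    simp [augAct, TensorProduct.smul_tmul']
  rw [h, rightAct_ind]
  simp only [LinearMap.comp_apply, Coalgebra.lTensor_counit_comul]
  exact TensorProduct.ext' fun b n => congrArg (fun r => n ⊗ₜ[k] (b * r)) (one_smul k x)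

theorem letterD_indWord [Coalgebra.IsCocomm k A] (c : letterLinear k A N) :
    letterD leftAct rightAct (indWord c) = indWord (moduleD c) := by
  let φ := Bialgebra.comulAlgHom k A
  let L := tensorAct (LinearMap.mul k A) (Algebra.lsmul k k N : A →ₐ[k] Module.End k N).toLinearMap
  let R := tensorAct (LinearMap.mul k A).flip (augAct (A := A) (N := N))
  have comul_comm := letterD_letterMap (L := L ∘ₗ φ.toLinearMap) (R := R ∘ₗ φ.toLinearMap)
    (L' := leftAct (M := Ind k A N)) comm_comp_tensorAct_left comm_comp_tensorAct_right
  refine (comul_comm _).trans (congrArg (letterMap _) ?_)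
  rw [LinearMap.comp_apply, letterD_letterComap, letterD_twist]
  rfl

end Cochains

section HopfModules

variable {k : Type u} [Field k] {A : Type v} [Ring A] [HopfAlgebra k A]
  {N : Type w} [AddCommGroup N] [Module k N] [Module A N] [IsScalarTower k A N]
  {M : Type x} [AddCommGroup M] [Module k M] [Module (Env k A) M] [IsScalarTower k (Env k A) M]

instance : Module k (Triv k A) := inferInstanceAs (Module k k)

instance : IsScalarTower k A (Triv k A) where
  smul_assoc r a c := show Coalgebra.counit (R := k) (r • a) * (show k from c) =
    r * (Coalgebra.counit (R := k) a * (show k from c)) by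
      rw [map_smul, smul_eq_mul, mul_assoc]

instance : Module k (Ad k A M) := inferInstanceAs (Module k M)

instance : IsScalarTower k A (Ad k A M) where
  smul_assoc r a m := by
    have h := smul_assoc r (deltaHom k A a) (show M from m)
    rw [← map_smul] at h
    exact h

theorem tmul_smul (x : A) (y : Aᵐᵒᵖ) (m : M) :
    (x ⊗ₜ[k] y : Env k A) • m = rightAct (k := k) y.unop (leftAct (k := k) x m) := by
  have split : (x ⊗ₜ[k] y : Env k A) = (1 ⊗ₜ[k] y) * (x ⊗ₜ[k] 1) := by simp
  rw [split, mul_smul]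
  rfl

/-- A `k`-linear map that is compatible with both actions, as a map of bimodules. -/
def bimoduleHom {M' : Type y} [AddCommGroup M'] [Module k M'] [Module (Env k A) M']
    [IsScalarTower k (Env k A) M'] (f : M →ₗ[k] M')
    (hl : ∀ x : A, f ∘ₗ leftAct x = leftAct x ∘ₗ f)
    (hr : ∀ x : A, f ∘ₗ rightAct x = rightAct x ∘ₗ f) :
    M →ₗ[Env k A] M' where
  toFun := f
  map_add' := f.map_add
  map_smul' e m := by
    have agree : f ∘ₗ (Algebra.lsmul k k M : Env k A →ₐ[k] Module.End k M).toLinearMap.flip m =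
        (Algebra.lsmul k k M' : Env k A →ₐ[k] Module.End k M').toLinearMap.flip (f m) :=
      TensorProduct.ext' fun x y => by
        change f ((x ⊗ₜ[k] y : Env k A) • m) = (x ⊗ₜ[k] y : Env k A) • f m
        rw [tmul_smul, tmul_smul]
        exact (LinearMap.congr_fun (hr y.unop) _).trans
          (congrArg _ (LinearMap.congr_fun (hl x) m))
    exact LinearMap.congr_fun agree e

theorem lTensor_assoc_comul_of_comp_comul {Q : A ⊗[k] A →ₗ[k] A}
    (hQ : Q ∘ₗ Coalgebra.comul = Algebra.linearMap k A ∘ₗ Coalgebra.counit) (a : A) :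
    Q.lTensor A (TensorProduct.assoc k A A A (Coalgebra.comul.rTensor A (Coalgebra.comul a))) =
      a ⊗ₜ[k] 1 := by
  rw [Coalgebra.coassoc_apply, ← LinearMap.lTensor_comp_apply, hQ, LinearMap.lTensor_comp_apply,
    Coalgebra.lTensor_counit_comul, LinearMap.lTensor_tmul, Algebra.linearMap_apply, map_one]

/-- The linear map `n ⊗ b ↦ φ(n) b`. -/
def actRight (φ : N →ₗ[k] M) : Ind k A N →ₗ[k] M :=
  show N ⊗[k] A →ₗ[k] M from TensorProduct.lift ((rightAct (k := k) (A := A) (M := M)).flip ∘ₗ φ)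

theorem actRight_comp_rightAct (φ : N →ₗ[k] M) (x : A) :
    actRight φ ∘ₗ rightAct (k := k) (M := Ind k A N) x = rightAct x ∘ₗ actRight φ := by
  rw [rightAct_ind]
  exact TensorProduct.ext' fun n b => LinearMap.congr_fun (rightAct_mul b x) (φ n)

theorem actRight_comp_leftAct {φ : N →ₗ[k] M}
    (hφ : ∀ (a : A) n, φ (a • n) = deltaHom k A a • φ n) (x : A) :
    actRight φ ∘ₗ leftAct (k := k) (M := Ind k A N) x = leftAct x ∘ₗ actRight φ := by
  rw [leftAct_ind]
  refine TensorProduct.ext' fun n b => ?_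
  let Q := LinearMap.mul' k A ∘ₗ (HopfAlgebra.antipode k).rTensor A
  let Φ : A ⊗[k] A →ₗ[k] M := TensorProduct.lift
    (((rightAct (k := k) (M := M)).flip ∘ₗ leftAct.flip (φ n)).compl₂ (LinearMap.mulRight k b))
  let Ψ : A ⊗[k] A →ₗ[k] M := actRight φ ∘ₗ LinearMap.applyₗ (n ⊗ₜ[k] b : N ⊗[k] A) ∘ₗ
    (tensorLsmul k A N).toLinearMap
  have inner (z : A) : rightAct (k := k) (z * b) ∘ₗ
      (Algebra.lsmul k k M : Env k A →ₐ[k] Module.End k M).toLinearMap.flip (φ n) ∘ₗ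
        (Algebra.TensorProduct.map (AlgHom.id k A)
          (HopfAlgebra.antipodeAlgHomOp k A)).toLinearMap =
      Φ ∘ₗ Q.lTensor A ∘ₗ (TensorProduct.assoc k A A A).toLinearMap ∘ₗ
        (TensorProduct.mk k (A ⊗[k] A) A).flip z := by
    refine TensorProduct.ext' fun y t => ?_
    let m := leftAct (k := k) y (φ n)
    let s := HopfAlgebra.antipode k t
    calc rightAct (k := k) (z * b) ((y ⊗ₜ MulOpposite.op s : Env k A) • φ n)
        = rightAct (k := k) (z * b) (rightAct (k := k) s m) := by
          rw [tmul_smul]; rfl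
      _ = rightAct (k := k) (s * z * b) m := by
          rw [mul_assoc, rightAct_mul _ (z * b)]; rfl
  have outer : Ψ = Φ ∘ₗ Q.lTensor A ∘ₗ (TensorProduct.assoc k A A A).toLinearMap ∘ₗ
      Coalgebra.comul.rTensor A :=
    TensorProduct.ext' fun y z => (congrArg (rightAct (k := k) (z * b)) (hφ y n)).trans
      (LinearMap.congr_fun (inner z) (Coalgebra.comul y))
  refine (LinearMap.congr_fun outer (Coalgebra.comul x)).trans ?_
  refine (congrArg Φ (lTensor_assoc_comul_of_comp_comul ?_ x)).trans ?_
  · exact HopfAlgebra.mul_antipode_rTensor_comul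
  · refine (congrArg (rightAct (k := k) · (leftAct (k := k) x (φ n))) (one_mul b)).trans ?_
    exact (LinearMap.congr_fun (leftAct_mul_rightAct x b) (φ n)).symm

/-- The map of bimodules `n ⊗ b ↦ φ(n) b` that corresponds to a map into the restriction of a
bimodule. -/
def indLift (φ : N →ₗ[A] Ad k A M) : Ind k A N →ₗ[Env k A] M :=
  let φₗ : N →ₗ[k] M := φ.restrictScalars k
  bimoduleHom (actRight φₗ) (actRight_comp_leftAct φ.map_smul)
    (actRight_comp_rightAct φₗ)

theorem deltaHom_smul_tmul_one (a : A) (n : N) :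
    deltaHom k A a • (show Ind k A N from n ⊗ₜ[k] (1 : A)) = (a • n) ⊗ₜ[k] (1 : A) := by
  let Q := LinearMap.mul' k A ∘ₗ (HopfAlgebra.antipode k).lTensor A
  let Ω : A ⊗[k] A →ₗ[k] N ⊗[k] A :=
    ((Algebra.lsmul k k N : A →ₐ[k] Module.End k N).toLinearMap.flip n).rTensor A
  let Ψ : A ⊗[k] A →ₗ[k] Ind k A N :=
    (Algebra.lsmul k k (Ind k A N) : Env k A →ₐ[k] _).toLinearMap.flip
      (show Ind k A N from n ⊗ₜ[k] (1 : A)) ∘ₗ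
      (Algebra.TensorProduct.map (AlgHom.id k A) (HopfAlgebra.antipodeAlgHomOp k A)).toLinearMap
  have inner (t : A) : (tensorLsmul k A N).toLinearMap.flip (n ⊗ₜ HopfAlgebra.antipode k t) =
      Ω ∘ₗ Q.lTensor A ∘ₗ (TensorProduct.assoc k A A A).toLinearMap ∘ₗ
        (TensorProduct.mk k (A ⊗[k] A) A).flip t :=
    TensorProduct.ext' fun _ _ => rfl
  have outer : Ψ = Ω ∘ₗ Q.lTensor A ∘ₗ (TensorProduct.assoc k A A A).toLinearMap ∘ₗ
      Coalgebra.comul.rTensor A :=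
    TensorProduct.ext' fun y t => by
      let s := HopfAlgebra.antipode k t
      let e : Ind k A N := n ⊗ₜ[k] (1 : A)
      refine Eq.trans ?_ (LinearMap.congr_fun (inner t) (Coalgebra.comul y))
      refine (tmul_smul (k := k) (A := A) (M := Ind k A N) y (MulOpposite.op s) e).trans ?_
      refine (LinearMap.congr_fun (leftAct_mul_rightAct (k := k) y s) e).symm.trans ?_
      rw [leftAct_ind, rightAct_ind]
      exact congrArg (fun b => tensorLsmul k A N (Coalgebra.comul y) (n ⊗ₜ b)) (one_mul s)
  refine (LinearMap.congr_fun outer (Coalgebra.comul a)).trans ?_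
  refine (congrArg Ω (lTensor_assoc_comul_of_comp_comul ?_ a)).trans rfl
  exact HopfAlgebra.mul_antipode_lTensor_comul

variable (k A N) in
/-- The map `n ↦ n ⊗ 1`. -/
def indUnit : N →ₗ[A] Ad k A (Ind k A N) where
  toFun n := n ⊗ₜ[k] (1 : A)
  map_add' n n' := TensorProduct.add_tmul n n' 1
  map_smul' a n := (deltaHom_smul_tmul_one a n).symm

theorem indLift_tmul (φ : N →ₗ[A] Ad k A M) (n : N) (b : A) :
    indLift φ (show Ind k A N from n ⊗ₜ b) = rightAct (k := k) b (show M from φ n) := rfl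

theorem indLift_indUnit (φ : N →ₗ[A] Ad k A M) (n : N) :
    indLift φ (show Ind k A N from indUnit k A N n) = φ n :=
  one_smul (Env k A) (show M from φ n)

theorem indLift_comp {M' : Type y} [AddCommGroup M'] [Module k M'] [Module (Env k A) M']
    [IsScalarTower k (Env k A) M'] (f : M →ₗ[Env k A] M') (φ : N →ₗ[A] Ad k A M) :
    indLift (adMap f ∘ₗ φ) = f ∘ₗ indLift φ := by
  refine LinearMap.ext fun t => ?_
  exact LinearMap.congr_fun (f := (indLift (adMap f ∘ₗ φ)).restrictScalars k)
    (g := (f ∘ₗ indLift φ).restrictScalars k)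
    (TensorProduct.ext' (M := N) (N := A) fun n b =>
      (f.map_smul (1 ⊗ₜ MulOpposite.op b : Env k A) (φ n)).symm) t

variable {N' : Type y} [AddCommGroup N'] [Module k N'] [Module A N'] [IsScalarTower k A N']

/-- The map `n ⊗ b ↦ φ(n) ⊗ b` of induced bimodules. -/
def indMap (φ : N →ₗ[A] N') : Ind k A N →ₗ[Env k A] Ind k A N' :=
  indLift (indUnit k A N' ∘ₗ φ)

theorem indMap_tmul (φ : N →ₗ[A] N') (n : N) (b : A) :
    indMap (k := k) φ (show Ind k A N from n ⊗ₜ[k] b) = (φ n ⊗ₜ[k] b : N' ⊗[k] A) := by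
  refine (indLift_tmul _ n b).trans ?_
  rw [rightAct_ind]
  exact congrArg (φ n ⊗ₜ[k] ·) (one_mul b)

theorem indMap_eq_rTensor (φ : N →ₗ[A] N') :
    (indMap (k := k) φ).restrictScalars k = (φ.restrictScalars k).rTensor A :=
  TensorProduct.ext' (M := N) (N := A) fun n b => indMap_tmul φ n b

theorem letterMap_indWord (φ : N →ₗ[A] N') (c : letterLinear k A N) :
    letterMap ((indMap (k := k) φ).restrictScalars k) (indWord c) =
      indWord (letterMap (φ.restrictScalars k) c) := by
  have twist_comm := congrArg (letterMap (TensorProduct.comm k A N').toLinearMap ∘ₗ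
    letterComap (Bialgebra.comulAlgHom k A)) (twist_letterMap (C := A) (φ.restrictScalars k) c)
  refine Eq.trans ?_ twist_comm.symm
  refine Subtype.ext (funext fun l => ?_)
  have comm_comp : (φ.restrictScalars k).rTensor A ∘ₗ (TensorProduct.comm k A N).toLinearMap =
      (TensorProduct.comm k A N').toLinearMap ∘ₗ (φ.restrictScalars k).lTensor A :=
    TensorProduct.ext' fun _ _ => rfl
  rw [indMap_eq_rTensor]
  exact LinearMap.congr_fun comm_comp ((twist A c).1 (l.map (Bialgebra.comulAlgHom k A)))

end HopfModules

section MarkedNaturality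

variable {k A B M M' P P' : Type*} [CommRing k] [Ring A] [Algebra k A] [Ring B] [Algebra k B]
  [AddCommGroup M] [Module k M] [AddCommGroup M'] [Module k M']
  [AddCommGroup P] [Module k P] [AddCommGroup P'] [Module k P']
  {φ ψ : A →ₐ[k] B} {Θ : (P →ₗ[k] P') →ₗ[k] M →ₗ[k] M'}
  {LB RB : B → Module.End k P} {LB' RB' : B → Module.End k P'}
  {L R : A → Module.End k M} {L' R' : A → Module.End k M'}

theorem tailD_map (hR : ∀ H x, Θ (H ∘ₗ RB (ψ x)) = Θ H ∘ₗ R x)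
    (hR' : ∀ H x, Θ (RB' (ψ x) ∘ₗ H) = R' x ∘ₗ Θ H) (H : List B → P →ₗ[k] P') (w : List A) :
    tailD R R' (fun w => Θ (H (w.map ψ))) w = Θ (tailD RB RB' H (w.map ψ)) := by
  cases w with
  | nil => exact (map_zero Θ).symm
  | cons b w =>
    simp only [List.map_cons, tailD, map_sub, hR, map_contract, contract_map, hR']

theorem headContract_map {F : List B → List B → P →ₗ[k] P'}
    (hL : ∀ (u w : List A) x,
      Θ (F (u.map φ) (w.map ψ) ∘ₗ LB (φ x)) = Θ (F (u.map φ) (w.map ψ)) ∘ₗ L x)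
    (hR : ∀ H x, Θ (H ∘ₗ RB (ψ x)) = Θ H ∘ₗ R x)
    (hR' : ∀ H x, Θ (RB' (ψ x) ∘ₗ H) = R' x ∘ₗ Θ H) (a : A) (u w : List A) :
    headContract L R R' (fun u w => Θ (F (u.map φ) (w.map ψ))) a u w =
      Θ (headContract LB RB RB' F (φ a) (u.map φ) (w.map ψ)) := by
  simp only [headContract, map_contract, contract_map, map_sub, hL, tailD_map hR hR',
    List.map_append, List.map_cons, List.map_nil]

theorem markedD_map {F : List B → List B → P →ₗ[k] P'}
    (hL : ∀ (u w : List A) x,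
      Θ (F (u.map φ) (w.map ψ) ∘ₗ LB (φ x)) = Θ (F (u.map φ) (w.map ψ)) ∘ₗ L x)
    (hR : ∀ H x, Θ (H ∘ₗ RB (ψ x)) = Θ H ∘ₗ R x)
    (hL' : ∀ H x, Θ (LB' (φ x) ∘ₗ H) = L' x ∘ₗ Θ H)
    (hR' : ∀ H x, Θ (RB' (ψ x) ∘ₗ H) = R' x ∘ₗ Θ H) (u w : List A) :
    markedD L R L' R' (fun u w => Θ (F (u.map φ) (w.map ψ))) u w =
      Θ (markedD LB RB LB' RB' F (u.map φ) (w.map ψ)) := by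
  cases u with
  | nil => exact (congrArg Neg.neg (tailD_map hR hR' (F []) w)).trans (map_neg Θ _).symm
  | cons a u => simp only [List.map_cons, markedD, map_sub, hL', headContract_map hL hR hR']

end MarkedNaturality

section IndMarked

variable {k : Type u} [Field k] {A : Type v} [Ring A] [Bialgebra k A]
  {N : Type w} [AddCommGroup N] [Module k N] [Module A N] [IsScalarTower k A N]

variable (k A) in
/-- The map `y ⊗ b ↦ y n ⊗ b`. -/
def orbitTensor : N →ₗ[k] A ⊗[k] A →ₗ[k] N ⊗[k] A :=
  LinearMap.rTensorHom A ∘ₗ (Algebra.lsmul k k N : A →ₐ[k] Module.End k N).toLinearMap.flip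

theorem orbitTensor_tmul (n : N) (y b : A) : orbitTensor k A n (y ⊗ₜ b) = (y • n) ⊗ₜ b := rfl

theorem orbitTensor_mul (n : N) (t z : A ⊗[k] A) :
    orbitTensor k A n (t * z) = tensorLsmul k A N t (orbitTensor k A n z) := by
  induction z with
  | zero => simp only [mul_zero, map_zero]
  | add z z' hz hz' => simp only [mul_add, map_add, hz, hz']
  | tmul y b =>
    refine LinearMap.congr_fun (f := orbitTensor k A n ∘ₗ LinearMap.mulRight k (y ⊗ₜ b))
      (g := (tensorLsmul k A N).toLinearMap.flip (orbitTensor k A n (y ⊗ₜ b))) ?_ t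
    exact TensorProduct.ext' fun s c => by
      simp [orbitTensor_tmul, tensorLsmul_tmul, mul_smul]

theorem orbitTensor_mul_tmul_one (n : N) (z : A ⊗[k] A) (y : A) :
    orbitTensor k A n (z * y ⊗ₜ 1) = orbitTensor k A (y • n) z := by
  refine LinearMap.congr_fun (f := orbitTensor k A n ∘ₗ LinearMap.mulRight k (y ⊗ₜ 1))
    (TensorProduct.ext' fun s c => ?_) z
  simp [orbitTensor_tmul, mul_smul]

theorem orbitTensor_mul_one_tmul (n : N) (z : A ⊗[k] A) (x : A) :
    orbitTensor k A n (z * 1 ⊗ₜ x) =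
      tensorRmul k A N (MulOpposite.op x) (orbitTensor k A n z) := by
  refine LinearMap.congr_fun (f := orbitTensor k A n ∘ₗ LinearMap.mulRight k (1 ⊗ₜ x))
    (g := tensorRmul k A N (MulOpposite.op x) ∘ₗ orbitTensor k A n)
    (TensorProduct.ext' fun s c => ?_) z
  simp [orbitTensor_tmul, tensorRmul_tmul]

variable (N) in
/-- The linear map `n ⊗ b ↦ y n ⊗ b'` induced by a linear map `φ` with `φ (1 ⊗ b) = y ⊗ b'`. -/
def orbitEnd : (A ⊗[k] A →ₗ[k] A ⊗[k] A) →ₗ[k] Ind k A N →ₗ[k] Ind k A N where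
  toFun φ := show N ⊗[k] A →ₗ[k] N ⊗[k] A from
    TensorProduct.lift ((orbitTensor k A).compl₂ (φ ∘ₗ TensorProduct.mk k A A 1))
  map_add' _ _ := TensorProduct.ext' (M := N) (N := A) fun n _ =>
    map_add (orbitTensor k A n) _ _
  map_smul' r _ := TensorProduct.ext' (M := N) (N := A) fun n _ =>
    map_smul (orbitTensor k A n) r _

theorem orbitEnd_id : orbitEnd N (LinearMap.id : A ⊗[k] A →ₗ[k] A ⊗[k] A) = LinearMap.id :=
  TensorProduct.ext' (M := N) (N := A) fun n b => congrArg (· ⊗ₜ[k] b) (one_smul A n)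

theorem orbitEnd_comp_mulLeft {φ : A ⊗[k] A →ₗ[k] A ⊗[k] A}
    (hφ : ∀ y b : A, φ (y ⊗ₜ b) = φ (1 ⊗ₜ b) * y ⊗ₜ 1) (x : A) :
    orbitEnd N (φ ∘ₗ LinearMap.mulLeft k (Coalgebra.comul x)) = orbitEnd N φ ∘ₗ leftAct x := by
  rw [leftAct_ind]
  refine TensorProduct.ext' (M := N) (N := A) fun n b => ?_
  refine LinearMap.congr_fun
    (f := orbitTensor k A n ∘ₗ φ ∘ₗ LinearMap.mulRight k (1 ⊗ₜ b))
    (g := orbitEnd N φ ∘ₗ (tensorLsmul k A N).toLinearMap.flip (n ⊗ₜ b)) ?_ (Coalgebra.comul x)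
  refine TensorProduct.ext' fun y z => ?_
  have move : φ (y ⊗ₜ z * 1 ⊗ₜ b) = φ (1 ⊗ₜ (z * b)) * y ⊗ₜ 1 := by
    rw [Algebra.TensorProduct.tmul_mul_tmul, mul_one, hφ]
  exact (congrArg _ move).trans (orbitTensor_mul_tmul_one n _ y)

theorem orbitEnd_comp_mulRight (φ : A ⊗[k] A →ₗ[k] A ⊗[k] A) (x : A) :
    orbitEnd N (φ ∘ₗ LinearMap.mulRight k (1 ⊗ₜ x)) = orbitEnd N φ ∘ₗ rightAct x := by
  rw [rightAct_ind]
  refine TensorProduct.ext' (M := N) (N := A) fun n b => ?_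
  refine congrArg (orbitTensor k A n ∘ₗ φ) ?_
  exact (Algebra.TensorProduct.tmul_mul_tmul 1 1 b x).trans (by rw [mul_one]; rfl)

theorem orbitEnd_mulLeft_comp (φ : A ⊗[k] A →ₗ[k] A ⊗[k] A) (x : A) :
    orbitEnd N (LinearMap.mulLeft k (Coalgebra.comul x) ∘ₗ φ) = leftAct x ∘ₗ orbitEnd N φ := by
  rw [leftAct_ind]
  exact TensorProduct.ext' (M := N) (N := A) fun n b => orbitTensor_mul n _ _

theorem orbitEnd_mulRight_comp (φ : A ⊗[k] A →ₗ[k] A ⊗[k] A) (x : A) :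
    orbitEnd N (LinearMap.mulRight k (1 ⊗ₜ x) ∘ₗ φ) = rightAct x ∘ₗ orbitEnd N φ := by
  rw [rightAct_ind]
  exact TensorProduct.ext' (M := N) (N := A) fun n b => orbitTensor_mul_one_tmul n _ x

variable (N) in
/-- The operator `n ⊗ b ↦ ∑ y n ⊗ b'` on `N ⊗ A`, where `∑ y ⊗ b'` is the value of `twist A g` at
the word `Δ(u₁) ⋯ Δ(uᵣ) (1 ⊗ b) (1 ⊗ w₁) ⋯ (1 ⊗ wₛ)`.
It extends `mark g u w` from `A` to `N ⊗ A`. -/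
def indMark (g : letterLinear k A A) (u w : List A) : Ind k A N →ₗ[k] Ind k A N :=
  orbitEnd N (mark (twist A g) (u.map (Bialgebra.comulAlgHom k A))
    (w.map (Algebra.TensorProduct.includeRight : A →ₐ[k] A ⊗[k] A)))

theorem indMark_tmul (g : letterLinear k A A) (u w : List A) (n : N) (b : A) :
    indMark N g u w (show Ind k A N from n ⊗ₜ b) =
      orbitTensor k A n ((twist A g).1
        (u.map (Bialgebra.comulAlgHom k A) ++ 1 ⊗ₜ b :: w.map fun x => 1 ⊗ₜ x)) := rfl

theorem indMark_mem_left (g : letterLinear k A A) (w : List A) :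
    (fun u => indMark N g u w) ∈ letterLinear k A (Ind k A N →ₗ[k] Ind k A N) :=
  (letterMap (orbitEnd N) (letterComap (Bialgebra.comulAlgHom k A)
    ⟨_, mark_mem_left (twist A g) (w.map Algebra.TensorProduct.includeRight)⟩)).2

theorem indMark_mem_right (g : letterLinear k A A) (u : List A) :
    indMark N g u ∈ letterLinear k A (Ind k A N →ₗ[k] Ind k A N) :=
  (letterMap (orbitEnd N) (letterComap Algebra.TensorProduct.includeRight
    ⟨_, mark_mem_right (twist A g) (u.map (Bialgebra.comulAlgHom k A))⟩)).2

theorem markedD_indMark {g : letterLinear k A A} {n : ℕ} (hg : ConcentratedIn n g.1)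
    (hδ : letterD (LinearMap.mul k A) (LinearMap.mul k A).flip g = 0)
    (hΔ : ∀ l, Coalgebra.comul (g.1 l) = (twist A g).1 (l.map (Bialgebra.comulAlgHom k A))) :
    markedD leftAct rightAct leftAct rightAct (indMark N g) = fun u w =>
      -(if u = [] then rightAct (g.1 w) else 0) -
        if w = [] then (-1 : k) ^ (n + 1) • leftAct (g.1 u) else 0 := by
  have hG : ConcentratedIn n (twist A g).1 := fun U hU =>
    twist_eq_zero fun l hl => hg l fun h => hU (hl.symm.trans h)
  have hδG := congrArg Subtype.val (wordD_twist_eq_zero (C := A) hδ)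
  funext u w
  have transport := markedD_map (Θ := orbitEnd N) (F := mark (twist A g)) (R' := rightAct)
    (L := leftAct) (R := rightAct) (L' := leftAct)
    (φ := Bialgebra.comulAlgHom k A) (ψ := Algebra.TensorProduct.includeRight (R := k) (A := A))
    (fun u w x => orbitEnd_comp_mulLeft
      (fun y b => twist_append_tmul_cons g (u.map (Bialgebra.comulAlgHom k A)) y b w) x)
    orbitEnd_comp_mulRight orbitEnd_mulLeft_comp orbitEnd_mulRight_comp u w
  refine transport.trans ?_
  rw [markedD_mark_of_wordD_eq_zero hG hδG]
  have left : orbitEnd N (LinearMap.mulRight k ((twist A g).1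
      (w.map (Algebra.TensorProduct.includeRight : A →ₐ[k] A ⊗[k] A)))) = rightAct (g.1 w) := by
    have := orbitEnd_mulRight_comp (k := k) (N := N) .id (g.1 w)
    rw [orbitEnd_id, ← twist_map_one_tmul] at this
    exact this
  have right : orbitEnd N (LinearMap.mulLeft k ((twist A g).1
      (u.map (Bialgebra.comulAlgHom k A)))) = leftAct (g.1 u) := by
    have := orbitEnd_mulLeft_comp (k := k) (N := N) .id (g.1 u)
    rw [orbitEnd_id, hΔ] at this
    exact this
  simp only [List.map_eq_nil_iff, map_sub, map_neg]
  split_ifs <;> simp only [left, right, map_smul, map_zero]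

end IndMarked

section Naturality

variable {k : Type u} [Field k] {A : Type v} [Ring A] [HopfAlgebra k A]
  {N : Type w} [AddCommGroup N] [Module k N] [Module A N] [IsScalarTower k A N]
  {N' : Type x} [AddCommGroup N'] [Module k N'] [Module A N'] [IsScalarTower k A N']

theorem indMap_indMark (φ : N →ₗ[A] N') (g : letterLinear k A A) (u w : List A) :
    (indMap (k := k) φ).restrictScalars k ∘ₗ indMark N g u w =
      indMark N' g u w ∘ₗ (indMap φ).restrictScalars k := by
  rw [indMap_eq_rTensor]
  refine TensorProduct.ext' (M := N) (N := A) fun n b => ?_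
  have orbit : (φ.restrictScalars k).rTensor A ∘ₗ orbitTensor k A n = orbitTensor k A (φ n) :=
    TensorProduct.ext' fun y b => congrArg (· ⊗ₜ[k] b) (φ.map_smul y n)
  exact LinearMap.congr_fun orbit _

theorem indLift_unitMap_tmul (p : N →ₗ[A] Triv k A) (n : N) (b : A) :
    indLift (unitMap k A ∘ₗ p) (show Ind k A N from n ⊗ₜ b) = (show k from p n) • b := by
  rw [indLift_tmul, rightAct_self, Algebra.smul_def]
  rfl

theorem indLift_unitMap_indMark (p : N →ₗ[A] Triv k A) (g : letterLinear k A A) (u w : List A) :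
    (indLift (unitMap k A ∘ₗ p)).restrictScalars k ∘ₗ indMark N g u w =
      mark g u w ∘ₗ (indLift (unitMap k A ∘ₗ p)).restrictScalars k := by
  refine TensorProduct.ext' (M := N) (N := A) fun n b => ?_
  let c : k := p n
  have orbit : (indLift (unitMap k A ∘ₗ p)).restrictScalars k ∘ₗ orbitTensor k A n =
      c • counitTensor k A A := TensorProduct.ext' fun y b => by
    refine (indLift_unitMap_tmul p (y • n) b).trans ?_
    rw [p.map_smul]
    exact (congrArg (· • b) (mul_comm _ c)).trans (mul_smul c _ b)
  have word := congrFun (congrArg Subtype.val (counitTensor_twist (C := A) g))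
    (u.map (Bialgebra.comulAlgHom k A) ++ 1 ⊗ₜ b :: w.map fun x => 1 ⊗ₜ x)
  refine (LinearMap.congr_fun orbit _).trans ((congrArg (c • ·) word).trans ?_)
  have letters : (u.map (Bialgebra.comulAlgHom k A) ++ 1 ⊗ₜ[k] b :: w.map fun x => 1 ⊗ₜ[k] x).map
      (counitTensorAlgHom k A A) = u ++ b :: w := by
    have counit_comul (x : A) : counitTensorAlgHom k A A (Coalgebra.comul x) = x := by
      refine (congrArg (TensorProduct.lid k A) (Coalgebra.rTensor_counit_comul x)).trans ?_
      exact one_smul k x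
    have counit_one_tmul (x : A) : counitTensorAlgHom k A A (1 ⊗ₜ x) = x := by
      simp [counitTensorAlgHom]
    simp [Function.comp_def, counit_comul, counit_one_tmul]
  refine (congrArg (c • g.1 ·) letters).trans (((mark g u w).map_smul c b).symm.trans ?_)
  exact congrArg (mark g u w) (indLift_unitMap_tmul p n b).symm

end Naturality

section BarExact

variable {k : Type u} [Field k] {A : Type v} [Ring A] [Algebra k A]

variable (k A) in
/-- The universal cochain `barUniv k A n` as a function of words. -/
def barWord (n : ℕ) : letterLinear k A (Bar k A n) := ofCochain (barUniv k A n)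

theorem letterMap_barExtend {M : Type w} [AddCommGroup M] [Module k M] [Module (Env k A) M]
    [IsScalarTower k (Env k A) M] {n : ℕ} (c : Cochain k A M n) :
    letterMap ((barExtend c).restrictScalars k) (barWord k A n) = ofCochain c := by
  have conc : ConcentratedIn n
      (letterMap ((barExtend c).restrictScalars k) (barWord k A n)).1 := fun l hl =>
    (congrArg (barExtend c) (concentratedIn_ofCochain _ l hl)).trans (map_zero _)
  rw [← ofCochain_toCochain conc]
  refine congrArg ofCochain (MultilinearMap.ext fun a => ?_)
  refine Eq.trans ?_ (barExtend_barUniv c a)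
  exact congrArg (barExtend c) (congrArg (· a) (toCochain_ofCochain (barUniv k A n)))

theorem letterMap_barD (n : ℕ) :
    letterMap ((barD k A n).restrictScalars k) (barWord k A (n + 1)) =
      letterD leftAct rightAct (barWord k A n) :=
  (letterMap_barExtend _).trans (letterD_ofCochain _).symm

theorem barD_barWord_cons (n : ℕ) (a : A) (l : List A) :
    barD k A n ((barWord k A (n + 1)).1 (a :: l)) = leftAct (k := k) a ((barWord k A n).1 l) -
      contract (barWord k A n).1 (fun u x => rightAct (k := k) x ((barWord k A n).1 u)) a l :=
  congrFun (congrArg Subtype.val (letterMap_barD n)) (a :: l)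

theorem barWord_ofFn {n : ℕ} (a : Fin n → A) : (barWord k A n).1 (List.ofFn a) = barUniv k A n a :=
  congrArg (· a) (toCochain_ofCochain (barUniv k A n))

theorem rightAct_one {M : Type w} [AddCommGroup M] [Module k M] [Module (Env k A) M]
    [IsScalarTower k (Env k A) M] : rightAct (k := k) (1 : A) = (.id : M →ₗ[k] M) :=
  LinearMap.ext fun m => one_smul (Env k A) m

theorem leftAct_rightAct_barUniv {n : ℕ} (x y : A) (a : Fin n → A) :
    leftAct (k := k) x (rightAct (k := k) y (barUniv k A n a)) =
      (x ⊗ₜ MulOpposite.op y : Env k A) ⊗ₜ[k] PiTensorProduct.tprod k a := by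
  have hr : rightAct (k := k) (M := Bar k A n) y (barUniv k A n a) =
      ((1 ⊗ₜ[k] MulOpposite.op y : Env k A) * 1) ⊗ₜ[k] PiTensorProduct.tprod k a := rfl
  have hl (e : Env k A) : leftAct (k := k) (M := Bar k A n) x (e ⊗ₜ[k] PiTensorProduct.tprod k a) =
      ((x ⊗ₜ[k] 1 : Env k A) * e) ⊗ₜ[k] PiTensorProduct.tprod k a := rfl
  rw [hr, hl, mul_one, Algebra.TensorProduct.tmul_mul_tmul, mul_one, one_mul]

theorem linearMap_bar_ext {M : Type*} [AddCommMonoid M] [Module k M] {n : ℕ}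
    {f g : Bar k A n →ₗ[k] M} (h : ∀ (x y : A) l, l.length = n →
      f (leftAct (k := k) x (rightAct (k := k) y ((barWord k A n).1 l))) =
        g (leftAct (k := k) x (rightAct (k := k) y ((barWord k A n).1 l)))) : f = g := by
  refine TensorProduct.ext (TensorProduct.ext' fun x y => PiTensorProduct.ext ?_)
  refine MultilinearMap.ext fun a => ?_
  have hxy := h x y.unop (List.ofFn a) List.length_ofFn
  rwa [barWord_ofFn, leftAct_rightAct_barUniv] at hxy

variable (k A) in
/-- The contracting homotopy `x ⊗ (a₁, …, aₙ) ⊗ y ↦ 1 ⊗ (x, a₁, …, aₙ) ⊗ y`. -/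
def barHomotopy (n : ℕ) : Bar k A n →ₗ[k] Bar k A (n + 1) :=
  let cons : A →ₗ[k] (⨂[k] _ : Fin n, A) →ₗ[k] Bar k A (n + 1) :=
    (PiTensorProduct.lift (R := k) (s := fun _ : Fin n => A)).toLinearMap ∘ₗ toCochain n ∘ₗ
      fixLetter.flip (barWord k A (n + 1))
  TensorProduct.lift (TensorProduct.lift (LinearMap.mk₂ k
    (fun x y => rightAct (k := k) (M := Bar k A (n + 1)) (MulOpposite.unop y) ∘ₗ cons x)
    (fun x x' y => by rw [map_add, LinearMap.comp_add])
    (fun r x y => by rw [map_smul, LinearMap.comp_smul])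
    (fun x y y' => by rw [MulOpposite.unop_add, map_add, LinearMap.add_comp])
    (fun r x y => by rw [MulOpposite.unop_smul, map_smul, LinearMap.smul_comp])))

theorem barHomotopy_barWord (n : ℕ) (x y : A) (l : List A) :
    barHomotopy k A n (leftAct (k := k) x (rightAct (k := k) y ((barWord k A n).1 l))) =
      rightAct (k := k) y ((barWord k A (n + 1)).1 (x :: l)) := by
  by_cases hl : l.length = n
  · subst hl
    have hU := barWord_ofFn (k := k) l.get
    rw [List.ofFn_get] at hU
    rw [hU, leftAct_rightAct_barUniv]
    refine congrArg (rightAct (k := k) (M := Bar k A (l.length + 1)) y) ?_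
    refine (PiTensorProduct.lift.tprod _).trans ?_
    exact congrArg (fun w => (barWord k A (l.length + 1)).1 (x :: w)) (List.ofFn_get l)
  · have hU : (barWord k A n).1 l = 0 := concentratedIn_ofCochain _ l hl
    have hU' : (barWord k A (n + 1)).1 (x :: l) = 0 :=
      concentratedIn_ofCochain _ _ (by simpa using hl)
    rw [hU, hU', map_zero, map_zero, map_zero, map_zero]

theorem barHomotopy_rightAct (n : ℕ) (y : A) (b : Bar k A n) :
    barHomotopy k A n (rightAct (k := k) y b) = rightAct (k := k) y (barHomotopy k A n b) := by
  suffices barHomotopy k A n ∘ₗ rightAct (k := k) (M := Bar k A n) y =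
      rightAct (k := k) (M := Bar k A (n + 1)) y ∘ₗ barHomotopy k A n from
    LinearMap.congr_fun this b
  refine linearMap_bar_ext fun x y' l _ => ?_
  have merge {m : ℕ} (b : Bar k A m) : rightAct (k := k) y (rightAct (k := k) y' b) =
      rightAct (k := k) (y' * y) b :=
    (LinearMap.congr_fun (rightAct_mul (k := k) (M := Bar k A m) y' y) b).symm
  rw [LinearMap.comp_apply, LinearMap.comp_apply, barHomotopy_barWord, merge,
    ← barHomotopy_barWord, ← merge]
  exact congrArg _ (LinearMap.congr_fun (leftAct_mul_rightAct (k := k) (M := Bar k A _) x y) _).symm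

theorem barHomotopy_leftAct_barWord (n : ℕ) (x : A) (l : List A) :
    barHomotopy k A n (leftAct (k := k) x ((barWord k A n).1 l)) =
      (barWord k A (n + 1)).1 (x :: l) := by
  have h := barHomotopy_barWord (k := k) n x 1 l
  have one {m : ℕ} (b : Bar k A m) : rightAct (k := k) (1 : A) b = b :=
    LinearMap.congr_fun (rightAct_one (k := k) (A := A) (M := Bar k A m)) b
  rwa [one, one] at h

theorem barHomotopy_leftAct_barD_barWord (n : ℕ) (x : A) (l : List A) :
    barHomotopy k A n (leftAct (k := k) x (barD k A n ((barWord k A (n + 1)).1 l))) =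
      contract (barWord k A (n + 1)).1
        (fun u z => rightAct (k := k) z ((barWord k A (n + 1)).1 u)) x l := by
  rcases l with - | ⟨a, l⟩
  · have hU : (barWord k A (n + 1)).1 [] = 0 := concentratedIn_ofCochain _ _ (by simp)
    rw [contract, hU, map_zero, map_zero, map_zero, map_zero]
  have left : leftAct (k := k) x (leftAct (k := k) a ((barWord k A n).1 l)) =
      leftAct (k := k) (x * a) ((barWord k A n).1 l) :=
    (LinearMap.congr_fun (leftAct_mul (k := k) (M := Bar k A n) x a) _).symm
  rw [barD_barWord_cons, map_sub, map_sub, left, barHomotopy_leftAct_barWord, contract]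
  have inner := map_contract (M' := Bar k A (n + 1))
    (LinearMap.comp (M₃ := Bar k A (n + 1)) (barHomotopy k A n)
      (leftAct (k := k) (M := Bar k A n) x))
    (barWord k A n).1 (fun u z => rightAct (k := k) z ((barWord k A n).1 u)) a l
  simp only [LinearMap.comp_apply, barHomotopy_leftAct_barWord, barHomotopy_barWord] at inner
  rw [inner]

theorem eq_self_of_barWord {n : ℕ} {f : Bar k A n →ₗ[k] Bar k A n}
    (hr : ∀ (y : A) b, f (rightAct (k := k) y b) = rightAct (k := k) y (f b))
    (h : ∀ (x : A) l, l.length = n → f (leftAct (k := k) x ((barWord k A n).1 l)) =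
      leftAct (k := k) x ((barWord k A n).1 l)) (b : Bar k A n) : f b = b := by
  suffices f = .id from LinearMap.congr_fun this b
  refine linearMap_bar_ext fun x y l hl => ?_
  have comm : leftAct (k := k) x (rightAct (k := k) y ((barWord k A n).1 l)) =
      rightAct (k := k) y (leftAct (k := k) x ((barWord k A n).1 l)) :=
    LinearMap.congr_fun (leftAct_mul_rightAct (k := k) (M := Bar k A _) x y) _
  rw [comm, hr, h x l hl, LinearMap.id_apply]

theorem barD_barHomotopy (n : ℕ) (b : Bar k A (n + 1)) :
    barD k A (n + 1) (barHomotopy k A (n + 1) b) + barHomotopy k A n (barD k A n b) = b := by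
  have left (x : A) (b : Bar k A (n + 1)) : barD k A n (leftAct (k := k) x b) =
      leftAct (k := k) x (barD k A n b) := (barD k A n).map_smul _ _
  have right {m : ℕ} (y : A) (b : Bar k A (m + 1)) : barD k A m (rightAct (k := k) y b) =
      rightAct (k := k) y (barD k A m b) := (barD k A m).map_smul _ _
  refine eq_self_of_barWord (f := (barD k A (n + 1)).restrictScalars k ∘ₗ
    barHomotopy k A (n + 1) + barHomotopy k A n ∘ₗ (barD k A n).restrictScalars k)
    (fun y b => ?_) (fun x l _ => ?_) b
  · change barD k A (n + 1) (barHomotopy k A (n + 1) _) + barHomotopy k A n (barD k A n _) =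
      rightAct (k := k) y
        (barD k A (n + 1) (barHomotopy k A (n + 1) b) + barHomotopy k A n (barD k A n b))
    rw [barHomotopy_rightAct, right, right, barHomotopy_rightAct, map_add]
  · change barD k A (n + 1) (barHomotopy k A (n + 1) _) + barHomotopy k A n (barD k A n _) = _
    rw [barHomotopy_leftAct_barWord, left, barHomotopy_leftAct_barD_barWord, barD_barWord_cons,
      sub_add_cancel]

theorem barD_barD (n : ℕ) : barD k A n ∘ₗ barD k A (n + 1) = 0 := by
  refine (barExtend_barD (hochschildD k A (Bar k A n) n (barUniv k A n))).trans ?_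
  rw [hochschildD_hochschildD]
  exact barExtend_zero

theorem barAug_barD : barAug k A ∘ₗ barD k A 0 = 0 := by
  refine (barExtend_barD _).trans (.trans (congrArg barExtend ?_) barExtend_zero)
  ext a
  have balanced : (a 0 ⊗ₜ[k] 1 : Env k A) • (1 : A) =
      (1 ⊗ₜ[k] MulOpposite.op (a 0) : Env k A) • (1 : A) := by
    simp [env_smul_def]
  simp [hochschildD_apply, balanced]

theorem exact_barD (n : ℕ) : Function.Exact (barD k A (n + 1)) (barD k A n) := fun b => by
  refine ⟨fun hb => ⟨barHomotopy k A (n + 1) b, ?_⟩, ?_⟩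
  · have h := barD_barHomotopy n b
    rwa [hb, map_zero, add_zero] at h
  · rintro ⟨b, rfl⟩
    exact LinearMap.congr_fun (barD_barD n) b

theorem barAug_leftAct_barWord_nil (x : A) :
    barAug k A (leftAct (k := k) x ((barWord k A 0).1 [])) = x := by
  have h := barWord_ofFn (k := k) (A := A) Fin.elim0
  refine (congrArg (barAug k A) (congrArg _ h)).trans ((barExtend_tmul _ _ _).trans ?_)
  change ((x ⊗ₜ[k] 1 : Env k A) * 1) • (1 : A) = x
  rw [mul_one, env_smul_def, MulOpposite.unop_one, mul_one, mul_one]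

theorem barAug_surjective : Function.Surjective (barAug k A) := fun x =>
  ⟨_, barAug_leftAct_barWord_nil x⟩

theorem barD_barHomotopy_zero (b : Bar k A 0) :
    barD k A 0 (barHomotopy k A 0 b) +
      rightAct (k := k) (barAug k A b) ((barWord k A 0).1 []) = b := by
  refine eq_self_of_barWord (f := (barD k A 0).restrictScalars k ∘ₗ barHomotopy k A 0 +
      (rightAct (k := k)).flip ((barWord k A 0).1 []) ∘ₗ (barAug k A).restrictScalars k)
    (fun y b => ?_) (fun x l hl => ?_) b
  · have hd : barD k A 0 (rightAct (k := k) y (barHomotopy k A 0 b)) =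
        rightAct (k := k) y (barD k A 0 (barHomotopy k A 0 b)) := (barD k A 0).map_smul _ _
    have ha : barAug k A (rightAct (k := k) y b) = barAug k A b * y :=
      ((barAug k A).map_smul _ _).trans (LinearMap.congr_fun₂ rightAct_self y (barAug k A b))
    have split : rightAct (k := k) (barAug k A b * y) ((barWord k A 0).1 []) =
        rightAct (k := k) y (rightAct (k := k) (barAug k A b) ((barWord k A 0).1 [])) :=
      LinearMap.congr_fun (rightAct_mul (k := k) (M := Bar k A 0) (barAug k A b) y) _
    change barD k A 0 (barHomotopy k A 0 (rightAct (k := k) y b)) +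
        rightAct (k := k) (barAug k A (rightAct (k := k) y b)) ((barWord k A 0).1 []) =
      rightAct (k := k) y (barD k A 0 (barHomotopy k A 0 b) +
        rightAct (k := k) (barAug k A b) ((barWord k A 0).1 []))
    rw [barHomotopy_rightAct, hd, ha, split, map_add]
  · obtain rfl := List.length_eq_zero_iff.mp hl
    change barD k A 0 (barHomotopy k A 0 (leftAct (k := k) x ((barWord k A 0).1 []))) +
      rightAct (k := k) (barAug k A (leftAct (k := k) x ((barWord k A 0).1 [])))
        ((barWord k A 0).1 []) = _
    rw [barHomotopy_leftAct_barWord, barD_barWord_cons, barAug_leftAct_barWord_nil, contract,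
      sub_add_cancel]

theorem exact_barAug : Function.Exact (barD k A 0) (barAug k A) := fun b => by
  refine ⟨fun hb => ⟨barHomotopy k A 0 b, ?_⟩, ?_⟩
  · have h := barD_barHomotopy_zero b
    rwa [hb, map_zero, LinearMap.zero_apply, add_zero] at h
  · rintro ⟨b, rfl⟩
    exact LinearMap.congr_fun barAug_barD b

end BarExact

section Truncation

variable {k : Type*} [CommRing k] {A M M' : Type*} [Ring A] [Algebra k A]
  [AddCommGroup M] [Module k M] [AddCommGroup M'] [Module k M']

/-- The function that agrees with `f` on the words of length `n` and vanishes on all others. -/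
def truncate (n : ℕ) (f : letterLinear k A M) : letterLinear k A M where
  val l := if l.length = n then f.1 l else 0
  property u w := by
    have length (x : A) : (u ++ x :: w).length = u.length + w.length + 1 := by simp; omega
    simp only [length]
    split_ifs
    · exact f.2 u w
    · exact (0 : A →ₗ[k] M).isLinear

theorem concentratedIn_truncate (n : ℕ) (f : letterLinear k A M) :
    ConcentratedIn n (truncate n f).1 := fun _ hl => if_neg hl

theorem letterMap_truncate (φ : M →ₗ[k] M') (n : ℕ) (f : letterLinear k A M) :
    letterMap φ (truncate n f) = truncate n (letterMap φ f) :=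
  Subtype.ext (funext fun _ => (apply_ite φ _ _ _).trans (congrArg _ φ.map_zero))

theorem letterD_truncate (L R : A →ₗ[k] Module.End k M) (n : ℕ) (f : letterLinear k A M) :
    letterD L R (truncate n f) = truncate (n + 1) (letterD L R f) := by
  refine Subtype.ext (funext fun l => ?_)
  by_cases hl : l.length = n + 1
  · have diff : wordD (L ·) (R ·) (truncate n f - f).1 l = 0 :=
      wordD_eq_zero _ _ (fun v hv => sub_eq_zero.2 (if_pos hv)) hl
    have split := congrFun (congrArg Subtype.val (map_sub (letterD L R) (truncate n f) f)) l
    exact (sub_eq_zero.1 (split.symm.trans diff)).trans (if_pos hl).symm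
  · exact ((concentratedIn_truncate n f).wordD _ _ l hl).trans (if_neg hl).symm

end Truncation

section BarLift

variable {k : Type u} [Field k] {A : Type v} [Ring A] [HopfAlgebra k A]
  (P : ProjRes.{u, v, w} k A)

instance (n : ℕ) : Module k (P.X n) := Module.compHom _ (algebraMap k A)

instance (n : ℕ) : IsScalarTower k A (P.X n) where
  smul_assoc r a x := by
    rw [Algebra.smul_def, mul_smul]
    rfl

theorem moduleD_letterMap {N : Type w} [AddCommGroup N] [Module k N] [Module A N]
    [IsScalarTower k A N] {N' : Type x} [AddCommGroup N'] [Module k N'] [Module A N']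
    [IsScalarTower k A N'] (φ : N →ₗ[A] N') (c : letterLinear k A N) :
    moduleD (letterMap (φ.restrictScalars k) c) = letterMap (φ.restrictScalars k) (moduleD c) :=
  letterD_letterMap (fun a => LinearMap.ext fun n => φ.map_smul a n)
    (fun _ => LinearMap.ext fun n => (φ.restrictScalars k).map_smul _ n) c

theorem moduleD_moduleD {N : Type w} [AddCommGroup N] [Module k N] [Module A N]
    [IsScalarTower k A N] (c : letterLinear k A N) : moduleD (moduleD c) = 0 := by
  refine Subtype.ext (wordD_wordD (fun x y => ?_) (fun x y => ?_) (fun x y => ?_) c.1)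
  · exact map_mul (Algebra.lsmul k k N : A →ₐ[k] Module.End k N) x y
  · refine (congrArg (algebraMap k (Module.End k N)) ?_).trans (map_mul _ _ _)
    rw [Bialgebra.counit_mul, mul_comm]
  · exact LinearMap.ext fun n => smul_comm x (Coalgebra.counit (R := k) y) n

/-- A `k`-linear chain map to `P` from the bar resolution of the `A`-module `k` that lifts the
identity. The component in degree `n` is given by its values at the elements `1 ⊗ l` for words `l`
of length `n`. -/
structure BarLift (P : ProjRes.{u, v, w} k A) where
  word : ∀ n, letterLinear k A (P.X n)
  concentrated : ∀ n, ConcentratedIn n (word n).1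
  comm : ∀ n, letterMap ((P.d n).restrictScalars k) (word (n + 1)) = moduleD (word n)
  aug : P.aug ((word 0).1 []) = (1 : k)

theorem moduleD_eq_zero_of_concentratedIn_zero {c : letterLinear k A (Triv k A)}
    (hc : ConcentratedIn 0 c.1) : moduleD c = 0 := by
  refine Subtype.ext (funext fun l => ?_)
  match l with
  | [a] => exact sub_self (Coalgebra.counit (R := k) a * (show k from c.1 []))
  | [] => rfl
  | a :: b :: l => exact hc.wordD _ _ (a :: b :: l) (by simp)

theorem BarLift.nonempty : Nonempty (BarLift P) := by
  obtain ⟨x, hx⟩ := P.aug_surjective (1 : k)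
  let c₀ : letterLinear k A (P.X 0) :=
    ofCochain (MultilinearMap.constOfIsEmpty k (fun _ : Fin 0 => A) x)
  have start : ∃ y, letterMap ((P.d 0).restrictScalars k) y = moduleD c₀ := by
    refine exists_letterMap_eq (g := P.aug.restrictScalars k) P.exact_aug ?_
    rw [← moduleD_letterMap]
    refine moduleD_eq_zero_of_concentratedIn_zero fun l hl => ?_
    exact (congrArg P.aug (concentratedIn_ofCochain _ l hl)).trans (map_zero P.aug)
  obtain ⟨c, hc₀, hc⟩ := exists_chain_lift (D := fun _ j => letterLinear k A (P.X j))
    (d := fun _ j => (letterMap ((P.d j).restrictScalars k)).toAddMonoidHom)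
    (δ := fun _ _ => moduleD.toAddMonoidHom)
    (fun _ j c => (moduleD_letterMap (P.d j) c).symm) (fun _ _ => moduleD_moduleD)
    (fun _ j c => exists_letterMap_eq (P.exact_d j)) c₀ start
  refine ⟨fun n => truncate n (c n), fun n => concentratedIn_truncate n _, fun n => ?_, ?_⟩
  · rw [letterMap_truncate, moduleD, letterD_truncate]
    exact congrArg _ (hc n)
  · rw [hc₀]
    exact hx

end BarLift

section Classes

variable {C : ℕ → Type w} [∀ n, AddCommGroup (C n)] {δ : ∀ n, C n →+ C (n + 1)}

theorem map_mem_coboundaries {C' : ℕ → Type x} [∀ n, AddCommGroup (C' n)]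
    {δ' : ∀ n, C' n →+ C' (n + 1)} (φ : ∀ n, C n →+ C' n)
    (hφ : ∀ n c, δ' n (φ n c) = φ (n + 1) (δ n c)) {n : ℕ} {c : C n}
    (hc : c ∈ coboundaries δ n) : φ n c ∈ coboundaries δ' n := by
  rcases n with - | n
  · rw [show c = 0 from hc, map_zero]
    exact zero_mem _
  · obtain ⟨b, rfl⟩ := hc
    exact ⟨φ n b, hφ n b⟩

theorem cohClass_eq_cohClass_iff {n : ℕ} (c c' : cocycles δ n) :
    cohClass δ c = cohClass δ c' ↔ c.1 - c'.1 ∈ coboundaries δ n := by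
  refine QuotientAddGroup.eq.trans ?_
  rw [AddSubgroup.mem_addSubgroupOf, ← neg_mem_iff, AddSubgroup.coe_add, AddSubgroup.coe_neg,
    neg_add, neg_neg, sub_eq_add_neg]

theorem cohClass_eq_zero_iff {n : ℕ} (c : cocycles δ n) :
    cohClass δ c = 0 ↔ c.1 ∈ coboundaries δ n :=
  (QuotientAddGroup.eq_zero_iff c).trans AddSubgroup.mem_addSubgroupOf

theorem cohClass_surjective {n : ℕ} : Function.Surjective (cohClass δ (n := n)) :=
  QuotientAddGroup.mk'_surjective _

end Classes

section BarExtension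

variable {k : Type u} [Field k] {A : Type v} [Ring A] [Algebra k A]
  {M : Type w} [AddCommGroup M] [Module k M] [Module (Env k A) M] [IsScalarTower k (Env k A) M]
  {M' : Type x} [AddCommGroup M'] [Module k M'] [Module (Env k A) M']
  [IsScalarTower k (Env k A) M']

theorem letterD_letterMap_bimodule (f : M →ₗ[Env k A] M') (c : letterLinear k A M) :
    letterD leftAct rightAct (letterMap (f.restrictScalars k) c) =
      letterMap (f.restrictScalars k) (letterD leftAct rightAct c) :=
  letterD_letterMap (fun _ => LinearMap.ext fun _ => f.map_smul _ _)
    (fun _ => LinearMap.ext fun _ => f.map_smul _ _) c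

theorem bimodule_bar_ext {n : ℕ} {f g : Bar k A n →ₗ[Env k A] M}
    (h : letterMap (f.restrictScalars k) (barWord k A n) =
      letterMap (g.restrictScalars k) (barWord k A n)) : f = g := by
  refine LinearMap.restrictScalars_injective k (linearMap_bar_ext fun x y l _ => ?_)
  have hl : f ((barWord k A n).1 l) = g ((barWord k A n).1 l) :=
    congrFun (congrArg Subtype.val h) l
  have action (f : Bar k A n →ₗ[Env k A] M) :
      f (leftAct (k := k) x (rightAct (k := k) y ((barWord k A n).1 l))) =
        leftAct (k := k) x (rightAct (k := k) y (f ((barWord k A n).1 l))) :=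
    (f.map_smul _ _).trans (congrArg _ (f.map_smul _ _))
  refine (action f).trans (.trans ?_ (action g).symm)
  rw [hl]

theorem letterMap_barExtend_toCochain {n : ℕ} {c : letterLinear k A M} (hc : ConcentratedIn n c.1) :
    letterMap ((barExtend (toCochain n c)).restrictScalars k) (barWord k A n) = c :=
  (letterMap_barExtend _).trans (ofCochain_toCochain hc)

theorem comp_barExtend_toCochain (f : M →ₗ[Env k A] M') {n : ℕ} {c : letterLinear k A M}
    (hc : ConcentratedIn n c.1) :
    f ∘ₗ barExtend (toCochain n c) =
      barExtend (toCochain n (letterMap (f.restrictScalars k) c)) := by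
  apply bimodule_bar_ext
  rw [letterMap_barExtend_toCochain fun l hl => (congrArg f (hc l hl)).trans (map_zero f)]
  exact congrArg (letterMap (f.restrictScalars k)) (letterMap_barExtend_toCochain hc)

theorem barExtend_toCochain_comp_barD {n : ℕ} (c : letterLinear k A M) :
    barExtend (toCochain n c) ∘ₗ barD k A n =
      barExtend (toCochain (n + 1) (letterD leftAct rightAct c)) := by
  rw [barExtend_barD, hochschildD_toCochain]

end BarExtension

section UnitLift

variable {k : Type u} [Field k] {A : Type v} [Ring A] [HopfAlgebra k A]
  {P : ProjRes.{u, v, w} k A}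

theorem ProjRes.exists_comp_eq {M : Type*} {M' : Type*} {M'' : Type*} [AddCommGroup M] [Module A M]
    [AddCommGroup M'] [Module A M'] [AddCommGroup M''] [Module A M''] (P : ProjRes.{u, v, w} k A)
    {n : ℕ} {f : M →ₗ[A] M'} {g : M' →ₗ[A] M''} (exact : Function.Exact f g)
    {φ : P.X n →ₗ[A] M'} (hφ : g ∘ₗ φ = 0) : ∃ ψ, f ∘ₗ ψ = φ := by
  have := P.projective n
  have mem (x) : φ x ∈ LinearMap.range f := (exact _).1 (LinearMap.congr_fun hφ x)
  obtain ⟨ψ, hψ⟩ := Module.projective_lifting_property f.rangeRestrict (φ.codRestrict _ mem)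
    f.surjective_rangeRestrict
  exact ⟨ψ, LinearMap.ext fun x => congrArg Subtype.val (LinearMap.congr_fun hψ x)⟩

theorem ProjRes.d_comp_d (P : ProjRes.{u, v, w} k A) (n : ℕ) : P.d n ∘ₗ P.d (n + 1) = 0 :=
  LinearMap.ext (P.exact_d n).apply_apply_eq_zero

theorem ProjRes.aug_comp_d (P : ProjRes.{u, v, w} k A) : P.aug ∘ₗ P.d 0 = 0 :=
  LinearMap.ext P.exact_aug.apply_apply_eq_zero

section Comparison

variable {M : ℕ → Type x} [∀ j, AddCommGroup (M j)] [∀ j, Module A (M j)]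
  {d : ∀ j, M (j + 1) →ₗ[A] M j}

theorem ProjRes.exists_lift (exact : ∀ j, Function.Exact (d (j + 1)) (d j))
    (φ₀ : P.X 0 →ₗ[A] M 0) (hφ₀ : ∃ ψ, d 0 ∘ₗ ψ = φ₀ ∘ₗ P.d 0) :
    ∃ φ : ∀ j, P.X j →ₗ[A] M j, φ 0 = φ₀ ∧ ∀ j, d j ∘ₗ φ (j + 1) = φ j ∘ₗ P.d j :=
  exists_chain_lift (D := fun i j => P.X i →ₗ[A] M j)
    (d := fun _ j => (LinearMap.compRight ℤ (d j)).toAddMonoidHom)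
    (δ := fun i j => homD P (M j) i) (fun _ _ _ => rfl)
    (fun i _ φ => (LinearMap.comp_assoc _ _ _).trans
      ((congrArg (φ ∘ₗ ·) (P.d_comp_d i)).trans φ.comp_zero))
    (fun _ j _ hφ => P.exists_comp_eq (exact j) hφ) φ₀ hφ₀

theorem ProjRes.exists_sub_mem_coboundaries (exact : ∀ j, Function.Exact (d (j + 1)) (d j))
    {φ : ∀ j, P.X j →ₗ[A] M j} (hφ : ∀ j, d j ∘ₗ φ (j + 1) = φ j ∘ₗ P.d j)
    (hφ₀ : ∃ ψ, d 0 ∘ₗ ψ = φ 0) (n : ℕ) :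
    ∃ ψ, φ n - d n ∘ₗ ψ ∈ coboundaries (homD P (M n)) n :=
  HopfGerstenhaber.exists_sub_mem_coboundaries (D := fun i j => P.X i →ₗ[A] M j)
    (d := fun _ j => (LinearMap.compRight ℤ (d j)).toAddMonoidHom)
    (δ := fun i j => homD P (M j) i) (fun _ _ _ => rfl)
    (fun i _ φ => (LinearMap.comp_assoc _ _ _).trans
      ((congrArg (φ ∘ₗ ·) (P.d_comp_d i)).trans φ.comp_zero))
    (fun _ j _ hφ => P.exists_comp_eq (exact j) hφ) hφ hφ₀ n

end Comparison

theorem UnitLift.nonempty : Nonempty (UnitLift P) := by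
  have := P.projective 0
  let barAugAd : Ad k A (Bar k A 0) →ₗ[A] Ad k A A := adMap (barAug k A)
  let barDAd (n) : Ad k A (Bar k A (n + 1)) →ₗ[A] Ad k A (Bar k A n) := adMap (barD k A n)
  have surjective : Function.Surjective barAugAd := fun a => barAug_surjective (k := k) (A := A) a
  have exact_aug : Function.Exact (barDAd 0) barAugAd := fun x => exact_barAug (k := k) (A := A) x
  have exact_d (n) : Function.Exact (barDAd (n + 1)) (barDAd n) := fun x =>
    exact_barD (k := k) (A := A) n x
  obtain ⟨φ₀, hφ₀⟩ :=
    Module.projective_lifting_property barAugAd (unitMap k A ∘ₗ P.aug) surjective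
  have start : ∃ ψ, barDAd 0 ∘ₗ ψ = φ₀ ∘ₗ P.d 0 := by
    refine P.exists_comp_eq exact_aug ?_
    rw [← LinearMap.comp_assoc, hφ₀, LinearMap.comp_assoc, P.aug_comp_d, LinearMap.comp_zero]
  obtain ⟨φ, rfl, hφ⟩ := P.exists_lift (M := fun n => Ad k A (Bar k A n)) exact_d φ₀ start
  exact ⟨⟨φ, hφ, hφ₀⟩⟩

end UnitLift

theorem letterLinear_ext_nil {k : Type*} [CommRing k] {A M : Type*} [Ring A] [Algebra k A]
    [AddCommGroup M] [Module k M] {c c' : letterLinear k A M} (hc : ConcentratedIn 0 c.1)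
    (hc' : ConcentratedIn 0 c'.1) (h : c.1 [] = c'.1 []) : c = c' :=
  Subtype.ext <| funext fun
    | [] => h
    | a :: l => (hc (a :: l) (Nat.succ_ne_zero _)).trans (hc' (a :: l) (Nat.succ_ne_zero _)).symm

section Pullback

variable {k : Type u} [Field k] {A : Type v} [Ring A] [HopfAlgebra k A]

theorem indLift_comp_indMap {N : Type w} [AddCommGroup N] [Module k N] [Module A N]
    [IsScalarTower k A N] {N' : Type y} [AddCommGroup N'] [Module k N'] [Module A N']
    [IsScalarTower k A N'] {M : Type x} [AddCommGroup M] [Module k M] [Module (Env k A) M]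
    [IsScalarTower k (Env k A) M] (φ : N' →ₗ[A] Ad k A M) (ψ : N →ₗ[A] N') :
    indLift φ ∘ₗ indMap ψ = indLift (φ ∘ₗ ψ) := by
  refine (indLift_comp (indLift φ) (indUnit k A N' ∘ₗ ψ)).symm.trans (congrArg indLift ?_)
  exact LinearMap.ext fun n => indLift_indUnit φ (ψ n)

theorem indLift_add {N : Type w} [AddCommGroup N] [Module k N] [Module A N]
    [IsScalarTower k A N] {M : Type x} [AddCommGroup M] [Module k M] [Module (Env k A) M]
    [IsScalarTower k (Env k A) M] (φ ψ : N →ₗ[A] Ad k A M) :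
    (indLift (φ + ψ)).restrictScalars k =
      (indLift φ).restrictScalars k + (indLift ψ).restrictScalars k :=
  TensorProduct.ext' (M := N) (N := A) fun n b =>
    map_add (rightAct (k := k) (M := M) b) (show M from φ n) (show M from ψ n)

variable {P : ProjRes.{u, v, w} k A} (C : BarLift P)

/-- The chain map of bimodules from the bar resolution to the induced resolution `Ind k A (P.X n)`,
given by its values at the elements `1 ⊗ l ⊗ 1`. -/
def BarLift.ind (n : ℕ) : letterLinear k A (Ind k A (P.X n)) := indWord (C.word n)

theorem BarLift.concentratedIn_ind (n : ℕ) : ConcentratedIn n (C.ind n).1 :=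
  concentratedIn_indWord (C.concentrated n)

theorem BarLift.ind_zero_nil : (C.ind 0).1 [] = ((C.word 0).1 [] ⊗ₜ[k] (1 : A) : P.X 0 ⊗[k] A) :=
  rfl

theorem BarLift.letterMap_ind [Coalgebra.IsCocomm k A] (n : ℕ) :
    letterMap ((indMap (k := k) (P.d n)).restrictScalars k) (C.ind (n + 1)) =
      letterD leftAct rightAct (C.ind n) := by
  refine (letterMap_indWord (P.d n) _).trans ?_
  rw [C.comm, ← letterD_indWord]
  rfl

variable {M : Type x} [AddCommGroup M] [Module k M] [Module (Env k A) M]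
  [IsScalarTower k (Env k A) M]

/-- The Hochschild cochain that corresponds to `φ` under the Eckmann-Shapiro isomorphism: the
composite of the bimodule map that corresponds to `φ` with `C.ind n`. -/
def BarLift.pull (n : ℕ) : (P.X n →ₗ[A] Ad k A M) →+ letterLinear k A M :=
  AddMonoidHom.mk' (fun φ => letterMap ((indLift φ).restrictScalars k) (C.ind n)) fun φ ψ => by
    rw [indLift_add]
    rfl

theorem BarLift.pull_eq_letterMap {n : ℕ} (φ : P.X n →ₗ[A] Ad k A M) :
    C.pull n φ = letterMap ((indLift φ).restrictScalars k) (C.ind n) := rfl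

theorem BarLift.concentratedIn_pull {n : ℕ} (φ : P.X n →ₗ[A] Ad k A M) :
    ConcentratedIn n (C.pull n φ).1 := fun l hl =>
  (congrArg (indLift φ) (C.concentratedIn_ind n l hl)).trans (map_zero _)

theorem BarLift.letterMap_pull {M' : Type y} [AddCommGroup M'] [Module k M'] [Module (Env k A) M']
    [IsScalarTower k (Env k A) M'] (f : M →ₗ[Env k A] M') {n : ℕ} (φ : P.X n →ₗ[A] Ad k A M) :
    letterMap (f.restrictScalars k) (C.pull n φ) = C.pull n (adMap f ∘ₗ φ) := by
  rw [C.pull_eq_letterMap (adMap f ∘ₗ φ), indLift_comp]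
  rfl

theorem BarLift.letterD_pull [Coalgebra.IsCocomm k A] {n : ℕ} (φ : P.X n →ₗ[A] Ad k A M) :
    letterD leftAct rightAct (C.pull n φ) = C.pull (n + 1) (φ ∘ₗ P.d n) := by
  rw [pull_eq_letterMap, letterD_letterMap_bimodule, ← C.letterMap_ind, pull_eq_letterMap,
    ← indLift_comp_indMap]
  rfl

theorem leftAct_one_apply (b : M) : leftAct (k := k) (1 : A) b = b :=
  one_smul (Env k A) b

theorem BarLift.pull_aug :
    C.pull 0 (unitMap k A ∘ₗ P.aug) =
      letterMap ((barAug k A).restrictScalars k) (barWord k A 0) := by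
  refine letterLinear_ext_nil (C.concentratedIn_pull _) (fun l hl => ?_) ?_
  · exact (congrArg _ (concentratedIn_ofCochain _ l hl)).trans (map_zero _)
  · refine (indLift_unitMap_tmul P.aug _ 1).trans ?_
    refine (congrArg (fun r : k => r • (1 : A)) C.aug).trans ((one_smul k _).trans ?_)
    refine (barAug_leftAct_barWord_nil (k := k) (1 : A)).symm.trans ?_
    exact congrArg (barAug k A) (leftAct_one_apply (k := k) (A := A) (M := Bar k A 0) _)

theorem letterD_letterD_bimodule (c : letterLinear k A M) :
    letterD leftAct rightAct (letterD leftAct rightAct c) = 0 :=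
  Subtype.ext (wordD_wordD leftAct_mul rightAct_mul leftAct_mul_rightAct c.1)

/-- A chain map from the bar resolution to the exact complex `B` that starts with a boundary is
null-homotopic, so its composites with cocycles on `B` are coboundaries. -/
theorem toCochain_letterMap_mem_coboundaries {B : ℕ → Type y} [∀ j, AddCommGroup (B j)]
    [∀ j, Module k (B j)] [∀ j, Module (Env k A) (B j)] [∀ j, IsScalarTower k (Env k A) (B j)]
    {d : ∀ j, B (j + 1) →ₗ[Env k A] B j} (exact : ∀ j, Function.Exact (d (j + 1)) (d j))
    {c : ∀ j, letterLinear k A (B j)}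
    (hc : ∀ j, letterMap ((d j).restrictScalars k) (c (j + 1)) = letterD leftAct rightAct (c j))
    (hc₀ : ∃ y, letterMap ((d 0).restrictScalars k) y = c 0) {n N : ℕ} (hN : n ≤ N)
    {f : B n →ₗ[Env k A] M} (hf : f ∘ₗ d n = 0) :
    toCochain N (letterMap (f.restrictScalars k) (c n)) ∈ coboundaries (hochschildD k A M) N := by
  obtain ⟨y, hy⟩ := exists_sub_mem_coboundaries (D := fun _ j => letterLinear k A (B j))
    (d := fun _ j => (letterMap ((d j).restrictScalars k)).toAddMonoidHom)
    (δ := fun _ _ => (letterD leftAct rightAct).toAddMonoidHom)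
    (fun _ j c => (letterD_letterMap_bimodule (d j) c).symm)
    (fun _ _ => letterD_letterD_bimodule) (fun _ j c => exists_letterMap_eq (exact j)) hc hc₀ n
  have kill : letterMap (f.restrictScalars k) (letterMap ((d n).restrictScalars k) y) = 0 :=
    Subtype.ext (funext fun l => LinearMap.congr_fun hf (y.1 l))
  have image := map_mem_coboundaries (δ' := fun _ => (letterD leftAct rightAct).toAddMonoidHom)
    (fun _ => (letterMap (f.restrictScalars k)).toAddMonoidHom)
    (fun _ c => letterD_letterMap_bimodule f c) hy
  change letterMap (f.restrictScalars k) (c n - letterMap ((d n).restrictScalars k) y) ∈ _ at image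
  rw [map_sub, kill, sub_zero] at image
  refine toCochain_mem_coboundaries ?_
  rcases n with - | n
  · rw [show letterMap (f.restrictScalars k) (c 0) = 0 from image]
    exact zero_mem _
  · obtain ⟨N, rfl⟩ := Nat.exists_eq_add_one.2 (n.succ_pos.trans_le hN)
    exact image

theorem BarLift.toCochain_pull_sub_letterMap_mem_coboundaries [Coalgebra.IsCocomm k A]
    {B : ℕ → Type y} [∀ j, AddCommGroup (B j)] [∀ j, Module k (B j)] [∀ j, Module (Env k A) (B j)]
    [∀ j, IsScalarTower k (Env k A) (B j)] {d : ∀ j, B (j + 1) →ₗ[Env k A] B j}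
    (exact : ∀ j, Function.Exact (d (j + 1)) (d j)) {Q : Type z} [AddCommGroup Q] [Module k Q]
    [Module (Env k A) Q] [IsScalarTower k (Env k A) Q] {ε : B 0 →ₗ[Env k A] Q}
    (exact₀ : Function.Exact (d 0) ε) {φ : ∀ j, P.X j →ₗ[A] Ad k A (B j)}
    (hφ : ∀ j, adMap (d j) ∘ₗ φ (j + 1) = φ j ∘ₗ P.d j) {c : ∀ j, letterLinear k A (B j)}
    (hc : ∀ j, letterMap ((d j).restrictScalars k) (c (j + 1)) = letterD leftAct rightAct (c j))
    (h₀ : C.pull 0 (adMap ε ∘ₗ φ 0) = letterMap (ε.restrictScalars k) (c 0)) {n : ℕ}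
    {f : B n →ₗ[Env k A] M} (hf : f ∘ₗ d n = 0) :
    toCochain n (C.pull n (adMap f ∘ₗ φ n)) - toCochain n (letterMap (f.restrictScalars k) (c n)) ∈
      coboundaries (hochschildD k A M) n := by
  rw [← C.letterMap_pull, ← map_sub, ← map_sub]
  refine toCochain_letterMap_mem_coboundaries exact (c := fun j => C.pull j (φ j) - c j)
    (fun j => ?_) (exists_letterMap_eq (g := ε.restrictScalars k) exact₀ ?_)
    le_rfl hf
  · rw [map_sub, map_sub, hc, C.letterMap_pull, C.letterD_pull, hφ]
  · rw [map_sub, C.letterMap_pull, h₀, sub_self]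

theorem BarLift.toCochain_pull_sub_mem_coboundaries [Coalgebra.IsCocomm k A] (L : UnitLift P)
    {n : ℕ} {f : Cochain k A A n} (hf : hochschildD k A A n f = 0) :
    toCochain n (C.pull n (adMap (barExtend f) ∘ₗ L.hom n)) - f ∈
      coboundaries (hochschildD k A A) n := by
  have kill : barExtend f ∘ₗ barD k A n = 0 := by
    rw [barExtend_barD, hf, barExtend_zero]
  have main := @BarLift.toCochain_pull_sub_letterMap_mem_coboundaries k _ A _ _ P C A _ _ _ _ _
    (fun j => Bar k A j) _ _ _ (fun _ => inferInstance) _ exact_barD A _ _ _ _ _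
    exact_barAug L.hom L.comm (barWord k A) letterMap_barD
    ((congrArg _ L.comm_aug).trans C.pull_aug) n _ kill
  rwa [letterMap_barExtend, toCochain_ofCochain] at main

theorem BarLift.sub_toCochain_pull_mem_coboundaries [Coalgebra.IsCocomm k A] (L : UnitLift P)
    {n : ℕ} {f : Cochain k A A n} (hf : hochschildD k A A n f = 0)
    {φ : P.X n →ₗ[A] Ad k A A}
    (h : adMap (barExtend f) ∘ₗ L.hom n - φ ∈ coboundaries (homD P (Ad k A A)) n) :
    f - toCochain n (C.pull n φ) ∈ coboundaries (hochschildD k A A) n := by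
  have image := toCochain_mem_coboundaries <|
    map_mem_coboundaries (δ' := fun _ => (letterD leftAct rightAct).toAddMonoidHom) C.pull
      (fun _ φ => C.letterD_pull φ) h
  rw [map_sub, map_sub] at image
  have main := sub_mem image (C.toCochain_pull_sub_mem_coboundaries L hf)
  rwa [sub_sub_sub_cancel_left] at main

end Pullback

section InducedResolution

variable {k : Type u} [Field k] {A : Type v} [Ring A] [HopfAlgebra k A]

theorem exact_indMap {N : Type w} [AddCommGroup N] [Module k N] [Module A N] [IsScalarTower k A N]
    {N' : Type x} [AddCommGroup N'] [Module k N'] [Module A N'] [IsScalarTower k A N']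
    {N'' : Type y} [AddCommGroup N''] [Module k N''] [Module A N''] [IsScalarTower k A N'']
    {f : N →ₗ[A] N'} {g : N' →ₗ[A] N''} (exact : Function.Exact f g) :
    Function.Exact (indMap (k := k) f) (indMap (k := k) g) := by
  have hf : ⇑(indMap (k := k) f) = (f.restrictScalars k).rTensor A :=
    congrArg DFunLike.coe (indMap_eq_rTensor f)
  have hg : ⇑(indMap (k := k) g) = (g.restrictScalars k).rTensor A :=
    congrArg DFunLike.coe (indMap_eq_rTensor g)
  rw [hf, hg]
  exact Module.Flat.rTensor_exact A (f := f.restrictScalars k) (g := g.restrictScalars k) exact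

theorem indLift_comp_indMap_eq_zero {N : Type w} [AddCommGroup N] [Module k N] [Module A N]
    [IsScalarTower k A N] {N' : Type y} [AddCommGroup N'] [Module k N'] [Module A N']
    [IsScalarTower k A N'] {M : Type x} [AddCommGroup M] [Module k M] [Module (Env k A) M]
    [IsScalarTower k (Env k A) M] {φ : N' →ₗ[A] Ad k A M} {ψ : N →ₗ[A] N'} (h : φ ∘ₗ ψ = 0) :
    indLift φ ∘ₗ indMap ψ = 0 := by
  rw [indLift_comp_indMap, h]
  refine LinearMap.restrictScalars_injective k ?_
  exact TensorProduct.ext' (M := N) (N := A) fun _ b => map_zero (rightAct (k := k) (M := M) b)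

variable (P : ProjRes.{u, v, w} k A)

theorem ProjRes.exact_indLift_aug :
    Function.Exact (indMap (k := k) (P.d 0)) (indLift (M := A) (unitMap k A ∘ₗ P.aug)) := by
  let aug : P.X 0 →ₗ[k] k := P.aug.restrictScalars k
  have hd : ⇑(indMap (k := k) (P.d 0)) = ((P.d 0).restrictScalars k).rTensor A :=
    congrArg DFunLike.coe (indMap_eq_rTensor (P.d 0))
  have haug : ⇑(indLift (M := A) (unitMap k A ∘ₗ P.aug)) =
      TensorProduct.lid k A ∘ aug.rTensor A :=
    congrArg DFunLike.coe (TensorProduct.ext' (M := P.X 0) (N := A)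
      (g := (indLift (M := A) (unitMap k A ∘ₗ P.aug)).restrictScalars k)
      (h := (TensorProduct.lid k A).toLinearMap ∘ₗ aug.rTensor A)
      (indLift_unitMap_tmul P.aug))
  rw [hd, haug]
  exact (Module.Flat.rTensor_exact A (f := (P.d 0).restrictScalars k) (g := aug)
    P.exact_aug).comp_injective _ (TensorProduct.lid k A).injective (map_zero _)

variable {P} (C : BarLift P)

theorem BarLift.barExtend_pull_aug :
    barExtend (toCochain 0 (C.pull 0 (unitMap k A ∘ₗ P.aug))) = barAug k A := by
  refine bimodule_bar_ext ((letterMap_barExtend_toCochain (C.concentratedIn_pull _)).trans ?_)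
  exact C.pull_aug

/-- The `A`-linear map `P.X n → P.X n ⊗ A` that lifts the unit of `A` through `L`. -/
def BarLift.resLift (L : UnitLift P) (n : ℕ) : P.X n →ₗ[A] Ad k A (Ind k A (P.X n)) :=
  adMap (barExtend (toCochain n (C.ind n))) ∘ₗ L.hom n

variable {M : Type x} [AddCommGroup M] [Module k M] [Module (Env k A) M]
  [IsScalarTower k (Env k A) M]

theorem BarLift.adMap_indLift_comp_resLift (L : UnitLift P) {n : ℕ} (φ : P.X n →ₗ[A] Ad k A M) :
    adMap (indLift φ) ∘ₗ C.resLift L n =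
      adMap (barExtend (toCochain n (C.pull n φ))) ∘ₗ L.hom n := by
  rw [C.pull_eq_letterMap, ← comp_barExtend_toCochain (indLift φ) (C.concentratedIn_ind n)]
  rfl

theorem adMap_indLift_comp_indUnit {N : Type w} [AddCommGroup N] [Module k N] [Module A N]
    [IsScalarTower k A N] (φ : N →ₗ[A] Ad k A M) : adMap (indLift φ) ∘ₗ indUnit k A N = φ :=
  LinearMap.ext (indLift_indUnit φ)

theorem BarLift.adMap_indMap_comp_resLift [Coalgebra.IsCocomm k A] (L : UnitLift P) (j : ℕ) :
    adMap (indMap (k := k) (P.d j)) ∘ₗ C.resLift L (j + 1) = C.resLift L j ∘ₗ P.d j := by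
  have bar := congrArg (fun f => adMap f ∘ₗ L.hom (j + 1))
    (comp_barExtend_toCochain (indMap (k := k) (P.d j)) (C.concentratedIn_ind (j + 1)))
  rw [C.letterMap_ind, ← barExtend_toCochain_comp_barD] at bar
  exact bar.trans (congrArg (adMap (barExtend (toCochain j (C.ind j))) ∘ₗ ·) (L.comm j))

theorem BarLift.sub_mem_coboundaries [Coalgebra.IsCocomm k A] (L : UnitLift P) {n : ℕ}
    {φ : P.X n →ₗ[A] Ad k A M} (hφ : φ ∘ₗ P.d n = 0) :
    adMap (barExtend (toCochain n (C.pull n φ))) ∘ₗ L.hom n - φ ∈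
      coboundaries (homD P (Ad k A M)) n := by
  let d (j) : Ad k A (Ind k A (P.X (j + 1))) →ₗ[A] Ad k A (Ind k A (P.X j)) :=
    adMap (indMap (k := k) (P.d j))
  let aug : Ad k A (Ind k A (P.X 0)) →ₗ[A] Ad k A A := adMap (indLift (unitMap k A ∘ₗ P.aug))
  have exact (j) : Function.Exact (d (j + 1)) (d j) := exact_indMap (k := k) (P.exact_d j)
  have exact_aug : Function.Exact (d 0) aug := P.exact_indLift_aug
  have comm (j) : d j ∘ₗ (C.resLift L (j + 1) - indUnit k A (P.X (j + 1))) =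
      (C.resLift L j - indUnit k A (P.X j)) ∘ₗ P.d j := by
    rw [LinearMap.comp_sub, LinearMap.sub_comp, ← C.adMap_indMap_comp_resLift]
    exact congrArg _ (adMap_indLift_comp_indUnit _)
  have start : aug ∘ₗ (C.resLift L 0 - indUnit k A (P.X 0)) = 0 := by
    rw [LinearMap.comp_sub, C.adMap_indLift_comp_resLift, adMap_indLift_comp_indUnit,
      C.barExtend_pull_aug, L.comm_aug, sub_self]
  obtain ⟨ψ, hψ⟩ := P.exists_sub_mem_coboundaries (M := fun j => Ad k A (Ind k A (P.X j)))
    (d := d) exact (φ := fun j => C.resLift L j - indUnit k A (P.X j)) comm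
    (P.exists_comp_eq exact_aug start) n
  have kill : adMap (indLift φ) ∘ₗ d n = 0 := LinearMap.ext fun t =>
    LinearMap.congr_fun (indLift_comp_indMap_eq_zero hφ) t
  have image := map_mem_coboundaries (δ' := homD P (Ad k A M))
    (fun j => (LinearMap.compRight ℤ (adMap (indLift φ))).toAddMonoidHom) (fun _ _ => rfl) hψ
  change adMap (indLift φ) ∘ₗ (C.resLift L n - indUnit k A (P.X n) - d n ∘ₗ ψ) ∈ _ at image
  rwa [LinearMap.comp_sub, LinearMap.comp_sub, ← LinearMap.comp_assoc _ (d n), kill,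
    LinearMap.zero_comp, sub_zero, C.adMap_indLift_comp_resLift, adMap_indLift_comp_indUnit]
    at image

end InducedResolution

section Telescope

variable {k A M M' : Type*} [CommRing k] [AddCommGroup M] [Module k M] [AddCommGroup M']
  [Module k M']

theorem cutSum_eq_of_concentratedIn_zero (H : List A → M →ₗ[k] M') {G : List A → M}
    (hG : ConcentratedIn 0 G) (l : List A) : cutSum H G l = H l (G []) := by
  rw [cutSum_eq_ite H hG, if_pos (Nat.zero_le _)]
  rfl

theorem insertSum_one_telescope {F : List A → List A → M →ₗ[k] M'} {c : List A → M}
    (hc : ConcentratedIn 1 c) {E : List A → List A → M'}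
    (hE : ∀ u w x, F u w (c [x]) = E (u ++ [x]) w - E u (x :: w)) (l : List A) :
    insertSum (1 : k) F c l = E l [] - E [] l := by
  have hc_nil : c [] = 0 := hc [] zero_ne_one
  induction l generalizing F E with
  | nil => rw [insertSum, hc_nil, map_zero, sub_self]
  | cons a l ih =>
    have tail : ConcentratedIn 0 fun v => c (a :: v) := fun v hv => hc _ (by simpa using hv)
    have rest := ih (F := fun u => F (a :: u)) (E := fun u => E (a :: u)) fun u => hE (a :: u)
    rw [insertSum, cutSum, hc_nil, map_zero, zero_add, cutSum_eq_of_concentratedIn_zero _ tail,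
      hE [] l a, one_smul, rest, List.nil_append, add_comm, sub_add_sub_cancel]

end Telescope

section DegreeZero

variable {k A M : Type*} [CommRing k] [Ring A] [Algebra k A] [AddCommGroup M] [Module k M]

theorem insertSum_mark_eq {c : letterLinear k A M} (hc : ConcentratedIn 1 c.1) (s : k)
    (g : List A → A) (l : List A) : insertSum s (mark c) g l = c.1 [g l] := by
  have hmark : mark c = fun u w => if u = [] then if w = [] then mark c [] [] else 0 else 0 := by
    funext u w
    rcases u with - | ⟨a, u⟩
    · rcases w with - | ⟨b, w⟩
      · rfl
      · exact LinearMap.ext fun x => hc _ (by simp)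
    · exact LinearMap.ext fun x => hc _ (by simp)
  rw [hmark, insertSum_ite_nil_left, cutSum_ite_nil]
  rfl

theorem wordBracket_letterD_eq_zero {L R : A →ₗ[k] Module.End k M} {c : letterLinear k A M}
    (hc : ConcentratedIn 0 c.1) {F : List A → List A → M →ₗ[k] M} {g : List A → A} {n : ℕ}
    {E : List A → List A → M} (hL : ∀ u w x, F u w (L x (c.1 [])) = E (u ++ [x]) w)
    (hR : ∀ u w x, F u w (R x (c.1 [])) = E u (x :: w)) (hl : ∀ l, E l [] = L (g l) (c.1 []))
    (hr : ∀ l, E [] l = R (g l) (c.1 [])) (l : List A) :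
    wordBracket 1 n F g (letterD L R c) l = 0 := by
  have hδ : ConcentratedIn 1 (letterD L R c).1 := hc.wordD L R
  have letter (x : A) : (letterD L R c).1 [x] = L x (c.1 []) - R x (c.1 []) := rfl
  have square (i : ℕ) : (-1 : k) ^ ((1 + 1) * i) = 1 := by rw [pow_mul]; simp
  have telescope := insertSum_one_telescope (k := k) (F := F) hδ (E := E)
    (fun u w x => by rw [letter, map_sub, hL, hR]) l
  rw [wordBracket, square, one_smul, neg_one_sq, telescope, insertSum_mark_eq hδ, letter, hl, hr,
    sub_self]

theorem map_wordBracket {M' : Type*} [AddCommGroup M'] [Module k M'] (φ : M →ₗ[k] M')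
    {F : List A → List A → M →ₗ[k] M} {F' : List A → List A → M' →ₗ[k] M'}
    (hF : ∀ u w, φ ∘ₗ F u w = F' u w ∘ₗ φ) (m n : ℕ) (g : List A → A) (c : letterLinear k A M)
    (l : List A) : φ (wordBracket m n F g c l) = wordBracket m n F' g (letterMap φ c) l := by
  rw [wordBracket, map_sub, map_smul, map_insertSum, map_insertSum]
  simp only [hF, ← insertSum_comp_left]
  rfl

end DegreeZero

section IndBracket

variable {k : Type u} [Field k] {A : Type v} [Ring A] [HopfAlgebra k A]
  {N : Type w} [AddCommGroup N] [Module k N] [Module A N] [IsScalarTower k A N]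

theorem indMark_leftAct_tmul_one (g : letterLinear k A A) (u w : List A) (x : A) (n : N) :
    indMark N g u w (leftAct (k := k) x (show Ind k A N from n ⊗ₜ[k] (1 : A))) =
      orbitTensor k A n ((twist A g).1 ((u ++ [x]).map (Bialgebra.comulAlgHom k A) ++
        w.map fun x => 1 ⊗ₜ x)) := by
  refine (LinearMap.congr_fun (orbitEnd_comp_mulLeft (fun y b => twist_append_tmul_cons g
    (u.map (Bialgebra.comulAlgHom k A)) y b w) x) (n ⊗ₜ[k] (1 : A))).symm.trans ?_
  rw [List.map_append, List.append_assoc]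
  refine congrArg (fun t => orbitTensor k A n (mark (twist A g) _ _ t)) ?_
  exact mul_one (Coalgebra.comul x)

theorem indMark_rightAct_tmul_one (g : letterLinear k A A) (u w : List A) (x : A) (n : N) :
    indMark N g u w (rightAct (k := k) x (show Ind k A N from n ⊗ₜ[k] (1 : A))) =
      orbitTensor k A n ((twist A g).1 (u.map (Bialgebra.comulAlgHom k A) ++
        (x :: w).map fun x => 1 ⊗ₜ x)) := by
  rw [rightAct_ind]
  refine (indMark_tmul g u w n (1 * x)).trans ?_
  rw [one_mul]
  rfl

theorem wordBracket_indMark_letterD_eq_zero {g : letterLinear k A A}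
    (hΔ : ∀ l, Coalgebra.comul (g.1 l) = (twist A g).1 (l.map (Bialgebra.comulAlgHom k A)))
    {c : letterLinear k A (Ind k A N)} (hc : ConcentratedIn 0 c.1) {e : N}
    (he : c.1 [] = (e ⊗ₜ[k] (1 : A) : N ⊗[k] A)) (n : ℕ) (l : List A) :
    wordBracket 1 n (indMark N g) g.1 (letterD leftAct rightAct c) l = 0 := by
  refine wordBracket_letterD_eq_zero hc (E := fun u w => orbitTensor k A e
    ((twist A g).1 (u.map (Bialgebra.comulAlgHom k A) ++ w.map fun x => 1 ⊗ₜ x)))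
    (fun u w x => ?_) (fun u w x => ?_) (fun l => ?_) (fun l => ?_) l <;> rw [he]
  · exact indMark_leftAct_tmul_one g u w x e
  · exact indMark_rightAct_tmul_one g u w x e
  · rw [List.map_nil, List.append_nil, ← hΔ, leftAct_ind]
    refine (congrArg (orbitTensor k A e) (mul_one (Coalgebra.comul (g.1 l))).symm).trans ?_
    refine (orbitTensor_mul e _ 1).trans (congrArg (tensorLsmul k A N (Coalgebra.comul (g.1 l))) ?_)
    exact congrArg (· ⊗ₜ[k] (1 : A)) (one_smul A e)
  · rw [List.map_nil, List.nil_append, twist_map_one_tmul, orbitTensor_tmul, one_smul, rightAct_ind]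
    exact congrArg (e ⊗ₜ[k] ·) (one_mul (g.1 l)).symm

end IndBracket

section Vanishing

variable {k : Type u} [Field k] {A : Type v} [Ring A] [HopfAlgebra k A]

theorem letterMap_indLift_unitMap_indWord {N : Type w} [AddCommGroup N] [Module k N] [Module A N]
    [IsScalarTower k A N] (p : N →ₗ[A] Triv k A) (c : letterLinear k A N) :
    letterMap ((indLift (unitMap k A ∘ₗ p)).restrictScalars k) (indWord c) =
      cofreeExtension (letterMap (M' := k) (p.restrictScalars k) c) := by
  let p' : N →ₗ[k] k := p.restrictScalars k
  have unit : (indLift (unitMap k A ∘ₗ p)).restrictScalars k ∘ₗ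
      (TensorProduct.comm k A N).toLinearMap =
        (TensorProduct.rid k A).toLinearMap ∘ₗ p'.lTensor A :=
    TensorProduct.ext' fun b n => indLift_unitMap_tmul p n b
  have twisted := congrArg (letterComap (Bialgebra.comulAlgHom k A) ∘ₗ
    letterMap (TensorProduct.rid k A).toLinearMap)
      (twist_letterMap (C := A) p' c)
  refine Eq.trans (Subtype.ext (funext fun l => ?_)) twisted.symm
  exact LinearMap.congr_fun unit ((twist A c).1 (l.map (Bialgebra.comulAlgHom k A)))

variable {P : ProjRes.{u, v, w} k A}

theorem unitMap_comp_comp_d_eq_zero {n : ℕ} {p : P.X n →ₗ[A] Triv k A} (hp : p ∘ₗ P.d n = 0) :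
    (unitMap k A ∘ₗ p) ∘ₗ P.d n = 0 := by
  rw [LinearMap.comp_assoc, hp, LinearMap.comp_zero]

variable (C : BarLift P)

theorem BarLift.comul_pull_unitMap {n : ℕ} (q : P.X n →ₗ[A] Triv k A) (l : List A) :
    Coalgebra.comul ((C.pull n (unitMap k A ∘ₗ q)).1 l) =
      (twist A (C.pull n (unitMap k A ∘ₗ q))).1 (l.map (Bialgebra.comulAlgHom k A)) := by
  rw [pull_eq_letterMap, BarLift.ind, letterMap_indLift_unitMap_indWord]
  exact comul_cofreeExtension _ l

/-- The bracket with `g` of the chain map `C.ind m`. -/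
def BarLift.indBracket (m n : ℕ) (g : letterLinear k A A) : letterLinear k A (Ind k A (P.X m)) :=
  ⟨wordBracket m n (indMark (P.X m) g) g.1 (C.ind m),
    wordBracket_mem (indMark_mem_right g) (indMark_mem_left g) g.2 _⟩

variable [Coalgebra.IsCocomm k A] {n : ℕ} {g : letterLinear k A A}

theorem BarLift.letterMap_indBracket (m : ℕ) :
    letterMap ((indMap (k := k) (P.d m)).restrictScalars k) (C.indBracket (m + 1) n g) =
      ⟨wordBracket (m + 1) n (indMark (P.X m) g) g.1 (letterD leftAct rightAct (C.ind m)),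
        wordBracket_mem (indMark_mem_right g) (indMark_mem_left g) g.2 _⟩ :=
  Subtype.ext <| funext fun l => by
    refine (map_wordBracket _ (indMap_indMark (P.d m) g) (m + 1) n g.1 _ l).trans ?_
    rw [C.letterMap_ind]

theorem BarLift.letterD_indBracket (hg : ConcentratedIn n g.1)
    (hδ : letterD (LinearMap.mul k A) (LinearMap.mul k A).flip g = 0)
    (hΔ : ∀ l, Coalgebra.comul (g.1 l) = (twist A g).1 (l.map (Bialgebra.comulAlgHom k A)))
    (m : ℕ) : letterD leftAct rightAct (C.indBracket m n g) = (-1 : k) ^ (n + 1) •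
      letterMap ((indMap (k := k) (P.d m)).restrictScalars k) (C.indBracket (m + 1) n g) := by
  rw [C.letterMap_indBracket]
  exact Subtype.ext <| funext <| wordD_wordBracket hg (congrArg Subtype.val hδ)
    (markedD_indMark hg hδ hΔ) (C.ind m) (C.concentratedIn_ind m)

theorem BarLift.letterMap_indBracket_one
    (hΔ : ∀ l, Coalgebra.comul (g.1 l) = (twist A g).1 (l.map (Bialgebra.comulAlgHom k A))) :
    letterMap ((indMap (k := k) (P.d 0)).restrictScalars k) (C.indBracket 1 n g) = 0 := by
  rw [C.letterMap_indBracket]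
  exact Subtype.ext <| funext <|
    wordBracket_indMark_letterD_eq_zero hΔ (C.concentratedIn_ind 0) C.ind_zero_nil n

theorem BarLift.letterMap_indBracket_mem_coboundaries (hg : ConcentratedIn n g.1)
    (hδ : letterD (LinearMap.mul k A) (LinearMap.mul k A).flip g = 0)
    (hΔ : ∀ l, Coalgebra.comul (g.1 l) = (twist A g).1 (l.map (Bialgebra.comulAlgHom k A)))
    {M : Type x} [AddCommGroup M] [Module k M] [Module (Env k A) M] [IsScalarTower k (Env k A) M]
    {m N : ℕ} (hm : m ≤ N) {f : Ind k A (P.X (m + 1)) →ₗ[Env k A] M}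
    (hf : f ∘ₗ indMap (k := k) (P.d (m + 1)) = 0) :
    toCochain N (letterMap (f.restrictScalars k) (C.indBracket (m + 1) n g)) ∈
      coboundaries (hochschildD k A M) N := by
  let s : k := (-1) ^ (n + 1)
  have hs (j : ℕ) : s ^ j * s ^ j = 1 := by rw [← mul_pow, ← mul_pow]; simp
  have null := toCochain_letterMap_mem_coboundaries (B := fun j => Ind k A (P.X (j + 1)))
    (d := fun j => indMap (k := k) (P.d (j + 1))) (fun j => exact_indMap (P.exact_d (j + 1)))
    (c := fun j => s ^ j • C.indBracket (j + 1) n g) (fun j => ?_)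
    (exists_letterMap_eq (g := (indMap (k := k) (P.d 0)).restrictScalars k)
      (exact_indMap (P.exact_d 0)) ?_) hm hf
  · have unsign := smul_mem_coboundaries (s ^ m) null
    rwa [map_smul, map_smul, smul_smul, hs, one_smul] at unsign
  · rw [map_smul, map_smul, C.letterD_indBracket hg hδ hΔ, smul_smul, pow_succ]
  · rw [pow_zero, one_smul, C.letterMap_indBracket_one hΔ]

/-- The Hochschild cocycle that represents the image of the class of `p` under the embedding
`H^*(A, k) → HH^*(A)`. -/
def BarLift.embed {n : ℕ} (p : cocycles (homD P (Triv k A)) n) : cocycles (hochschildD k A A) n :=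
  ⟨toCochain n (C.pull n (unitMap k A ∘ₗ p.1)), by
    change hochschildD k A A n _ = 0
    rw [hochschildD_toCochain, C.letterD_pull, unitMap_comp_comp_d_eq_zero p.2, map_zero, map_zero]⟩

theorem BarLift.cochainBracket_embed_mem_coboundaries {m n N : ℕ} (h : N + 1 = m + n) (hm : 0 < m)
    (p : cocycles (homD P (Triv k A)) m) (q : cocycles (homD P (Triv k A)) n) :
    cochainBracket h (C.embed p).1 (C.embed q).1 ∈ coboundaries (hochschildD k A A) N := by
  obtain ⟨m, rfl⟩ := Nat.exists_eq_add_one.2 hm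
  let φ : P.X (m + 1) →ₗ[A] Ad k A A := unitMap k A ∘ₗ p.1
  let g : letterLinear k A A := C.pull n (unitMap k A ∘ₗ q.1)
  have hg : ConcentratedIn n g.1 := C.concentratedIn_pull _
  have hδ : letterD leftAct rightAct g = 0 := by
    rw [C.letterD_pull, unitMap_comp_comp_d_eq_zero q.2, map_zero]
  rw [leftAct_self, rightAct_self] at hδ
  have bracket : cochainBracket h (C.embed p).1 (C.embed q).1 =
      toCochain N (letterMap ((indLift φ).restrictScalars k) (C.indBracket (m + 1) n g)) := by
    ext a
    refine (cochainBracket_toCochain h (C.concentratedIn_pull _) hg a).trans ?_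
    exact (map_wordBracket _ (indLift_unitMap_indMark p.1 g) (m + 1) n g.1 _ _).symm
  rw [bracket]
  exact C.letterMap_indBracket_mem_coboundaries hg hδ (C.comul_pull_unitMap q.1) (by omega)
    (indLift_comp_indMap_eq_zero (unitMap_comp_comp_d_eq_zero p.2))

theorem BarLift.isHochschildImage_cohClass_iff {n : ℕ} (p : cocycles (homD P (Triv k A)) n)
    (x : HH k A n) : IsHochschildImage (cohClass _ p) x ↔ x = cohClass _ (C.embed p) := by
  have image (L : UnitLift P) (f : cocycles (hochschildD k A A) n) :
      shapiro L n (cohClass _ f) = unitCoh P n (cohClass _ p) ↔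
        adMap (barExtend f.1) ∘ₗ L.hom n - unitMap k A ∘ₗ p.1 ∈
          coboundaries (homD P (Ad k A A)) n :=
    cohClass_eq_cohClass_iff _ _
  constructor
  · rintro ⟨L, hL⟩
    obtain ⟨f, rfl⟩ := cohClass_surjective x
    rw [cohClass_eq_cohClass_iff]
    exact C.sub_toCochain_pull_mem_coboundaries L f.2 ((image L f).1 hL)
  · rintro rfl
    obtain ⟨L⟩ := UnitLift.nonempty (P := P)
    exact ⟨L, (image L _).2 (C.sub_mem_coboundaries L (unitMap_comp_comp_d_eq_zero p.2))⟩

end Vanishing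

section HopfBracket

variable {k : Type u} [Field k] {A : Type v} [Ring A] [Algebra k A]

theorem cochainBracket_mem_cocycles {m n N : ℕ} (h : N + 1 = m + n) {f : Cochain k A A m}
    (hf : hochschildD k A A m f = 0) {g : Cochain k A A n} (hg : hochschildD k A A n g = 0) :
    cochainBracket h f g ∈ cocycles (hochschildD k A A) N := by
  have h' : N + 1 + 1 = m + 1 + n := by omega
  have zero := cochainBracket_sub_left h' 0 0 g
  rw [sub_self, sub_self] at zero
  change hochschildD k A A N (cochainBracket h f g) = 0
  rw [hochschildD_cochainBracket h f hg h', hf, zero, smul_zero]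

theorem isGerstenhaberBracket_cohClass_iff {m n N : ℕ} (h : N + 1 = m + n) (hm : 0 < m)
    (hn : 0 < n) (f : cocycles (hochschildD k A A) m) (g : cocycles (hochschildD k A A) n)
    (z : HH k A N) : IsGerstenhaberBracket h (cohClass _ f) (cohClass _ g) z ↔
      z = cohClass _ ⟨cochainBracket h f.1 g.1, cochainBracket_mem_cocycles h f.2 g.2⟩ := by
  constructor
  · rintro ⟨f', g', b, hf, hg, hb, rfl⟩
    rw [cohClass_eq_cohClass_iff] at hf hg ⊢
    rw [hb]
    exact cochainBracket_sub_cochainBracket_mem h hm hn f.2 hf g'.2 hg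
  · rintro rfl
    exact ⟨f, g, _, rfl, rfl, rfl, rfl⟩

end HopfBracket

end HopfGerstenhaber

end

theorem corollary4p2_general {k : Type u} [Field k] {A : Type v} [Ring A] [HopfAlgebra k A]
    [Coalgebra.IsCocomm k A] (P : HopfGerstenhaber.ProjRes.{u, v, w} k A) {m n N : ℕ} (hm : 0 < m)
    (hn : 0 < n) (h : N + 1 = m + n)
    (α : HopfGerstenhaber.HopfCoh P (HopfGerstenhaber.Triv k A) m)
    (β : HopfGerstenhaber.HopfCoh P (HopfGerstenhaber.Triv k A) n)
    (z : HopfGerstenhaber.HH k A N) :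
    HopfGerstenhaber.IsHopfBracket h α β z ↔ z = 0 := by
  obtain ⟨C⟩ := HopfGerstenhaber.BarLift.nonempty (P := P)
  obtain ⟨p, rfl⟩ := HopfGerstenhaber.cohClass_surjective α
  obtain ⟨q, rfl⟩ := HopfGerstenhaber.cohClass_surjective β
  simp only [HopfGerstenhaber.IsHopfBracket, C.isHochschildImage_cohClass_iff, exists_and_left,
    exists_eq_left, HopfGerstenhaber.isGerstenhaberBracket_cohClass_iff h hm hn]
  have vanish := (HopfGerstenhaber.cohClass_eq_zero_iff
    ⟨_, HopfGerstenhaber.cochainBracket_mem_cocycles h (C.embed p).2 (C.embed q).2⟩).2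
      (C.cochainBracket_embed_mem_coboundaries h hm p q)
  rw [vanish]

theorem corollary4p2 {k : Type u} [Field k] (hk : ringChar k ≠ 2)
    {A : Type v} [Ring A] [HopfAlgebra k A] [Coalgebra.IsCocomm k A]
    (P : HopfGerstenhaber.ProjRes.{u, v, w} k A) {m n N : ℕ} (hm : 0 < m) (hn : 0 < n)
    (h : N + 1 = m + n)
    (α : HopfGerstenhaber.HopfCoh P (HopfGerstenhaber.Triv k A) m)
    (β : HopfGerstenhaber.HopfCoh P (HopfGerstenhaber.Triv k A) n)
    (z : HopfGerstenhaber.HH k A N) :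
    HopfGerstenhaber.IsHopfBracket h α β z ↔ z = 0 :=
  corollary4p2_general P hm hn h α β z
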